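/- Let $\mathcal H=L^2[0,\infty[$ (complex-valued). For $\alpha\in\mathbb C$ let $L_\alpha=-\partial_x^2+\left(-\tfrac14+\alpha\right)\frac1{x^2}$. Let $L_\alpha^{\min}$ be the closure in $\mathcal H$ of $L_\alpha$ restricted to $C_c^\infty(]0,\infty[)$, and let $L_\alpha^{\max}$ be $L_\alpha$ (in the sense of distributions on $]0,\infty[$) on the domain $\{f\in\mathcal H : L_\alpha f\in\mathcal H\}$. For $m\in\mathbb C$ with $|\operatorname{Re} m|<1$ and $\kappa\in\mathbb C\cup\{\infty\}$ let $H_{m,\kappa}$ be the restriction of $L_{m^2}^{\max}$ to those $f\in \mathrm{Dom}(L_{m^2}^{\max})$ for which there is $c\in\mathbb C$ such that $$f(x)-c\,\bigl(x^{1/2-m}+\kappa x^{1/2+m}\bigr)\in \mathrm{Dom}(L_{m^2}^{\min})\ \text{ around } 0\qquad(\kappa\ne\infty),$$ $$f(x)-c\,x^{1/2+m}\in \mathrm{Dom}(L_{m^2}^{\min})\ \text{ around } 0\qquad(\kappa=\infty),$$ where "around $0$" means: coincides almost everywhere on some interval $]0,\varepsilon[$, $\varepsilon>0$, with an element of that domain.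 Then: 1. If $m\in\,]-1,1[$ and $\kappa\ge 0$ or $\kappa=\infty$, then $H_{m,\kappa}$ has no eigenvalues. 2. If $m\in\,]-1,1[$, $m\neq 0$ and $\kappa<0$, then $H_{m,\kappa}$ has exactly one eigenvalue, namely $$-4\left(\frac{\kappa\,\Gamma(m)}{\Gamma(-m)}\right)^{1/m}.$$ 3. If $m=\mathrm i m_{\mathrm I}$ with $m_{\mathrm I}\in\mathbb R\setminus\{0\}$ and $|\kappa|=1$, then $H_{m,\kappa}$ has infinitely many eigenvalues, which accumulate at $-\infty$ and at $0$: for every $R\in\mathbb R$ there are infinitely many real eigenvalues below $R$, and for every $\varepsilon>0$ infinitely many in $]-\varepsilon,0[$. Moreover, if $\alpha\in\mathbb R$ satisfies $\mathrm e^{\mathrm i\alpha}=\dfrac{\Gamma(-\mathrm i m_{\mathrm I})}{\kappa\,\Gamma(\mathrm i m_{\mathrm I})}$, then the set of eigenvalues is exactly $$\left\{-4\exp\left(-\frac{\alpha+2\pi n}{m_{\mathrm I}}\right) : n\in\mathbb Z\right\}.$$ -/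

import Mathlib

open MeasureTheory Set

noncomputable section

namespace AlmostHomogeneous

/-- Lebesgue measure on the half-line `]0,∞[`. -/
abbrev halfLine : Measure ℝ := volume.restrict (Ioi 0)

/-- The Hilbert space `L²[0,∞[` of complex-valued functions. -/
abbrev L2HalfLine : Type := Lp ℂ 2 halfLine

/-- `φ ∈ C_c^∞(]0,∞[)`, extended by zero to `ℝ`. -/
structure IsTestFunction (φ : ℝ → ℂ) : Prop where
  smooth : ContDiff ℝ ((⊤ : ℕ∞) : WithTop ℕ∞) φ
  compact : HasCompactSupport φ
  support : tsupport φ ⊆ Ioi 0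

/-- The differential expression `L_α φ = -φ'' + (-1/4 + α) x⁻² φ`. -/
def diffExpr (α : ℂ) (φ : ℝ → ℂ) (x : ℝ) : ℂ :=
  -deriv (deriv φ) x + (-(1 / 4) + α) / (x : ℂ) ^ 2 * φ x

/-! ### Elementary facts on test functions -/

theorem IsTestFunction.zero : IsTestFunction (0 : ℝ → ℂ) :=
  ⟨contDiff_const, HasCompactSupport.zero, by simp [tsupport]⟩

theorem IsTestFunction.add {φ ψ : ℝ → ℂ} (hφ : IsTestFunction φ) (hψ : IsTestFunction ψ) :
    IsTestFunction (φ + ψ) :=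
  ⟨hφ.smooth.add hψ.smooth, hφ.compact.add hψ.compact,
    (tsupport_add φ ψ).trans (union_subset hφ.support hψ.support)⟩

theorem IsTestFunction.smul {φ : ℝ → ℂ} (c : ℂ) (hφ : IsTestFunction φ) :
    IsTestFunction (c • φ) :=
  ⟨hφ.smooth.const_smul c, hφ.compact.smul_left (f := fun _ => c),
    (tsupport_smul_subset_right (fun _ => c) φ).trans hφ.support⟩

theorem IsTestFunction.differentiable {φ : ℝ → ℂ} (hφ : IsTestFunction φ) :
    Differentiable ℝ φ := hφ.smooth.differentiable (by simp)

theorem IsTestFunction.deriv {φ : ℝ → ℂ} (hφ : IsTestFunction φ) :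
    IsTestFunction (deriv φ) :=
  ⟨((contDiff_infty_iff_deriv).1 hφ.smooth).2, hφ.compact.deriv,
    tsupport_deriv_subset.trans hφ.support⟩

theorem diffExpr_add (α : ℂ) {φ ψ : ℝ → ℂ} (hφ : IsTestFunction φ) (hψ : IsTestFunction ψ) :
    diffExpr α (φ + ψ) = diffExpr α φ + diffExpr α ψ := by
  have h1 : deriv (φ + ψ) = deriv φ + deriv ψ := by
    ext x; exact deriv_add hφ.differentiable.differentiableAt hψ.differentiable.differentiableAt
  have h2 : deriv (deriv φ + deriv ψ) = deriv (deriv φ) + deriv (deriv ψ) := by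
    ext x
    exact deriv_add hφ.deriv.differentiable.differentiableAt
      hψ.deriv.differentiable.differentiableAt
  ext x
  simp only [diffExpr, h1, h2, Pi.add_apply]
  ring

theorem diffExpr_smul (α c : ℂ) {φ : ℝ → ℂ} (hφ : IsTestFunction φ) :
    diffExpr α (c • φ) = c • diffExpr α φ := by
  have h1 : deriv (c • φ) = c • deriv φ := by
    ext x; exact deriv_const_smul c hφ.differentiable.differentiableAt
  have h2 : deriv (c • deriv φ) = c • deriv (deriv φ) := by
    ext x; exact deriv_const_smul c hφ.deriv.differentiable.differentiableAt
  ext x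
  simp only [diffExpr, h1, h2, Pi.smul_apply, smul_eq_mul]
  ring

theorem IsTestFunction.continuous_potential {φ : ℝ → ℂ} (hφ : IsTestFunction φ) (α : ℂ) :
    Continuous fun x : ℝ => (-(1 / 4) + α) / (x : ℂ) ^ 2 * φ x := by
  rw [continuous_iff_continuousAt]
  intro x
  by_cases hx : x ∈ tsupport φ
  · have h0 : (x : ℂ) ^ 2 ≠ 0 := by
      have : (0 : ℝ) < x := hφ.support hx
      simpa using this.ne'
    refine ContinuousAt.mul (ContinuousAt.div continuousAt_const ?_ h0)
      hφ.smooth.continuous.continuousAt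
    exact (Complex.continuous_ofReal.pow 2).continuousAt
  · have h := notMem_tsupport_iff_eventuallyEq.1 hx
    refine (continuousAt_const (y := (0 : ℂ))).congr ?_
    filter_upwards [h] with y hy
    simp [hy]

theorem IsTestFunction.continuous_diffExpr {φ : ℝ → ℂ} (hφ : IsTestFunction φ) (α : ℂ) :
    Continuous (diffExpr α φ) :=
  hφ.deriv.deriv.smooth.continuous.neg.add (hφ.continuous_potential α)

theorem IsTestFunction.compact_diffExpr {φ : ℝ → ℂ} (hφ : IsTestFunction φ) (α : ℂ) :
    HasCompactSupport (diffExpr α φ) :=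
  hφ.deriv.deriv.compact.neg.add
    (hφ.compact.mul_left (f := fun x : ℝ => (-(1 / 4) + α) / (x : ℂ) ^ 2))


theorem integrable_pairing {ψ : ℝ → ℂ} (hψ : Continuous ψ) (hc : HasCompactSupport ψ)
    (f : L2HalfLine) : Integrable (fun x => f x * ψ x) halfLine :=
  (Lp.memLp f).integrable_mul
    (show MemLp ψ 2 halfLine from hψ.memLp_of_hasCompactSupport hc)

theorem continuous_pairing {ψ : ℝ → ℂ} (hψ : Continuous ψ) (hc : HasCompactSupport ψ) :
    Continuous fun f : L2HalfLine => ∫ x, f x * ψ x ∂halfLine := by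
  have hm : MemLp (fun x => (starRingEnd ℂ) (ψ x)) 2 halfLine :=
    (Complex.continuous_conj.comp hψ).memLp_of_hasCompactSupport
      (hc.comp_left (g := (starRingEnd ℂ)) (map_zero _))
  have key : (fun f : L2HalfLine => ∫ x, f x * ψ x ∂halfLine) =
      fun f => inner ℂ (hm.toLp _) f := by
    ext f
    rw [L2.inner_def]
    refine integral_congr_ae ?_
    filter_upwards [hm.coeFn_toLp] with x hx
    simp [hx]
  rw [key]
  exact continuous_const.inner continuous_id

/-! ### The maximal operator -/

/-- The graph of the maximal operator: pairs `(f, g)` in `L² × L²` with `L_α f = g` in the sense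
of distributions on `]0,∞[`. -/
def maxGraph (α : ℂ) : Submodule ℂ (L2HalfLine × L2HalfLine) where
  carrier := {p | ∀ φ : ℝ → ℂ, IsTestFunction φ →
    ∫ x, p.1 x * diffExpr α φ x ∂halfLine = ∫ x, p.2 x * φ x ∂halfLine}
  zero_mem' := by
    intro φ _
    have h : ∀ ψ : ℝ → ℂ, ∫ x, (0 : L2HalfLine) x * ψ x ∂halfLine = 0 := by
      intro ψ
      refine integral_eq_zero_of_ae ?_
      filter_upwards [Lp.coeFn_zero ℂ 2 halfLine] with x hx
      rw [hx, Pi.zero_apply, zero_mul]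
    exact (h _).trans (h _).symm
  add_mem' := by
    rintro p q hp hq φ hφ
    have h : ∀ (u v : L2HalfLine) (ψ : ℝ → ℂ), Continuous ψ → HasCompactSupport ψ →
        ∫ x, (u + v : L2HalfLine) x * ψ x ∂halfLine =
          ∫ x, u x * ψ x ∂halfLine + ∫ x, v x * ψ x ∂halfLine := by
      intro u v ψ hψ hc
      rw [← integral_add (integrable_pairing hψ hc u) (integrable_pairing hψ hc v)]
      refine integral_congr_ae ?_
      filter_upwards [Lp.coeFn_add u v] with x hx
      rw [hx, Pi.add_apply, add_mul]
    rw [Prod.fst_add, Prod.snd_add, h _ _ _ (hφ.continuous_diffExpr α) (hφ.compact_diffExpr α),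
      h _ _ _ hφ.smooth.continuous hφ.compact, hp φ hφ, hq φ hφ]
  smul_mem' := by
    rintro c p hp φ hφ
    have h : ∀ (u : L2HalfLine) (ψ : ℝ → ℂ),
        ∫ x, (c • u : L2HalfLine) x * ψ x ∂halfLine = c * ∫ x, u x * ψ x ∂halfLine := by
      intro u ψ
      rw [← integral_const_mul]
      refine integral_congr_ae ?_
      filter_upwards [Lp.coeFn_smul c u] with x hx
      rw [hx, Pi.smul_apply, smul_eq_mul, mul_assoc]
    rw [Prod.smul_fst, Prod.smul_snd, h, h, hp φ hφ]

theorem maxGraph_single_valued (α : ℂ) (p : L2HalfLine × L2HalfLine) (hp : p ∈ maxGraph α)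
    (h0 : p.1 = 0) : p.2 = 0 := by
  have hloc : LocallyIntegrableOn (p.2 : ℝ → ℂ) (Ioi 0) volume := by
    intro x _
    have h1 : LocallyIntegrable (p.2 : ℝ → ℂ) halfLine :=
      (Lp.memLp p.2).locallyIntegrable (by norm_num)
    obtain ⟨u, hu, hi⟩ := h1 x
    refine ⟨u ∩ Ioi 0, Filter.inter_mem (mem_nhdsWithin_of_mem_nhds hu) self_mem_nhdsWithin, ?_⟩
    rwa [IntegrableOn, Measure.restrict_restrict₀' measurableSet_Ioi.nullMeasurableSet] at hi
  have key := isOpen_Ioi.ae_eq_zero_of_integral_contDiff_smul_eq_zero hloc (by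
    intro g hg hc hs
    have hφ : IsTestFunction (fun x => (g x : ℂ)) := by
      refine ⟨Complex.ofRealCLM.contDiff.comp hg,
        hc.comp_left (g := fun y : ℝ => (y : ℂ)) Complex.ofReal_zero, ?_⟩
      refine (closure_mono ?_).trans hs
      intro x hx h
      exact hx (by simp [h])
    have h := hp _ hφ
    have hz : ∫ x, p.1 x * diffExpr α (fun x => (g x : ℂ)) x ∂halfLine = 0 := by
      rw [h0]
      refine integral_eq_zero_of_ae ?_
      filter_upwards [Lp.coeFn_zero ℂ 2 halfLine] with x hx
      rw [hx, Pi.zero_apply, zero_mul]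
    rw [hz] at h
    rw [← setIntegral_eq_integral_of_forall_compl_eq_zero (s := Ioi 0), h]
    · refine integral_congr_ae (Filter.Eventually.of_forall fun x => ?_)
      simp [mul_comm]
    · intro x hx
      have : g x = 0 := image_eq_zero_of_notMem_tsupport fun h => hx (hs h)
      simp [this])
  refine Lp.ext ?_
  have h2 : (p.2 : ℝ → ℂ) =ᵐ[halfLine] 0 := (ae_restrict_iff' measurableSet_Ioi).2 key
  exact h2.trans (Lp.coeFn_zero ℂ 2 halfLine).symm

/-- The maximal operator `L_α^max`: its domain is `{f ∈ L² | L_α f ∈ L²}`, where `L_α f` is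
computed as a distribution on `]0,∞[`. -/
def maxOp (α : ℂ) : L2HalfLine →ₗ.[ℂ] L2HalfLine := (maxGraph α).toLinearPMap

theorem maxOp_graph (α : ℂ) : (maxOp α).graph = maxGraph α :=
  Submodule.toLinearPMap_graph_eq _ (maxGraph_single_valued α)

theorem maxOp_isClosed (α : ℂ) : (maxOp α).IsClosed := by
  rw [LinearPMap.IsClosed, maxOp_graph]
  have : (maxGraph α : Set (L2HalfLine × L2HalfLine)) =
      ⋂ (φ : ℝ → ℂ) (_ : IsTestFunction φ), {p | ∫ x, p.1 x * diffExpr α φ x ∂halfLine =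
        ∫ x, p.2 x * φ x ∂halfLine} := by
    ext p; simp [maxGraph]
  rw [this]
  refine isClosed_iInter fun φ => isClosed_iInter fun hφ => isClosed_eq ?_ ?_
  · exact (continuous_pairing (hφ.continuous_diffExpr α) (hφ.compact_diffExpr α)).comp
      continuous_fst
  · exact (continuous_pairing hφ.smooth.continuous hφ.compact).comp continuous_snd

/-! ### The minimal operator -/

/-- The graph of `L_α` on `C_c^∞(]0,∞[)`. -/
def testGraph (α : ℂ) : Submodule ℂ (L2HalfLine × L2HalfLine) where
  carrier := {p | ∃ φ : ℝ → ℂ, IsTestFunction φ ∧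
    p.1 =ᵐ[halfLine] φ ∧ p.2 =ᵐ[halfLine] diffExpr α φ}
  zero_mem' := by
    refine ⟨0, IsTestFunction.zero, Lp.coeFn_zero ℂ 2 halfLine, ?_⟩
    have : diffExpr α 0 = 0 := by
      simpa using diffExpr_smul α 0 IsTestFunction.zero
    rw [this]
    exact Lp.coeFn_zero ℂ 2 halfLine
  add_mem' := by
    rintro p q ⟨φ, hφ, h1, h2⟩ ⟨ψ, hψ, h3, h4⟩
    refine ⟨φ + ψ, hφ.add hψ, (Lp.coeFn_add _ _).trans (h1.add h3), ?_⟩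
    rw [diffExpr_add α hφ hψ]
    exact (Lp.coeFn_add _ _).trans (h2.add h4)
  smul_mem' := by
    rintro c p ⟨φ, hφ, h1, h2⟩
    refine ⟨c • φ, hφ.smul c, (Lp.coeFn_smul _ _).trans (h1.const_smul c), ?_⟩
    rw [diffExpr_smul α c hφ]
    exact (Lp.coeFn_smul _ _).trans (h2.const_smul c)

/-- Integration by parts: `L_α` is symmetric with respect to the bilinear pairing. -/
theorem integral_diffExpr_mul (α : ℂ) {φ ψ : ℝ → ℂ} (hφ : IsTestFunction φ)
    (hψ : IsTestFunction ψ) :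
    ∫ x, φ x * diffExpr α ψ x ∂halfLine = ∫ x, diffExpr α φ x * ψ x ∂halfLine := by
  have hint : ∀ {u v : ℝ → ℂ}, IsTestFunction u → IsTestFunction v → Integrable (u * v) := by
    intro u v hu hv
    exact (hu.smooth.continuous.mul hv.smooth.continuous).integrable_of_hasCompactSupport
      hv.compact.mul_left
  have hd : ∀ {u : ℝ → ℂ}, IsTestFunction u → ∀ x, HasDerivAt u (deriv u x) x :=
    fun hu x => hu.differentiable.differentiableAt.hasDerivAt
  have e1 : ∫ x, φ x * deriv (deriv ψ) x = -∫ x, deriv φ x * deriv ψ x :=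
    integral_mul_deriv_eq_deriv_mul_of_integrable (fun x _ => hd hφ x)
      (fun x _ => hd hψ.deriv x) (hint hφ hψ.deriv.deriv) (hint hφ.deriv hψ.deriv)
      (hint hφ hψ.deriv)
  have e2 : ∫ x, deriv φ x * deriv ψ x = -∫ x, deriv (deriv φ) x * ψ x :=
    integral_mul_deriv_eq_deriv_mul_of_integrable (fun x _ => hd hφ.deriv x)
      (fun x _ => hd hψ x) (hint hφ.deriv hψ.deriv) (hint hφ.deriv.deriv hψ) (hint hφ.deriv hψ)
  have e3 : ∫ x, φ x * deriv (deriv ψ) x = ∫ x, deriv (deriv φ) x * ψ x := by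
    rw [e1, e2, neg_neg]
  have hpot : Integrable fun x : ℝ => φ x * ((-(1 / 4) + α) / (x : ℂ) ^ 2 * ψ x) :=
    (hφ.smooth.continuous.mul (hψ.continuous_potential α)).integrable_of_hasCompactSupport
      (hφ.compact.mul_right)
  rw [setIntegral_eq_integral_of_forall_compl_eq_zero,
    setIntegral_eq_integral_of_forall_compl_eq_zero]
  · have l : ∫ x, φ x * diffExpr α ψ x = -(∫ x, φ x * deriv (deriv ψ) x) +
        ∫ x : ℝ, φ x * ((-(1 / 4) + α) / (x : ℂ) ^ 2 * ψ x) := by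
      rw [← integral_neg, ← integral_add (f := fun x => -(φ x * deriv (deriv ψ) x)) (hint hφ hψ.deriv.deriv).neg hpot]
      refine integral_congr_ae (Filter.Eventually.of_forall fun x => ?_)
      simp only [diffExpr]; ring
    have r : ∫ x, diffExpr α φ x * ψ x = -(∫ x, deriv (deriv φ) x * ψ x) +
        ∫ x : ℝ, φ x * ((-(1 / 4) + α) / (x : ℂ) ^ 2 * ψ x) := by
      rw [← integral_neg, ← integral_add (f := fun x => -(deriv (deriv φ) x * ψ x)) (hint hφ.deriv.deriv hψ).neg hpot]
      refine integral_congr_ae (Filter.Eventually.of_forall fun x => ?_)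
      simp only [diffExpr]; ring
    rw [l, r, e3]
  · intro x hx
    have : ψ x = 0 := image_eq_zero_of_notMem_tsupport fun h => hx (hψ.support h)
    simp [this]
  · intro x hx
    have : φ x = 0 := image_eq_zero_of_notMem_tsupport fun h => hx (hφ.support h)
    simp [this]

theorem testGraph_le_maxGraph (α : ℂ) : testGraph α ≤ maxGraph α := by
  rintro p ⟨φ, hφ, h1, h2⟩ ψ hψ
  calc ∫ x, p.1 x * diffExpr α ψ x ∂halfLine = ∫ x, φ x * diffExpr α ψ x ∂halfLine :=
        integral_congr_ae (by filter_upwards [h1] with x hx; simp [hx])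
    _ = ∫ x, diffExpr α φ x * ψ x ∂halfLine := integral_diffExpr_mul α hφ hψ
    _ = ∫ x, p.2 x * ψ x ∂halfLine :=
        integral_congr_ae (by filter_upwards [h2] with x hx; simp [hx])

/-- The operator `L_α` with domain `C_c^∞(]0,∞[)`. -/
def testOp (α : ℂ) : L2HalfLine →ₗ.[ℂ] L2HalfLine := (testGraph α).toLinearPMap

theorem testOp_graph (α : ℂ) : (testOp α).graph = testGraph α :=
  Submodule.toLinearPMap_graph_eq _ fun p hp =>
    maxGraph_single_valued α p (testGraph_le_maxGraph α hp)

theorem testOp_isClosable (α : ℂ) : (testOp α).IsClosable :=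
  (maxOp_isClosed α).isClosable.leIsClosable <| LinearPMap.le_of_le_graph <| by
    rw [testOp_graph, maxOp_graph]; exact testGraph_le_maxGraph α

/-- The minimal operator `L_α^min`: the closure of `L_α` on `C_c^∞(]0,∞[)`. -/
def minOp (α : ℂ) : L2HalfLine →ₗ.[ℂ] L2HalfLine := (testOp α).closure

/-! ### The operators `H_{m,κ}` -/

/-- The function prescribing the behaviour at `0`: `x^{1/2-m} + κ x^{1/2+m}` for `κ ∈ ℂ`, and
`x^{1/2+m}` for `κ = ∞`. -/
def boundaryFun (m : ℂ) : OnePoint ℂ → ℝ → ℂ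
  | OnePoint.infty => fun x => (x : ℂ) ^ (1 / 2 + m)
  | OnePoint.some κ => fun x => (x : ℂ) ^ (1 / 2 - m) + κ * (x : ℂ) ^ (1 / 2 + m)

/-- The boundary condition: for some `c`, the function `f - c (x^{1/2-m} + κ x^{1/2+m})` (with the
usual meaning for `κ = ∞`) belongs to `Dom(L_{m²}^min)` around `0`, that is, it coincides on some
interval `]0,ε[` with an element of `Dom(L_{m²}^min)`. -/
def boundarySpace (m : ℂ) (κ : OnePoint ℂ) : Submodule ℂ L2HalfLine where
  carrier := {f | ∃ c : ℂ, ∃ h ∈ (minOp (m ^ 2)).domain, ∃ ε : ℝ, 0 < ε ∧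
    ∀ᵐ x ∂halfLine, x < ε → f x - c * boundaryFun m κ x = h x}
  zero_mem' := by
    refine ⟨0, 0, Submodule.zero_mem _, 1, one_pos, ?_⟩
    filter_upwards with x hx
    simp
  add_mem' := by
    rintro f g ⟨c, h, hh, ε, hε, hf⟩ ⟨d, k, hk, δ, hδ, hg⟩
    refine ⟨c + d, h + k, Submodule.add_mem _ hh hk, min ε δ, lt_min hε hδ, ?_⟩
    filter_upwards [hf, hg, Lp.coeFn_add f g, Lp.coeFn_add h k] with x h1 h2 h3 h4 hx
    rw [h3, h4, Pi.add_apply, Pi.add_apply, ← h1 (hx.trans_le (min_le_left _ _)),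
      ← h2 (hx.trans_le (min_le_right _ _))]
    ring
  smul_mem' := by
    rintro a f ⟨c, h, hh, ε, hε, hf⟩
    refine ⟨a * c, a • h, Submodule.smul_mem _ _ hh, ε, hε, ?_⟩
    filter_upwards [hf, Lp.coeFn_smul a f, Lp.coeFn_smul a h] with x h1 h3 h4 hx
    rw [h3, h4, Pi.smul_apply, Pi.smul_apply, ← h1 hx, smul_eq_mul, smul_eq_mul]
    ring

/-- The almost homogeneous Schrödinger operator `H_{m,κ}` (for `|Re m| < 1`): the restriction of
`L_{m²}^max` to the functions satisfying the boundary condition at `0`. -/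
def almostHomOp (m : ℂ) (κ : OnePoint ℂ) : L2HalfLine →ₗ.[ℂ] L2HalfLine :=
  (maxOp (m ^ 2)).domRestrict (boundarySpace m κ)

/-- The set of eigenvalues of an unbounded operator. -/
def eigenvalues (T : L2HalfLine →ₗ.[ℂ] L2HalfLine) : Set ℂ :=
  {z | ∃ f : T.domain, (f : L2HalfLine) ≠ 0 ∧ T f = z • (f : L2HalfLine)}

end AlmostHomogeneous

end

/-! ### Classical solutions, distributional derivatives and elliptic regularity -/

open Filter Topology

noncomputable section

namespace AlmostHomogeneous

/-! Since `|Re m| < 1`, all solutions of `L u = 0`, with `L = L_{m²}`, are square integrable near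
`0`, and membership in the minimal domain around `0` can be tested by Wronskians. If `D` coincides
near `0` with an element of that domain, then `W(D, u) → 0` at `0` for every such `u`
(`tendsto_wronskian_of_mem_minOp_graph`). Conversely, for `m ≠ 0`, if `L D = z K` with `K` of power
growth at `0` and the Wronskians of `D` with `x^{1/2±m}` tend to `0`, then `D` and `D'` are so small
that cutting off near `0` converges in the graph norm (`exists_norm_le_of_tendsto_wronskian`,
`exists_mem_minOp_domain`).

An eigenvector is a classical solution `F` by elliptic regularity (`exists_isC2_of_mem_maxGraph`). A
positive energy is excluded by an almost conserved energy functional, a nonreal one because the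
boundary condition is self-adjoint in each case considered, so that `W(F, F̄)` vanishes at both
ends. At energy `0`, `F` would be a multiple of the boundary function, which is not square
integrable at infinity.

At energy `-4β` with `β > 0`, the square integrable solutions at infinity are the multiples of `√x
K_m(2√β x)`, with `K_m` the Macdonald function. Up to a constant this is `decaying`, built on the
integral `∫ exp(-t - y/t) t^{-m-1} dt`. From the integral one reads the limits at `0` of its
Wronskians: `2 β^{-m} Γ(1+m)` with `x^{1/2+m}` and `2 Γ(1-m)` with `x^{1/2-m}`. For the boundary
function `x^{1/2-m} + κ x^{1/2+m}` they are `2m` and `-2mκ`. For `m ≠ 0`, proportionality of the two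
pairs is the eigenvalue equation `κ β^{-m} Γ(1+m) + Γ(1-m) = 0`.

For real `m` both Gamma values are positive, so there is a root only if `κ < 0`, and it is then
unique. For `m = iμ` the equation reads `exp(-iμ log β) = exp(iα)`, whose roots form a geometric
progression in `β`. For `κ = ∞`, and for `m = 0`, the boundary function is a multiple of
`x^{1/2+m}`; its Wronskian with `x^{1/2+m}` is zero while that of `decaying` tends to a nonzero
limit, so nothing survives. -/

/-- `F` is twice continuously differentiable on `]0,∞[` with derivatives `F₁` and `F₂`. -/
structure IsC2 (F F₁ F₂ : ℝ → ℂ) : Prop where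
  hasDerivAt : ∀ x, 0 < x → HasDerivAt F (F₁ x) x
  hasDerivAt' : ∀ x, 0 < x → HasDerivAt F₁ (F₂ x) x
  continuousOn : ContinuousOn F₂ (Ioi 0)

/-- The potential `(-1/4 + α) x⁻²`. -/
def potential (α : ℂ) (x : ℝ) : ℂ := (-(1 / 4) + α) / (x : ℂ) ^ 2

theorem continuousOn_potential (α : ℂ) : ContinuousOn (potential α) (Ioi 0) := by
  refine ContinuousOn.div continuousOn_const (by fun_prop) ?_
  intro x hx
  have : (0 : ℝ) < x := hx
  simpa using this.ne'

theorem IsC2.continuousOn_zero {F F₁ F₂ : ℝ → ℂ} (h : IsC2 F F₁ F₂) : ContinuousOn F (Ioi 0) :=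
  fun x hx => (h.hasDerivAt x hx).continuousAt.continuousWithinAt

theorem IsC2.continuousOn_one {F F₁ F₂ : ℝ → ℂ} (h : IsC2 F F₁ F₂) : ContinuousOn F₁ (Ioi 0) :=
  fun x hx => (h.hasDerivAt' x hx).continuousAt.continuousWithinAt

/-- The Wronskian of two functions with given derivatives. -/
def wronskian (F F₁ G G₁ : ℝ → ℂ) (x : ℝ) : ℂ := F x * G₁ x - F₁ x * G x

theorem IsC2.hasDerivAt_wronskian {F F₁ F₂ G G₁ G₂ : ℝ → ℂ} (hF : IsC2 F F₁ F₂)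
    (hG : IsC2 G G₁ G₂) {x : ℝ} (hx : 0 < x) :
    HasDerivAt (wronskian F F₁ G G₁) (F x * G₂ x - F₂ x * G x) x := by
  have h := ((hF.hasDerivAt x hx).mul (hG.hasDerivAt' x hx)).sub
    ((hF.hasDerivAt' x hx).mul (hG.hasDerivAt x hx))
  convert! h using 1
  ring

/-- The interval is open so that `φ` and its derivatives vanish at `a` and `b` themselves, which
removes the boundary terms from integrations by parts. -/
theorem IsTestFunction.exists_Ioo {φ : ℝ → ℂ} (hφ : IsTestFunction φ) :
    ∃ a b : ℝ, 0 < a ∧ a < b ∧ tsupport φ ⊆ Ioo a b := by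
  rcases (tsupport φ).eq_empty_or_nonempty with h | h
  · exact ⟨1, 2, by norm_num, by norm_num, by simp [h]⟩
  · have hc : IsCompact (tsupport φ) := hφ.compact
    obtain ⟨a, ha, ha'⟩ := hc.exists_isLeast h
    obtain ⟨b, hb, hb'⟩ := hc.exists_isGreatest h
    have h0 : 0 < a := hφ.support ha
    refine ⟨a / 2, b + 1, by positivity, by linarith [ha' hb], fun x hx => ⟨?_, ?_⟩⟩
    · linarith [ha' hx]
    · linarith [hb' hx]

theorem integral_halfLine_eq_interval {f : ℝ → ℂ} {a b : ℝ} (ha : 0 ≤ a) (hab : a ≤ b)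
    (hf : ∀ x, x ∉ Ioo a b → f x = 0) : ∫ x, f x ∂halfLine = ∫ x in a..b, f x := by
  rw [intervalIntegral.integral_of_le hab, setIntegral_eq_integral_of_forall_compl_eq_zero,
    setIntegral_eq_integral_of_forall_compl_eq_zero]
  · exact fun x hx => hf x fun h => hx ⟨h.1, h.2.le⟩
  · exact fun x hx => hf x fun h => hx (ha.trans_lt h.1)

theorem deriv_eq_zero_of_notMem_tsupport {φ : ℝ → ℂ} {x : ℝ} (hx : x ∉ tsupport φ) :
    deriv φ x = 0 :=
  image_eq_zero_of_notMem_tsupport fun h => hx (tsupport_deriv_subset h)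

theorem isC2_of_isTestFunction {φ : ℝ → ℂ} (hφ : IsTestFunction φ) :
    IsC2 φ (deriv φ) (deriv (deriv φ)) :=
  ⟨fun _ _ => hφ.differentiable.differentiableAt.hasDerivAt,
    fun _ _ => hφ.deriv.differentiable.differentiableAt.hasDerivAt,
    hφ.deriv.deriv.smooth.continuous.continuousOn⟩

theorem Icc_subset_Ioi_zero {a b : ℝ} (ha : 0 < a) : Icc a b ⊆ Ioi 0 :=
  fun _ hx => ha.trans_le hx.1

/-- Green's identity on a compact interval. -/
theorem IsC2.integral_green {F F₁ F₂ G G₁ G₂ : ℝ → ℂ} (hF : IsC2 F F₁ F₂) (hG : IsC2 G G₁ G₂)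
    {a b : ℝ} (ha : 0 < a) (hab : a ≤ b) :
    ∫ x in a..b, (F x * G₂ x - F₂ x * G x) = wronskian F F₁ G G₁ b - wronskian F F₁ G G₁ a := by
  have hs : uIcc a b ⊆ Ioi 0 := by rw [uIcc_of_le hab]; exact Icc_subset_Ioi_zero ha
  refine intervalIntegral.integral_eq_sub_of_hasDerivAt
    (fun x hx => hF.hasDerivAt_wronskian hG (hs hx)) (ContinuousOn.intervalIntegrable ?_)
  exact ((hF.continuousOn_zero.mul hG.continuousOn).sub
    (hF.continuousOn.mul hG.continuousOn_zero)).mono hs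

/-- Classical derivatives on `]0,∞[` are distributional derivatives. -/
theorem IsC2.integral_mul_deriv_deriv {F F₁ F₂ : ℝ → ℂ} (hF : IsC2 F F₁ F₂) {φ : ℝ → ℂ}
    (hφ : IsTestFunction φ) :
    ∫ x, F x * deriv (deriv φ) x ∂halfLine = ∫ x, F₂ x * φ x ∂halfLine := by
  obtain ⟨a, b, ha, hab, hs⟩ := hφ.exists_Ioo
  have z0 : ∀ x, x ∉ Ioo a b → φ x = 0 := fun x hx =>
    image_eq_zero_of_notMem_tsupport fun h => hx (hs h)
  have z1 : ∀ x, x ∉ Ioo a b → deriv φ x = 0 := fun x hx =>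
    deriv_eq_zero_of_notMem_tsupport fun h => hx (hs h)
  have z2 : ∀ x, x ∉ Ioo a b → deriv (deriv φ) x = 0 := fun x hx =>
    deriv_eq_zero_of_notMem_tsupport fun h => hx (hs (tsupport_deriv_subset h))
  have hu : uIcc a b ⊆ Ioi 0 := by rw [uIcc_of_le hab.le]; exact Icc_subset_Ioi_zero ha
  rw [integral_halfLine_eq_interval ha.le hab.le fun x hx => by rw [z2 x hx, mul_zero],
    integral_halfLine_eq_interval ha.le hab.le fun x hx => by rw [z0 x hx, mul_zero],
    ← sub_eq_zero, ← intervalIntegral.integral_sub, hF.integral_green (isC2_of_isTestFunction hφ) ha hab.le]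
  · simp [wronskian, z0 a (by simp), z0 b (by simp), z1 a (by simp), z1 b (by simp)]
  · exact ((hF.continuousOn_zero.mul (isC2_of_isTestFunction hφ).continuousOn).mono hu).intervalIntegrable
  · exact ((hF.continuousOn.mul (isC2_of_isTestFunction hφ).continuousOn_zero).mono hu).intervalIntegrable

theorem integrable_mul_testFunction {f : ℝ → ℂ} (hf : LocallyIntegrableOn f (Ioi 0))
    {φ : ℝ → ℂ} (hφ : IsTestFunction φ) : Integrable (fun x => f x * φ x) halfLine := by
  have h1 : IntegrableOn f (tsupport φ) :=
    hf.integrableOn_compact_subset hφ.support hφ.compact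
  have h2 : IntegrableOn (fun x => f x * φ x) (tsupport φ) :=
    h1.mul_continuousOn hφ.smooth.continuous.continuousOn hφ.compact
  have h3 : Integrable (fun x => f x * φ x) :=
    (integrableOn_iff_integrable_of_support_subset fun x hx => by
      by_contra h
      exact hx (by simp [image_eq_zero_of_notMem_tsupport h])).1 h2
  exact h3.mono_measure Measure.restrict_le_self

theorem locallyIntegrableOn_of_L2 (f : L2HalfLine) :
    LocallyIntegrableOn (f : ℝ → ℂ) (Ioi 0) volume := by
  intro x _
  have h1 : LocallyIntegrable (f : ℝ → ℂ) halfLine :=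
    (Lp.memLp f).locallyIntegrable (by norm_num)
  obtain ⟨u, hu, hi⟩ := h1 x
  refine ⟨u ∩ Ioi 0, Filter.inter_mem (mem_nhdsWithin_of_mem_nhds hu) self_mem_nhdsWithin, ?_⟩
  rwa [IntegrableOn, Measure.restrict_restrict₀' measurableSet_Ioi.nullMeasurableSet] at hi

/-- A locally integrable function on an open subset of `]0,∞[` is determined by its pairing with
test functions. -/
theorem ae_eq_zero_of_integral_testFunction {f : ℝ → ℂ} {U : Set ℝ} (hU : IsOpen U)
    (hU0 : U ⊆ Ioi 0) (hf : LocallyIntegrableOn f U)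
    (h : ∀ φ, IsTestFunction φ → tsupport φ ⊆ U → ∫ x, f x * φ x ∂halfLine = 0) :
    ∀ᵐ x, x ∈ U → f x = 0 := by
  refine hU.ae_eq_zero_of_integral_contDiff_smul_eq_zero hf fun g hg hc hs => ?_
  have hs' : tsupport (fun x => (g x : ℂ)) ⊆ tsupport g := by
    refine closure_mono fun x hx h => hx (by simp [h])
  have hφ : IsTestFunction (fun x => (g x : ℂ)) :=
    ⟨Complex.ofRealCLM.contDiff.comp hg,
      hc.comp_left (g := fun y : ℝ => (y : ℂ)) Complex.ofReal_zero, hs'.trans (hs.trans hU0)⟩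
  rw [← h _ hφ (hs'.trans hs), setIntegral_eq_integral_of_forall_compl_eq_zero]
  · exact integral_congr_ae (.of_forall fun x => by simp [mul_comm])
  · intro x hx
    have : g x = 0 := image_eq_zero_of_notMem_tsupport fun h => hx (hU0 (hs h))
    simp [this]

/-- A test function with vanishing integral has a primitive which is a test function. -/
theorem exists_primitive_of_isTestFunction {ψ : ℝ → ℂ} (hψ : IsTestFunction ψ)
    (h0 : ∫ x, ψ x ∂halfLine = 0) : ∃ φ : ℝ → ℂ, IsTestFunction φ ∧ deriv φ = ψ := by
  obtain ⟨a, b, ha, hab, hs⟩ := hψ.exists_Ioo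
  have z0 : ∀ x, x ∉ Ioo a b → ψ x = 0 := fun x hx =>
    image_eq_zero_of_notMem_tsupport fun h => hx (hs h)
  have hc := hψ.smooth.continuous
  have hd : ∀ x, HasDerivAt (fun x => ∫ t in a..x, ψ t) (ψ x) x := fun x =>
    intervalIntegral.integral_hasDerivAt_right (hc.intervalIntegrable _ _)
      hc.stronglyMeasurable.stronglyMeasurableAtFilter hc.continuousAt
  have hderiv : deriv (fun x => ∫ t in a..x, ψ t) = ψ := funext fun x => (hd x).deriv
  rw [integral_halfLine_eq_interval ha.le hab.le z0] at h0
  have hsup : ∀ x, x ∉ Icc a b → ∫ t in a..x, ψ t = 0 := by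
    intro x hx
    rcases lt_or_ge x a with h | h
    · rw [intervalIntegral.integral_congr (g := fun _ => 0) (fun t ht => z0 t ?_)]
      · simp
      · rw [uIcc_of_ge h.le] at ht
        exact fun h' => absurd h'.1 (not_lt.2 ht.2)
    · have hb : b < x := not_le.1 fun h' => hx ⟨h, h'⟩
      rw [← intervalIntegral.integral_add_adjacent_intervals (hc.intervalIntegrable a b)
        (hc.intervalIntegrable b x), h0,
        intervalIntegral.integral_congr (a := b) (g := fun _ => 0) (fun t ht => z0 t ?_)]
      · simp
      · rw [uIcc_of_le hb.le] at ht
        exact fun h' => absurd h'.2 (not_lt.2 ht.1)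
  have hts : tsupport (fun x => ∫ t in a..x, ψ t) ⊆ Icc a b :=
    closure_minimal (fun x hx => by_contra fun h => hx (hsup x h)) isClosed_Icc
  refine ⟨_, ⟨?_, isCompact_Icc.of_isClosed_subset (isClosed_tsupport _) hts,
    hts.trans (Icc_subset_Ioi_zero ha)⟩, hderiv⟩
  rw [contDiff_infty_iff_deriv, hderiv]
  exact ⟨fun x => (hd x).differentiableAt, hψ.smooth⟩

/-- Otherwise, by scaling, every test function would have integral `0`, and the constant `1` would
vanish almost everywhere on the half-line. -/
theorem exists_testFunction_integral_eq_one :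
    ∃ η, IsTestFunction η ∧ ∫ x, η x ∂halfLine = 1 := by
  by_contra! hne
  have hz : ∀ φ, IsTestFunction φ → ∫ x, φ x ∂halfLine = 0 := by
    intro φ hφ
    by_contra h
    refine hne _ (hφ.smul (∫ x, φ x ∂halfLine)⁻¹) ?_
    simp only [Pi.smul_apply, smul_eq_mul]
    rw [integral_const_mul, inv_mul_cancel₀ h]
  have := ae_eq_zero_of_integral_testFunction (f := fun _ => 1) isOpen_Ioi subset_rfl
    (continuousOn_const.locallyIntegrableOn measurableSet_Ioi)
    (fun φ hφ _ => by simpa using hz φ hφ)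
  have h2 : volume (Ioi (0 : ℝ)) = 0 := by
    rw [ae_iff] at this
    simpa [Set.Ioi] using this
  simp at h2

/-- A locally integrable function with vanishing distributional derivative is constant. -/
theorem ae_eq_const_of_integral_mul_deriv {f : ℝ → ℂ} (hf : LocallyIntegrableOn f (Ioi 0))
    (h : ∀ φ : ℝ → ℂ, IsTestFunction φ → ∫ x, f x * deriv φ x ∂halfLine = 0) :
    ∃ c : ℂ, f =ᵐ[halfLine] fun _ => c := by
  obtain ⟨η, hη, h1⟩ := exists_testFunction_integral_eq_one
  set c := ∫ x, f x * η x ∂halfLine with hc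
  refine ⟨c, (ae_restrict_iff' measurableSet_Ioi).2 ?_⟩
  have hl : LocallyIntegrableOn (fun x => f x - c) (Ioi 0) :=
    hf.sub (continuousOn_const.locallyIntegrableOn measurableSet_Ioi)
  have hi : ∀ {ψ : ℝ → ℂ}, IsTestFunction ψ → Integrable ψ halfLine := fun {ψ} hψ =>
    (hψ.smooth.continuous.integrable_of_hasCompactSupport hψ.compact).mono_measure
      Measure.restrict_le_self
  have key := ae_eq_zero_of_integral_testFunction isOpen_Ioi subset_rfl hl (by
    intro ψ hψ _
    set J := ∫ x, ψ x ∂halfLine with hJ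
    -- Subtracting `J η` makes the integral zero, so the difference is the derivative of a test
    -- function and the hypothesis applies to it.
    have hψ' : IsTestFunction (ψ + (-J) • η) := hψ.add (hη.smul _)
    obtain ⟨φ, hφ, hd⟩ := exists_primitive_of_isTestFunction hψ' (by
      simp only [Pi.add_apply, Pi.smul_apply, smul_eq_mul]
      rw [integral_add (hi hψ) ((hi hη).const_mul _), integral_const_mul, h1, ← hJ]
      ring)
    have e := h φ hφ
    rw [hd] at e
    simp only [Pi.add_apply, Pi.smul_apply, smul_eq_mul, mul_add] at e
    have e2 : ∀ x, f x * (-J * η x) = -J * (f x * η x) := fun x => by ring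
    simp only [e2] at e
    rw [integral_add (integrable_mul_testFunction hf hψ)
      ((integrable_mul_testFunction hf hη).const_mul _), integral_const_mul, ← hc] at e
    simp only [sub_mul]
    rw [integral_sub (integrable_mul_testFunction hf hψ) ((hi hψ).const_mul c),
      integral_const_mul, ← hJ]
    linear_combination e)
  filter_upwards [key] with x hx h
  exact sub_eq_zero.1 (hx h)

/-- A primitive of a merely integrable function is differentiable only almost everywhere; absolute
continuity is what makes a derivative vanishing almost everywhere force constancy. Real and
imaginary parts are treated separately and recombined. -/
theorem absolutelyContinuousOnInterval_integral {r : ℝ → ℂ} {a b c : ℝ}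
    (h : IntervalIntegrable r volume a b) (hc : c ∈ uIcc a b) :
    AbsolutelyContinuousOnInterval (fun x => ∫ v in c..x, r v) a b := by
  have hre : IntervalIntegrable (fun x => (r x).re) volume a b := ⟨h.1.re, h.2.re⟩
  have him : IntervalIntegrable (fun x => (r x).im) volume a b := ⟨h.1.im, h.2.im⟩
  have hconst : ∀ w : ℂ, AbsolutelyContinuousOnInterval (fun _ : ℝ => w) a b := fun w =>
    (contDiffOn_const (n := 1)).absolutelyContinuousOnInterval
  have hs : AbsolutelyContinuousOnInterval (fun x => (∫ v in c..x, (r v).re) • (1 : ℂ) +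
      (∫ v in c..x, (r v).im) • Complex.I) a b := ((hre.absolutelyContinuousOnInterval_intervalIntegral hc).smul (hconst 1)).add
    ((him.absolutelyContinuousOnInterval_intervalIntegral hc).smul (hconst Complex.I))
  rw [absolutelyContinuousOnInterval_iff] at hs ⊢
  have heq : ∀ x ∈ uIcc a b, ∫ v in c..x, r v =
      (∫ v in c..x, (r v).re) • (1 : ℂ) + (∫ v in c..x, (r v).im) • Complex.I := by
    intro x hx
    have hsub : uIcc c x ⊆ uIcc a b := uIcc_subset_uIcc hc hx
    have h1 : IntervalIntegrable (fun x => ((r x).re : ℂ)) volume c x :=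
      ⟨(hre.mono_set hsub).1.ofReal, (hre.mono_set hsub).2.ofReal⟩
    have h2 : IntervalIntegrable (fun x => ((r x).im : ℂ) * Complex.I) volume c x :=
      IntervalIntegrable.mul_const ⟨(him.mono_set hsub).1.ofReal, (him.mono_set hsub).2.ofReal⟩ _
    simp only [Complex.real_smul, mul_one]
    rw [← intervalIntegral.integral_ofReal, ← intervalIntegral.integral_ofReal,
      ← intervalIntegral.integral_mul_const, ← intervalIntegral.integral_add h1 h2]
    simp only [Complex.re_add_im]
  intro ε hε
  obtain ⟨δ, hδ, H⟩ := hs ε hε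
  refine ⟨δ, hδ, fun E hE h => ?_⟩
  rw [Finset.sum_congr rfl fun i hi => by rw [heq _ (hE.1 i hi).1, heq _ (hE.1 i hi).2]]
  exact H E hE h

/-- Integration by parts for a primitive of an integrable function. -/
theorem integral_primitive_mul_deriv {r φ : ℝ → ℂ} {a b c : ℝ}
    (hr : IntervalIntegrable r volume a b) (hc : c ∈ uIcc a b) (hφ : ContDiff ℝ 1 φ)
    (ha : φ a = 0) (hb : φ b = 0) :
    ∫ x in a..b, (∫ v in c..x, r v) * deriv φ x = -∫ x in a..b, r x * φ x := by
  set P : ℝ → ℂ := fun x => ∫ v in c..x, r v with hP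
  have hPac : AbsolutelyContinuousOnInterval P a b := absolutelyContinuousOnInterval_integral hr hc
  have hd : Continuous (deriv φ) := hφ.continuous_deriv le_rfl
  have i1 : IntervalIntegrable (fun x => P x * deriv φ x) volume a b :=
    (hPac.continuousOn.mul hd.continuousOn).intervalIntegrable
  have i2 : IntervalIntegrable (fun x => r x * φ x) volume a b :=
    hr.mul_continuousOn hφ.continuous.continuousOn
  have i3 := i1.add i2
  have hQ := absolutelyContinuousOnInterval_integral i3 left_mem_uIcc
  have hH := (hPac.smul hφ.contDiffOn.absolutelyContinuousOnInterval).sub hQ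
  -- `P φ` and the primitive of `P φ' + r φ` have the same derivative almost everywhere, so they
  -- differ by a constant; comparing at `a` and `b`, where `φ` vanishes, gives the formula.
  obtain ⟨C, hC⟩ := hH.const_of_ae_hasDerivAt_zero (by
    filter_upwards [hr.ae_hasDerivAt_integral, i3.ae_hasDerivAt_integral] with x h1 h2 hx
    have e1 := h1 hx c hc
    have e2 := h2 hx a left_mem_uIcc
    have e3 := (hφ.differentiable one_ne_zero x).hasDerivAt
    have := (e1.mul e3).sub e2
    refine this.congr_deriv ?_
    ring)
  have ea := hC a left_mem_uIcc
  have eb := hC b right_mem_uIcc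
  rw [← ea] at eb
  simp only [Pi.sub_apply, smul_eq_mul, Pi.mul_apply, ha, hb, mul_zero,
    intervalIntegral.integral_same] at eb
  rw [intervalIntegral.integral_add i1 i2] at eb
  linear_combination -eb

theorem intervalIntegrable_of_locallyIntegrableOn {r : ℝ → ℂ}
    (hr : LocallyIntegrableOn r (Ioi 0)) {a b : ℝ} (ha : 0 < a) (hb : 0 < b) :
    IntervalIntegrable r volume a b := by
  rw [intervalIntegrable_iff]
  exact (hr.integrableOn_compact_subset (fun x hx => (lt_min ha hb).trans_le hx.1)
    isCompact_uIcc).mono_set uIoc_subset_uIcc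

theorem continuousOn_primitive_of_locallyIntegrableOn {r : ℝ → ℂ}
    (hr : LocallyIntegrableOn r (Ioi 0)) :
    ContinuousOn (fun x => ∫ v in (1 : ℝ)..x, r v) (Ioi 0) := by
  intro x hx
  have hx : 0 < x := hx
  have ha : 0 < min 1 x / 2 := by positivity
  have h := (absolutelyContinuousOnInterval_integral (c := 1) (b := max 1 x + 1)
    (intervalIntegrable_of_locallyIntegrableOn hr ha (by positivity)) (by
      rw [uIcc_of_le (by linarith [min_le_left 1 x, le_max_left 1 x])]
      exact ⟨by linarith [min_le_left 1 x], by linarith [le_max_left 1 x]⟩)).continuousOn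
  refine (h.continuousAt ?_).continuousWithinAt
  rw [uIcc_of_le (by linarith [min_le_left 1 x, le_max_left 1 x])]
  exact Icc_mem_nhds (by linarith [min_le_right 1 x]) (by linarith [le_max_right 1 x])

theorem integral_primitive_mul_deriv_halfLine {r φ : ℝ → ℂ}
    (hr : LocallyIntegrableOn r (Ioi 0)) (hφ : IsTestFunction φ) :
    ∫ x, (∫ v in (1 : ℝ)..x, r v) * deriv φ x ∂halfLine = -∫ x, r x * φ x ∂halfLine := by
  obtain ⟨a', b', ha', hab', hs'⟩ := hφ.exists_Ioo
  set a := min a' 1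
  set b := max b' 1
  have ha : 0 < a := by positivity
  have hab : a ≤ b := (min_le_right _ _).trans (le_max_right _ _)
  have hs : tsupport φ ⊆ Ioo a b :=
    hs'.trans (Ioo_subset_Ioo (min_le_left _ _) (le_max_left _ _))
  have z0 : ∀ x, x ∉ Ioo a b → φ x = 0 := fun x hx =>
    image_eq_zero_of_notMem_tsupport fun h => hx (hs h)
  have z1 : ∀ x, x ∉ Ioo a b → deriv φ x = 0 := fun x hx =>
    deriv_eq_zero_of_notMem_tsupport fun h => hx (hs h)
  rw [integral_halfLine_eq_interval ha.le hab fun x hx => by rw [z1 x hx, mul_zero],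
    integral_halfLine_eq_interval ha.le hab fun x hx => by rw [z0 x hx, mul_zero]]
  refine integral_primitive_mul_deriv
    (intervalIntegrable_of_locallyIntegrableOn hr ha (by positivity)) ?_
    (hφ.smooth.of_le (by exact_mod_cast le_top)) (z0 a (by simp)) (z0 b (by simp))
  rw [uIcc_of_le hab]
  exact ⟨min_le_right _ _, le_max_right _ _⟩

/-- Regularity: if `f'' = r` in the sense of distributions, then `f` is almost everywhere equal to
a second primitive of `r`. -/
theorem ae_eq_second_primitive {f r : ℝ → ℂ} (hf : LocallyIntegrableOn f (Ioi 0))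
    (hr : LocallyIntegrableOn r (Ioi 0))
    (h : ∀ φ : ℝ → ℂ, IsTestFunction φ →
      ∫ x, f x * deriv (deriv φ) x ∂halfLine = ∫ x, r x * φ x ∂halfLine) :
    ∃ A B : ℂ, f =ᵐ[halfLine] fun x => A + ∫ t in (1 : ℝ)..x, (B + ∫ v in (1 : ℝ)..t, r v) := by
  set P : ℝ → ℂ := fun x => ∫ v in (1 : ℝ)..x, r v with hP
  have hPc : ContinuousOn P (Ioi 0) := continuousOn_primitive_of_locallyIntegrableOn hr
  have hPl : LocallyIntegrableOn P (Ioi 0) := hPc.locallyIntegrableOn measurableSet_Ioi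
  obtain ⟨η, hη, h1⟩ := exists_testFunction_integral_eq_one
  have hi : ∀ {ψ : ℝ → ℂ}, IsTestFunction ψ → Integrable ψ halfLine := fun {ψ} hψ =>
    (hψ.smooth.continuous.integrable_of_hasCompactSupport hψ.compact).mono_measure
      Measure.restrict_le_self
  -- `B` is forced: it is the pairing of `f' - P` with the normalized `η`, and `f' - P` has to be
  -- constant. Then `f' = R` in the sense of distributions.
  set B : ℂ := -(∫ x, f x * deriv η x ∂halfLine + ∫ x, P x * η x ∂halfLine) with hB
  set R : ℝ → ℂ := fun t => B + P t with hR
  have hRc : ContinuousOn R (Ioi 0) := continuousOn_const.add hPc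
  have hRl : LocallyIntegrableOn R (Ioi 0) := hRc.locallyIntegrableOn measurableSet_Ioi
  set Q : ℝ → ℂ := fun x => ∫ t in (1 : ℝ)..x, R t with hQ
  have hQl : LocallyIntegrableOn Q (Ioi 0) :=
    (continuousOn_primitive_of_locallyIntegrableOn hRl).locallyIntegrableOn measurableSet_Ioi
  obtain ⟨A, hA⟩ := ae_eq_const_of_integral_mul_deriv (hf.sub hQl) (by
    intro ψ hψ
    set J := ∫ x, ψ x ∂halfLine with hJ
    have hψ' : IsTestFunction (ψ + (-J) • η) := hψ.add (hη.smul _)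
    obtain ⟨φ, hφ, hd⟩ := exists_primitive_of_isTestFunction hψ' (by
      simp only [Pi.add_apply, Pi.smul_apply, smul_eq_mul]
      rw [integral_add (hi hψ) ((hi hη).const_mul _), integral_const_mul, h1, ← hJ]
      ring)
    have e1 := h φ hφ
    have e2 := integral_primitive_mul_deriv_halfLine hr hφ
    have e3 := integral_primitive_mul_deriv_halfLine hRl hψ
    have hdd : deriv (deriv φ) = fun x => deriv ψ x + -J * deriv η x := by
      rw [hd]
      ext x
      rw [deriv_add hψ.differentiable.differentiableAt (hη.smul _).differentiable.differentiableAt,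
        deriv_const_smul _ hη.differentiable.differentiableAt, smul_eq_mul]
    rw [hdd] at e1
    rw [hd] at e2
    simp only [Pi.add_apply, Pi.smul_apply, smul_eq_mul] at e2
    have i1 := integrable_mul_testFunction hf hψ.deriv
    have i2 := integrable_mul_testFunction hf hη.deriv
    have i3 := integrable_mul_testFunction hPl hψ
    have i4 := integrable_mul_testFunction hPl hη
    have i5 := integrable_mul_testFunction hQl hψ.deriv
    have s1 : ∀ x, f x * (deriv ψ x + -J * deriv η x) =
        f x * deriv ψ x + -J * (f x * deriv η x) := fun x => by ring
    have s2 : ∀ x, P x * (ψ x + -J * η x) = P x * ψ x + -J * (P x * η x) := fun x => by ring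
    have s3 : ∀ x, R x * ψ x = B * ψ x + P x * ψ x := fun x => by simp only [hR]; ring
    simp only [s1] at e1
    rw [integral_add i1 (i2.const_mul _), integral_const_mul] at e1
    change ∫ x, P x * (ψ x + -J * η x) ∂halfLine = _ at e2
    simp only [s2] at e2
    rw [integral_add i3 (i4.const_mul _), integral_const_mul] at e2
    simp only [s3] at e3
    rw [integral_add ((hi hψ).const_mul _) i3, integral_const_mul, ← hJ] at e3
    change ∫ x, Q x * deriv ψ x ∂halfLine = _ at e3
    simp only [Pi.sub_apply, sub_mul]
    rw [integral_sub i1 i5, e3]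
    linear_combination e1 + e2 + J * hB)
  refine ⟨A, B, ?_⟩
  filter_upwards [hA] with x hx
  simp only [Pi.sub_apply] at hx
  linear_combination hx

theorem mem_maxGraph_iff {α : ℂ} {f g : L2HalfLine} : (f, g) ∈ maxGraph α ↔
    ∀ φ : ℝ → ℂ, IsTestFunction φ →
      ∫ x, f x * diffExpr α φ x ∂halfLine = ∫ x, g x * φ x ∂halfLine := Iff.rfl

theorem integral_mul_diffExpr {α : ℂ} {f φ : ℝ → ℂ} (hf : LocallyIntegrableOn f (Ioi 0))
    (hφ : IsTestFunction φ) :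
    ∫ x, f x * diffExpr α φ x ∂halfLine = -(∫ x, f x * deriv (deriv φ) x ∂halfLine) +
      ∫ x, potential α x * f x * φ x ∂halfLine := by
  have i1 := integrable_mul_testFunction hf hφ.deriv.deriv
  have hl : LocallyIntegrableOn (fun x => potential α x * f x) (Ioi 0) :=
    hf.continuousOn_mul (continuousOn_potential α) isOpen_Ioi.isLocallyClosed
  have i2 := integrable_mul_testFunction hl hφ
  rw [neg_add_eq_sub, ← integral_sub i2 i1]
  refine integral_congr_ae (.of_forall fun x => ?_)
  simp only [diffExpr, potential]
  ring

/-- Green's identity for a `C²` function and a test function. -/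
theorem IsC2.integral_mul_diffExpr {F F₁ F₂ : ℝ → ℂ} (hF : IsC2 F F₁ F₂) (α : ℂ) {φ : ℝ → ℂ}
    (hφ : IsTestFunction φ) :
    ∫ x, F x * diffExpr α φ x ∂halfLine =
      ∫ x, (-F₂ x + potential α x * F x) * φ x ∂halfLine := by
  have hl := hF.continuousOn_zero.locallyIntegrableOn (μ := volume) measurableSet_Ioi
  have i1 := integrable_mul_testFunction
    (hF.continuousOn.locallyIntegrableOn measurableSet_Ioi) hφ
  have i2 := integrable_mul_testFunction
    (((continuousOn_potential α).mul hF.continuousOn_zero).locallyIntegrableOn measurableSet_Ioi)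
    hφ
  rw [AlmostHomogeneous.integral_mul_diffExpr hl hφ, hF.integral_mul_deriv_deriv hφ,
    neg_add_eq_sub]
  refine (integral_sub i2 i1).symm.trans (integral_congr_ae (.of_forall fun x => ?_))
  simp only [Pi.mul_apply]
  ring

/-- Elliptic regularity: eigenvectors of the maximal operator are classical solutions. -/
theorem exists_isC2_of_mem_maxGraph {α z : ℂ} {f : L2HalfLine} (hf : (f, z • f) ∈ maxGraph α) :
    ∃ F F₁ : ℝ → ℂ, IsC2 F F₁ (fun x => (potential α x - z) * F x) ∧ f =ᵐ[halfLine] F := by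
  have hl := locallyIntegrableOn_of_L2 f
  have hq : ContinuousOn (fun x => potential α x - z) (Ioi 0) :=
    (continuousOn_potential α).sub continuousOn_const
  have hr : LocallyIntegrableOn (fun x => (potential α x - z) * f x) (Ioi 0) :=
    hl.continuousOn_mul hq isOpen_Ioi.isLocallyClosed
  obtain ⟨A, B, hAB⟩ := ae_eq_second_primitive hl hr (by
    intro φ hφ
    have e := mem_maxGraph_iff.1 hf φ hφ
    rw [integral_mul_diffExpr hl hφ] at e
    have i1 := integrable_mul_testFunction (hl.continuousOn_mul (continuousOn_potential α)
      isOpen_Ioi.isLocallyClosed) hφ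
    have i2 := (integrable_mul_testFunction hl hφ).const_mul z
    have e3 : ∫ x, (z • f : L2HalfLine) x * φ x ∂halfLine = ∫ x, z * (f x * φ x) ∂halfLine := by
      refine integral_congr_ae ?_
      filter_upwards [Lp.coeFn_smul z f] with x hx
      rw [hx, Pi.smul_apply, smul_eq_mul, mul_assoc]
    rw [e3] at e
    have e4 : ∫ x, (potential α x - z) * f x * φ x ∂halfLine =
        ∫ x, potential α x * f x * φ x ∂halfLine - ∫ x, z * (f x * φ x) ∂halfLine := by
      rw [← integral_sub i1 i2]
      exact integral_congr_ae (.of_forall fun x => by ring)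
    rw [e4]
    linear_combination -e)
  set F : ℝ → ℂ := fun x => A + ∫ t in (1 : ℝ)..x,
    (B + ∫ v in (1 : ℝ)..t, (potential α v - z) * f v) with hF
  have hcont : ContinuousOn (fun t => B + ∫ v in (1 : ℝ)..t, (potential α v - z) * f v) (Ioi 0) :=
    continuousOn_const.add (continuousOn_primitive_of_locallyIntegrableOn hr)
  have hprim : ∀ {u : ℝ → ℂ}, ContinuousOn u (Ioi 0) → ∀ x, 0 < x →
      HasDerivAt (fun x => ∫ t in (1 : ℝ)..x, u t) (u x) x := by
    intro u hu x hx
    refine intervalIntegral.integral_hasDerivAt_right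
      (intervalIntegrable_of_locallyIntegrableOn (hu.locallyIntegrableOn measurableSet_Ioi)
        one_pos hx)
      (hu.stronglyMeasurableAtFilter isOpen_Ioi x hx) (hu.continuousAt (Ioi_mem_nhds hx))
  have hd1 : ∀ x, 0 < x → HasDerivAt F (B + ∫ v in (1 : ℝ)..x, (potential α v - z) * f v) x :=
    fun x hx => (hprim hcont x hx).const_add A
  have hFc : ContinuousOn F (Ioi 0) := fun x hx => (hd1 x hx).continuousAt.continuousWithinAt
  have hF2 : ContinuousOn (fun x => (potential α x - z) * F x) (Ioi 0) := hq.mul hFc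
  refine ⟨F, fun x => B + ∫ v in (1 : ℝ)..x, (potential α v - z) * f v, ⟨hd1, ?_, hF2⟩, hAB⟩
  -- Under the integral `f` may be replaced by its representative `F`, which is continuous; the
  -- inner primitive then becomes classically differentiable.
  have hcongr : ∀ x, 0 < x → ∫ v in (1 : ℝ)..x, (potential α v - z) * f v =
      ∫ v in (1 : ℝ)..x, (potential α v - z) * F v := by
    intro x hx
    refine intervalIntegral.integral_congr_ae ?_
    filter_upwards [(ae_restrict_iff' measurableSet_Ioi).1 hAB] with v hv hv'
    rw [hv ((lt_min one_pos hx).trans hv'.1)]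
  intro x hx
  refine HasDerivAt.congr_of_eventuallyEq ((hprim hF2 x hx).const_add B) ?_
  filter_upwards [Ioi_mem_nhds hx] with y hy
  rw [hcongr y hy]

end AlmostHomogeneous
end

/-! ### The minimal domain near `0`: boundary Wronskians vanish -/

noncomputable section

namespace AlmostHomogeneous

/-- The bilinear pairing is the inner product with the conjugate of `ψ`. Compact support is not
assumed, because the truncated homogeneous solutions used as `ψ` are supported up to `0`. -/
theorem continuous_pairing_of_memLp {ψ : ℝ → ℂ} (hψ : MemLp ψ 2 halfLine) :
    Continuous fun f : L2HalfLine => ∫ x, f x * ψ x ∂halfLine := by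
  have hm : MemLp (fun x => (starRingEnd ℂ) (ψ x)) 2 halfLine := hψ.star
  have key : (fun f : L2HalfLine => ∫ x, f x * ψ x ∂halfLine) =
      fun f => inner ℂ (hm.toLp _) f := by
    ext f
    rw [L2.inner_def]
    refine integral_congr_ae ?_
    filter_upwards [hm.coeFn_toLp] with x hx
    simp [hx]
  rw [key]
  exact continuous_const.inner continuous_id

theorem minOp_graph (α : ℂ) : (minOp α).graph = (testGraph α).topologicalClosure := by
  rw [minOp, ← (testOp_isClosable α).graph_closure_eq_closure_graph, testOp_graph]

theorem minOp_graph_le_maxGraph (α : ℂ) : (minOp α).graph ≤ maxGraph α := by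
  rw [minOp_graph]
  refine Submodule.topologicalClosure_minimal _ (testGraph_le_maxGraph α) ?_
  rw [← maxOp_graph]
  exact maxOp_isClosed α

/-- A Green identity against test functions extends to the minimal operator. -/
theorem integral_mul_eq_of_mem_minOp_graph {α : ℂ} {h g : L2HalfLine}
    (hg : (h, g) ∈ (minOp α).graph) {v w : ℝ → ℂ} (hv : MemLp v 2 halfLine)
    (hw : MemLp w 2 halfLine)
    (hvw : ∀ φ, IsTestFunction φ →
      ∫ x, v x * diffExpr α φ x ∂halfLine = ∫ x, w x * φ x ∂halfLine) :
    ∫ x, g x * v x ∂halfLine = ∫ x, h x * w x ∂halfLine := by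
  rw [minOp_graph] at hg
  have hc : IsClosed {p : L2HalfLine × L2HalfLine |
      ∫ x, p.2 x * v x ∂halfLine = ∫ x, p.1 x * w x ∂halfLine} :=
    isClosed_eq ((continuous_pairing_of_memLp hv).comp continuous_snd)
      ((continuous_pairing_of_memLp hw).comp continuous_fst)
  refine closure_minimal ?_ hc hg
  rintro p ⟨φ, hφ, h1, h2⟩
  have e1 : ∫ x, p.2 x * v x ∂halfLine = ∫ x, v x * diffExpr α φ x ∂halfLine :=
    integral_congr_ae (by filter_upwards [h2] with x hx; rw [hx, mul_comm])
  have e2 : ∫ x, p.1 x * w x ∂halfLine = ∫ x, w x * φ x ∂halfLine :=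
    integral_congr_ae (by filter_upwards [h1] with x hx; rw [hx, mul_comm])
  exact e1.trans ((hvw φ hφ).trans e2.symm)

/-- A smooth cutoff function equal to `1` on `]-∞,a]` and to `0` on `[b,∞[`. -/
structure IsCutoff (χ : ℝ → ℂ) (a b : ℝ) : Prop where
  smooth : ContDiff ℝ ((⊤ : ℕ∞) : WithTop ℕ∞) χ
  eq_one : ∀ x, x ≤ a → χ x = 1
  eq_zero : ∀ x, b ≤ x → χ x = 0
  norm_le : ∀ x, ‖χ x‖ ≤ 1

theorem exists_isCutoff {a b : ℝ} (hab : a < b) : ∃ χ, IsCutoff χ a b := by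
  refine ⟨fun x => (Real.smoothTransition ((b - x) / (b - a)) : ℝ), ?_, ?_, ?_, ?_⟩
  · refine Complex.ofRealCLM.contDiff.comp (Real.smoothTransition.contDiff.comp ?_)
    fun_prop
  · intro x hx
    rw [Real.smoothTransition.one_of_one_le, Complex.ofReal_one]
    rw [le_div_iff₀ (sub_pos.2 hab)]
    linarith
  · intro x hx
    rw [Real.smoothTransition.zero_of_nonpos, Complex.ofReal_zero]
    exact div_nonpos_of_nonpos_of_nonneg (by linarith) (by linarith)
  · intro x
    rw [Complex.norm_real, Real.norm_of_nonneg (Real.smoothTransition.nonneg _)]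
    exact Real.smoothTransition.le_one _

namespace IsCutoff

variable {χ : ℝ → ℂ} {a b : ℝ}

theorem hasDerivAt (h : IsCutoff χ a b) (x : ℝ) : HasDerivAt χ (deriv χ x) x :=
  (h.smooth.differentiable (by simp) x).hasDerivAt

theorem contDiff_deriv (h : IsCutoff χ a b) :
    ContDiff ℝ ((⊤ : ℕ∞) : WithTop ℕ∞) (deriv χ) := (contDiff_infty_iff_deriv.1 h.smooth).2

theorem contDiff_deriv_deriv (h : IsCutoff χ a b) :
    ContDiff ℝ ((⊤ : ℕ∞) : WithTop ℕ∞) (deriv (deriv χ)) :=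
  (contDiff_infty_iff_deriv.1 h.contDiff_deriv).2

theorem hasDerivAt' (h : IsCutoff χ a b) (x : ℝ) :
    HasDerivAt (deriv χ) (deriv (deriv χ) x) x :=
  (h.contDiff_deriv.differentiable (by simp) x).hasDerivAt

theorem eventuallyEq_of_lt (h : IsCutoff χ a b) {x : ℝ} (hx : x < a) : χ =ᶠ[𝓝 x] fun _ => 1 := by
  filter_upwards [Iio_mem_nhds hx] with y hy using h.eq_one y hy.le

theorem eventuallyEq_of_gt (h : IsCutoff χ a b) {x : ℝ} (hx : b < x) : χ =ᶠ[𝓝 x] fun _ => 0 := by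
  filter_upwards [Ioi_mem_nhds hx] with y hy using h.eq_zero y hy.le

theorem deriv_eq_zero (h : IsCutoff χ a b) {x : ℝ} (hx : x < a ∨ b < x) : deriv χ x = 0 := by
  rcases hx with hx | hx
  · rw [(h.eventuallyEq_of_lt hx).deriv_eq, deriv_const]
  · rw [(h.eventuallyEq_of_gt hx).deriv_eq, deriv_const]

theorem deriv_deriv_eq_zero (h : IsCutoff χ a b) {x : ℝ} (hx : x < a ∨ b < x) :
    deriv (deriv χ) x = 0 := by
  rcases hx with hx | hx
  · rw [((h.eventuallyEq_of_lt hx).deriv).deriv_eq]; simp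
  · rw [((h.eventuallyEq_of_gt hx).deriv).deriv_eq]; simp

end IsCutoff

/-- Products with smooth functions. -/
theorem IsC2.smooth_mul {F F₁ F₂ χ : ℝ → ℂ} (hF : IsC2 F F₁ F₂)
    (hχ : ContDiff ℝ ((⊤ : ℕ∞) : WithTop ℕ∞) χ) :
    IsC2 (fun x => χ x * F x) (fun x => deriv χ x * F x + χ x * F₁ x)
      (fun x => deriv (deriv χ) x * F x + 2 * deriv χ x * F₁ x + χ x * F₂ x) := by
  have hχ' := (contDiff_infty_iff_deriv.1 hχ).2
  have hχ'' := (contDiff_infty_iff_deriv.1 hχ').2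
  have d0 : ∀ x, HasDerivAt χ (deriv χ x) x := fun x =>
    (hχ.differentiable (by simp) x).hasDerivAt
  have d1 : ∀ x, HasDerivAt (deriv χ) (deriv (deriv χ) x) x := fun x =>
    (hχ'.differentiable (by simp) x).hasDerivAt
  refine ⟨fun x hx => (d0 x).mul (hF.hasDerivAt x hx), fun x hx => ?_, ?_⟩
  · refine (((d1 x).mul (hF.hasDerivAt x hx)).add
      ((d0 x).mul (hF.hasDerivAt' x hx))).congr_deriv ?_
    ring
  · exact ((hχ''.continuous.continuousOn.mul hF.continuousOn_zero).add
      ((continuousOn_const.mul hχ'.continuous.continuousOn).mul hF.continuousOn_one)).add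
      (hχ.continuous.continuousOn.mul hF.continuousOn)

theorem memLp_of_continuousOn_of_eq_zero {w : ℝ → ℂ} {a b : ℝ} (ha : 0 < a)
    (hw : ContinuousOn w (Ioi 0)) (h0 : ∀ x, x < a ∨ b < x → w x = 0) : MemLp w 2 halfLine := by
  obtain ⟨C, hC⟩ := isCompact_Icc.exists_bound_of_continuousOn
    (hw.mono (Icc_subset_Ioi_zero ha : Icc a b ⊆ Ioi 0))
  have hind : w = (Icc a b).indicator w := by
    ext x
    by_cases hx : x ∈ Icc a b
    · rw [indicator_of_mem hx]
    · rw [indicator_of_notMem hx]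
      refine h0 x ?_
      by_contra! h
      exact hx ⟨h.1, h.2⟩
  rw [hind, memLp_indicator_iff_restrict measurableSet_Icc,
    Measure.restrict_restrict measurableSet_Icc,
    inter_eq_left.2 (Icc_subset_Ioi_zero ha)]
  have : IsFiniteMeasure (volume.restrict (Icc a b)) := ⟨by simp⟩
  exact MemLp.of_bound ((hw.mono (Icc_subset_Ioi_zero ha)).aestronglyMeasurable
    measurableSet_Icc) C ((ae_restrict_iff' measurableSet_Icc).2 (.of_forall hC))

/-- Near `0`, elements of the domain of the minimal operator have vanishing Wronskian with
square integrable solutions of the homogeneous equation. -/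
theorem tendsto_wronskian_of_mem_minOp_graph {α : ℂ} {h g : L2HalfLine}
    (hg : (h, g) ∈ (minOp α).graph) {D D₁ D₂ : ℝ → ℂ} (hD : IsC2 D D₁ D₂) {ε : ℝ} (hε : 0 < ε)
    (hDh : ∀ᵐ x ∂halfLine, x < ε → D x = h x) {u u₁ : ℝ → ℂ}
    (hu : IsC2 u u₁ (fun x => potential α x * u x))
    (hu2 : MemLp u 2 (volume.restrict (Ioo 0 ε))) :
    Tendsto (wronskian D D₁ u u₁) (𝓝[>] 0) (𝓝 0) := by
  -- On `]0,ε[` the distribution `L h` is computed from the classical function `D`: test with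
  -- functions supported there.
  have hgD : ∀ᵐ x ∂halfLine, x < ε → g x = -D₂ x + potential α x * D x := by
    have hl : LocallyIntegrableOn (fun x => g x - (-D₂ x + potential α x * D x)) (Ioi 0) :=
      (locallyIntegrableOn_of_L2 g).sub ((hD.continuousOn.neg.add
        ((continuousOn_potential α).mul hD.continuousOn_zero)).locallyIntegrableOn
          measurableSet_Ioi)
    have hl2 : LocallyIntegrableOn (fun x => -D₂ x + potential α x * D x) (Ioi 0) :=
      (hD.continuousOn.neg.add
        ((continuousOn_potential α).mul hD.continuousOn_zero)).locallyIntegrableOn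
          measurableSet_Ioi
    have := ae_eq_zero_of_integral_testFunction (U := Ioo 0 ε) isOpen_Ioo (fun x hx => hx.1)
      (hl.mono_set fun x hx => hx.1) (by
        intro φ hφ hs
        have e1 := mem_maxGraph_iff.1 (minOp_graph_le_maxGraph α hg) φ hφ
        have e2 := hD.integral_mul_diffExpr α hφ
        have e3 : ∫ x, h x * diffExpr α φ x ∂halfLine =
            ∫ x, D x * diffExpr α φ x ∂halfLine := by
          refine integral_congr_ae ?_
          filter_upwards [hDh] with x hx
          by_cases hxs : x ∈ tsupport φ
          · rw [hx (hs hxs).2]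
          · have z0 : φ x = 0 := image_eq_zero_of_notMem_tsupport hxs
            have z2 : deriv (deriv φ) x = 0 :=
              deriv_eq_zero_of_notMem_tsupport fun h => hxs (tsupport_deriv_subset h)
            simp [diffExpr, z0, z2]
        simp only [sub_mul]
        rw [integral_sub (integrable_mul_testFunction (locallyIntegrableOn_of_L2 g) hφ)
          (integrable_mul_testFunction hl2 hφ), ← e1, e3, e2, sub_self])
    refine (ae_restrict_iff' measurableSet_Ioi).2 ?_
    filter_upwards [this] with x hx h0 h1
    exact sub_eq_zero.1 (hx ⟨h0, h1⟩)
  -- Truncate `u` to `v = χ u`. Then `w = L v` vanishes near `0`, where `χ = 1` and `L u = 0`, as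
  -- well as beyond `ε/2`; hence `v` and `w` are both square integrable.
  obtain ⟨χ, hχ⟩ := exists_isCutoff (show ε / 3 < ε / 2 by linarith)
  have hv := hu.smooth_mul hχ.smooth
  set v : ℝ → ℂ := fun x => χ x * u x with hvdef
  set v₁ : ℝ → ℂ := fun x => deriv χ x * u x + χ x * u₁ x with hv1def
  set v₂ : ℝ → ℂ := fun x => deriv (deriv χ) x * u x + 2 * deriv χ x * u₁ x +
    χ x * (potential α x * u x) with hv2def
  set w : ℝ → ℂ := fun x => -v₂ x + potential α x * v x with hwdef
  have hwc : ContinuousOn w (Ioi 0) :=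
    hv.continuousOn.neg.add ((continuousOn_potential α).mul hv.continuousOn_zero)
  have hvL : MemLp v 2 halfLine := by
    have hind : v = (Ioo 0 ε).indicator v + (Ioo 0 ε)ᶜ.indicator v :=
      (indicator_self_add_compl _ _).symm
    have h1 : MemLp ((Ioo 0 ε).indicator v) 2 halfLine := by
      rw [memLp_indicator_iff_restrict measurableSet_Ioo,
        Measure.restrict_restrict measurableSet_Ioo,
        inter_eq_left.2 (Ioo_subset_Ioi_self : Ioo 0 ε ⊆ Ioi 0)]
      refine hu2.mono ((hv.continuousOn_zero.mono fun x hx => hx.1).aestronglyMeasurable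
        measurableSet_Ioo) (.of_forall fun x => ?_)
      rw [hvdef, norm_mul]
      exact mul_le_of_le_one_left (norm_nonneg _) (hχ.norm_le x)
    refine h1.ae_eq ?_
    refine (ae_restrict_iff' measurableSet_Ioi).2 (.of_forall fun x hx => ?_)
    by_cases hx' : x ∈ Ioo 0 ε
    · rw [indicator_of_mem hx']
    · rw [indicator_of_notMem hx', hvdef]
      have : ε ≤ x := by by_contra! hlt; exact hx' ⟨hx, hlt⟩
      simp [hχ.eq_zero x (by linarith)]
  have hw0 : ∀ x, x < ε / 3 ∨ ε / 2 < x → w x = 0 := by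
    intro x hx
    simp only [hwdef, hv2def, hvdef, hχ.deriv_eq_zero hx, hχ.deriv_deriv_eq_zero hx]
    ring
  have hwL : MemLp w 2 halfLine :=
    memLp_of_continuousOn_of_eq_zero (by positivity) hwc hw0
  have key := integral_mul_eq_of_mem_minOp_graph hg hvL hwL fun φ hφ =>
    hv.integral_mul_diffExpr α hφ
  set k : ℝ → ℂ := fun x => g x * v x - h x * w x with hk
  have ki : IntegrableOn k (Ioi 0) :=
    ((Lp.memLp g).integrable_mul hvL).sub ((Lp.memLp h).integrable_mul hwL)
  have k0 : ∫ x in Ioi 0, k x = 0 := by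
    refine (integral_sub ((Lp.memLp g).integrable_mul hvL)
      ((Lp.memLp h).integrable_mul hwL)).trans ?_
    exact sub_eq_zero.2 key
  -- The extended Green identity says that `k` has total integral `0`. Its integral over `]x,∞[` is
  -- `-W(D, u)` at `x` by the classical Green identity, so `W(D, u)` is the integral of `k` over
  -- `]0,x[`, which tends to `0`.
  have hkW : ∀ x ∈ Ioo 0 (ε / 3), ∫ t in (0 : ℝ)..x, k t = wronskian D D₁ u u₁ x := by
    intro x hx
    have hz : ∀ y, ε / 2 < y → v y = 0 ∧ v₁ y = 0 := by
      intro y hy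
      simp [hvdef, hv1def, hχ.deriv_eq_zero (Or.inr hy), hχ.eq_zero y hy.le]
    have e1 : ∫ t in Ioi x, k t = ∫ t in x..ε, (D t * v₂ t - D₂ t * v t) := by
      rw [intervalIntegral.integral_of_le (by linarith [hx.2])]
      refine (setIntegral_eq_of_subset_of_ae_sdiff_eq_zero (s := Ioc x ε) (t := Ioi x)
        measurableSet_Ioi.nullMeasurableSet Ioc_subset_Ioi_self ?_).trans ?_
      swap
      · refine setIntegral_congr_ae measurableSet_Ioc ?_
        filter_upwards [(ae_restrict_iff' measurableSet_Ioi).1 hDh,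
          (ae_restrict_iff' measurableSet_Ioi).1 hgD,
          Measure.ae_ne volume ε] with t h1 h2 hne ht
        have t0 : t ∈ Ioi (0 : ℝ) := hx.1.trans ht.1
        have tε : t < ε := lt_of_le_of_ne ht.2 hne
        rw [hk]
        simp only [hwdef]
        rw [h2 t0 tε, ← h1 t0 tε]
        ring
      · refine .of_forall fun t ht => ?_
        have : ε < t := by
          by_contra! hle
          exact ht.2 ⟨ht.1, hle⟩
        change g t * v t - h t * w t = 0
        rw [(hz t (by linarith)).1, hw0 t (Or.inr (by linarith))]
        ring
    have e2 : ∫ t in x..ε, (D t * v₂ t - D₂ t * v t) = -wronskian D D₁ v v₁ x := by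
      rw [hD.integral_green hv hx.1 (by linarith [hx.2])]
      simp [wronskian, (hz ε (by linarith)).1, (hz ε (by linarith)).2]
    have e3 : ∫ t in (0 : ℝ)..x, k t = (∫ t in Ioi 0, k t) - ∫ t in Ioi x, k t :=
      (intervalIntegral.integral_Ioi_sub_Ioi ki hx.1.le).symm
    rw [e3, k0, e1, e2, zero_sub, neg_neg]
    simp [wronskian, hvdef, hv1def, hχ.eq_one x hx.2.le, hχ.deriv_eq_zero (Or.inl hx.2)]
  have hcont : ContinuousOn (fun x => ∫ t in (0 : ℝ)..x, k t) (uIcc 0 (ε / 3)) := by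
    refine intervalIntegral.continuousOn_primitive_interval ?_
    rw [uIcc_of_le (by positivity), integrableOn_Icc_iff_integrableOn_Ioc]
    exact ki.mono_set fun x hx => hx.1
  have h0 := (hcont 0 left_mem_uIcc).tendsto
  rw [intervalIntegral.integral_same, uIcc_of_le (by positivity)] at h0
  have h1 : Tendsto (fun x => ∫ t in (0 : ℝ)..x, k t) (𝓝[>] 0) (𝓝 0) := by
    refine h0.mono_left ?_
    rw [← nhdsWithin_Ioo_eq_nhdsGT (show (0 : ℝ) < ε / 3 by positivity)]
    exact nhdsWithin_mono _ Ioo_subset_Icc_self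
  refine h1.congr' ?_
  filter_upwards [Ioo_mem_nhdsGT (show (0 : ℝ) < ε / 3 by positivity)] with x hx
  exact hkW x hx

end AlmostHomogeneous
end

/-! ### Behaviour at infinity: uniqueness, and no positive or nonreal energies -/

noncomputable section

namespace AlmostHomogeneous

open scoped ComplexConjugate

/-- Unique continuation for the equation `F'' = p F`. -/
theorem IsC2.eq_zero_of_initial {F F₁ p : ℝ → ℂ} (hF : IsC2 F F₁ (fun x => p x * F x))
    (hp : ContinuousOn p (Ioi 0)) {x₀ : ℝ} (hx₀ : 0 < x₀) (h0 : F x₀ = 0) (h1 : F₁ x₀ = 0)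
    {x : ℝ} (hx : 0 < x) : F x = 0 := by
  set a := min x₀ x / 2 with ha
  set b := max x₀ x + 1 with hb
  have ha0 : 0 < a := by positivity
  obtain ⟨C, hC⟩ := isCompact_Icc.exists_bound_of_continuousOn
    (hp.mono (Icc_subset_Ioi_zero ha0 : Icc a b ⊆ Ioi 0))
  set K : NNReal := Real.toNNReal (max 1 C) with hK
  have hKc : (K : ℝ) = max 1 C := Real.coe_toNNReal _ (by positivity)
  have hlip : ∀ t ∈ Ioo a b, LipschitzOnWith K (fun y : ℂ × ℂ => (y.2, p t * y.1)) univ := by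
    intro t ht
    refine (LipschitzWith.of_dist_le_mul fun y z => ?_).lipschitzOnWith
    rw [dist_eq_norm, dist_eq_norm, hKc, Prod.norm_def, Prod.norm_def]
    have hpt := hC t (Ioo_subset_Icc_self ht)
    refine max_le ?_ ?_
    · simp only [Prod.snd_sub, Prod.fst_sub]
      calc ‖y.2 - z.2‖ ≤ max ‖y.1 - z.1‖ ‖y.2 - z.2‖ := le_max_right _ _
        _ ≤ _ := le_mul_of_one_le_left (by positivity) (le_max_left _ _)
    · simp only [Prod.snd_sub, Prod.fst_sub, ← mul_sub, norm_mul]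
      exact mul_le_mul (hpt.trans (le_max_right _ _)) (le_max_left _ _) (norm_nonneg _)
        (by positivity)
  have hsub : ∀ t ∈ Ioo a b, 0 < t := fun t ht => ha0.trans ht.1
  have := ODE_solution_unique_of_mem_Ioo (t₀ := x₀) (f := fun t => (F t, F₁ t))
    (g := fun _ => (0, 0)) hlip
    ⟨by linarith [min_le_left x₀ x], by linarith [le_max_left x₀ x]⟩
    (fun t ht => ⟨(hF.hasDerivAt t (hsub t ht)).prodMk (hF.hasDerivAt' t (hsub t ht)), trivial⟩)
    (fun t ht => ⟨by simpa [← Prod.zero_eq_mk] using hasDerivAt_const t ((0, 0) : ℂ × ℂ), trivial⟩)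
    (by simp [h0, h1])
  have hxm : x ∈ Ioo a b := ⟨by linarith [min_le_right x₀ x], by linarith [le_max_right x₀ x]⟩
  exact congrArg Prod.fst (this hxm)

/-- Turns integrability of a monotone or constant quantity into a sign; the arguments at infinity in
this part end here. -/
theorem nonpos_of_integrableOn_Ioi {f : ℝ → ℝ} {a δ : ℝ} (hf : IntegrableOn f (Ioi a))
    (h : ∀ x, a < x → δ ≤ f x) : δ ≤ 0 := by
  by_contra! hδ
  have : IntegrableOn (fun _ : ℝ => δ) (Ioi a) := by
    refine hf.mono' aestronglyMeasurable_const ?_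
    refine (ae_restrict_iff' measurableSet_Ioi).2 (.of_forall fun x hx => ?_)
    rw [Real.norm_of_nonneg hδ.le]
    exact h x hx
  rw [integrableOn_const_iff] at this
  simp [hδ.ne'] at this

/-- If `F'' = p F` with `p` bounded near infinity and `F` is square integrable, so is `F'`. -/
theorem IsC2.memLp_deriv {F F₁ p : ℝ → ℂ} (hF : IsC2 F F₁ (fun x => p x * F x)) {C : ℝ}
    (hp : ∀ x, 1 ≤ x → ‖p x‖ ≤ C) (h : MemLp F 2 (volume.restrict (Ioi 1))) :
    MemLp F₁ 2 (volume.restrict (Ioi 1)) := by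
  have hC0 : 0 ≤ C := (norm_nonneg _).trans (hp 1 le_rfl)
  have hsub : ∀ {x : ℝ}, Icc 1 x ⊆ Ioi (0 : ℝ) := fun {x} => Icc_subset_Ioi_zero one_pos
  have hm : AEStronglyMeasurable F₁ (volume.restrict (Ioi 1)) :=
    (hF.continuousOn_one.mono (Ioi_subset_Ioi zero_le_one)).aestronglyMeasurable measurableSet_Ioi
  have hI : IntegrableOn (fun x => ‖F x‖ ^ 2) (Ioi 1) := (memLp_two_iff_integrable_sq_norm h.1).1 h
  rw [memLp_two_iff_integrable_sq_norm hm]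
  set B := ∫ x in Ioi 1, ‖F x‖ ^ 2 with hB
  set S : ℝ → ℝ := fun x => inner ℝ (F x) (F₁ x) with hS
  have c1 : ∀ x, ContinuousOn (fun t => ‖F₁ t‖ ^ 2) (Icc 1 x) := fun x =>
    (hF.continuousOn_one.mono hsub).norm.pow 2
  have c0 : ∀ x, ContinuousOn (fun t => ‖F t‖ ^ 2) (Icc 1 x) := fun x =>
    (hF.continuousOn_zero.mono hsub).norm.pow 2
  -- `S = Re(F̄ F')` is half the derivative of `|F|²`. Since `S' = |F'|² + Re(F̄ p F)`, it dominates
  -- the integral of `|F'|²` up to the bounded error `C B`.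
  have hSd : ∀ x, 1 ≤ x → S 1 + (∫ t in (1 : ℝ)..x, ‖F₁ t‖ ^ 2) - C * B ≤ S x := by
    intro x hx
    have hd : ∀ t ∈ uIcc 1 x, HasDerivAt S
        (inner ℝ (F t) (p t * F t) + inner ℝ (F₁ t) (F₁ t)) t := fun t ht => by
      rw [uIcc_of_le hx] at ht
      exact (hF.hasDerivAt t (hsub ht)).inner ℝ (hF.hasDerivAt' t (hsub ht))
    have ci : ContinuousOn (fun t => (inner ℝ (F t) (p t * F t) + inner ℝ (F₁ t) (F₁ t) : ℝ))
        (Icc 1 x) :=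
      ((hF.continuousOn_zero.mono hsub).inner (hF.continuousOn.mono hsub)).add
        ((hF.continuousOn_one.mono hsub).inner (hF.continuousOn_one.mono hsub))
    have e := intervalIntegral.integral_eq_sub_of_hasDerivAt hd (by
      refine ContinuousOn.intervalIntegrable ?_
      rwa [uIcc_of_le hx])
    have i1 : IntervalIntegrable (fun t => ‖F₁ t‖ ^ 2) volume 1 x := by
      refine ContinuousOn.intervalIntegrable ?_
      rw [uIcc_of_le hx]; exact c1 x
    have i0 : IntervalIntegrable (fun t => ‖F t‖ ^ 2) volume 1 x := by
      refine ContinuousOn.intervalIntegrable ?_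
      rw [uIcc_of_le hx]; exact c0 x
    have l : ∫ t in (1 : ℝ)..x, (‖F₁ t‖ ^ 2 - C * ‖F t‖ ^ 2) ≤
        ∫ t in (1 : ℝ)..x, (inner ℝ (F t) (p t * F t) + inner ℝ (F₁ t) (F₁ t) : ℝ) := by
      refine intervalIntegral.integral_mono_on hx (i1.sub (i0.const_mul C)) ?_ ?_
      · refine ContinuousOn.intervalIntegrable ?_
        rwa [uIcc_of_le hx]
      · intro t ht
        rw [real_inner_self_eq_norm_sq]
        have h1 : |inner ℝ (F t) (p t * F t)| ≤ ‖F t‖ * ‖p t * F t‖ := abs_real_inner_le_norm _ _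
        have h2 : ‖F t‖ * ‖p t * F t‖ ≤ C * ‖F t‖ ^ 2 := by
          rw [norm_mul]
          nlinarith [hp t ht.1, sq_nonneg ‖F t‖]
        linarith [neg_abs_le (inner ℝ (F t) (p t * F t))]
    rw [e, intervalIntegral.integral_sub i1 (i0.const_mul C),
      intervalIntegral.integral_const_mul] at l
    have hle : ∫ t in (1 : ℝ)..x, ‖F t‖ ^ 2 ≤ B := by
      rw [intervalIntegral.integral_of_le hx]
      exact setIntegral_mono_set hI (.of_forall fun t => by positivity)
        (Eventually.of_forall fun t ht => ht.1)
    nlinarith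
  -- If the integral of `|F'|²` diverged, `S` would eventually be at least `1`, so `|F|²` would grow
  -- at least like `2t`, against its integrability.
  by_contra hne
  obtain ⟨x₀, hx₀, hbig⟩ : ∃ x₀, 1 ≤ x₀ ∧
      C * B - S 1 + 1 < ∫ t in (1 : ℝ)..x₀, ‖F₁ t‖ ^ 2 := by
    by_contra! hall
    refine hne (integrableOn_Ioi_of_intervalIntegral_norm_bounded (C * B - S 1 + 1) 1
      (l := atTop) (b := fun x : ℝ => x) (fun x => ?_) tendsto_id ?_)
    · exact ((c1 x).integrableOn_Icc).mono_set Ioc_subset_Icc_self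
    · filter_upwards [eventually_ge_atTop 1] with x hx
      simpa using hall x hx
  have hS1 : ∀ x, x₀ ≤ x → 1 ≤ S x := by
    intro x hx
    have hm : ∫ t in (1 : ℝ)..x₀, ‖F₁ t‖ ^ 2 ≤ ∫ t in (1 : ℝ)..x, ‖F₁ t‖ ^ 2 := by
      refine intervalIntegral.integral_mono_interval le_rfl hx₀ hx
        (.of_forall fun t => by positivity) ?_
      refine ContinuousOn.intervalIntegrable ?_
      rw [uIcc_of_le (hx₀.trans hx)]; exact c1 x
    linarith [hSd x (hx₀.trans hx)]
  have hN : ∀ x, x₀ + 1 < x → 2 ≤ ‖F x‖ ^ 2 := by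
    intro x hx
    have hd : ∀ t, x₀ ≤ t → HasDerivAt (fun t => ‖F t‖ ^ 2 - 2 * t)
        (2 * S t - 2 * 1) t := fun t ht =>
      ((hF.hasDerivAt t (by linarith)).norm_sq).sub ((hasDerivAt_id t).const_mul 2)
    have hmono : MonotoneOn (fun t => ‖F t‖ ^ 2 - 2 * t) (Ici x₀) := by
      refine monotoneOn_of_deriv_nonneg (convex_Ici _)
        (fun t ht => (hd t ht).continuousAt.continuousWithinAt)
        (fun t ht => (hd t (interior_subset ht)).differentiableAt.differentiableWithinAt) ?_
      intro t ht
      rw [(hd t (interior_subset ht)).deriv]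
      linarith [hS1 t (interior_subset ht)]
    have := hmono (self_mem_Ici) (show x ∈ Ici x₀ by simp only [mem_Ici]; linarith)
      (by linarith)
    simp only at this
    nlinarith [sq_nonneg ‖F x₀‖]
  have := nonpos_of_integrableOn_Ioi
    (hI.mono_set (Ioi_subset_Ioi (show (1 : ℝ) ≤ x₀ + 1 by linarith))) hN
  linarith

theorem integrableOn_wronskian {F F₁ G G₁ : ℝ → ℂ}
    (hF : MemLp F 2 (volume.restrict (Ioi 1))) (hF₁ : MemLp F₁ 2 (volume.restrict (Ioi 1)))
    (hG : MemLp G 2 (volume.restrict (Ioi 1))) (hG₁ : MemLp G₁ 2 (volume.restrict (Ioi 1))) :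
    IntegrableOn (wronskian F F₁ G G₁) (Ioi 1) :=
  (hF.integrable_mul hG₁).sub (hF₁.integrable_mul hG)

/-- The Wronskian of two solutions of the same equation is constant. -/
theorem IsC2.wronskian_eq {F F₁ G G₁ p : ℝ → ℂ} (hF : IsC2 F F₁ (fun x => p x * F x))
    (hG : IsC2 G G₁ (fun x => p x * G x)) {x y : ℝ} (hx : 0 < x) (hy : 0 < y) :
    wronskian F F₁ G G₁ x = wronskian F F₁ G G₁ y := by
  have hd : ∀ t ∈ Ioi (0 : ℝ), HasDerivAt (wronskian F F₁ G G₁) 0 t := fun t ht =>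
    (hF.hasDerivAt_wronskian hG ht).congr_deriv (by ring)
  exact isOpen_Ioi.is_const_of_deriv_eq_zero isPreconnected_Ioi
    (fun t ht => (hd t ht).differentiableAt.differentiableWithinAt)
    (fun t ht => (hd t ht).deriv) hx hy

/-- Two solutions which are square integrable at infinity are linearly dependent. -/
theorem IsC2.wronskian_eq_zero {F F₁ G G₁ p : ℝ → ℂ} (hF : IsC2 F F₁ (fun x => p x * F x))
    (hG : IsC2 G G₁ (fun x => p x * G x)) {C : ℝ} (hp : ∀ x, 1 ≤ x → ‖p x‖ ≤ C)
    (hF2 : MemLp F 2 (volume.restrict (Ioi 1))) (hG2 : MemLp G 2 (volume.restrict (Ioi 1)))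
    {x : ℝ} (hx : 0 < x) : wronskian F F₁ G G₁ x = 0 := by
  have hi := integrableOn_wronskian hF2 (hF.memLp_deriv hp hF2) hG2 (hG.memLp_deriv hp hG2)
  have := nonpos_of_integrableOn_Ioi hi.norm (δ := ‖wronskian F F₁ G G₁ x‖) fun y hy => by
    rw [hF.wronskian_eq hG hx (one_pos.trans hy)]
  exact norm_le_zero_iff.1 this

theorem norm_potential_sub_le (α z : ℂ) {x : ℝ} (hx : 1 ≤ x) :
    ‖potential α x - z‖ ≤ ‖-(1 / 4) + α‖ + ‖z‖ := by
  refine (norm_sub_le _ _).trans (add_le_add_left ?_ _)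
  rw [potential, norm_div, norm_pow, Complex.norm_real, Real.norm_of_nonneg (by linarith)]
  exact div_le_self (norm_nonneg _) (one_le_pow₀ hx)

theorem continuousOn_potential_sub (α z : ℂ) :
    ContinuousOn (fun x => potential α x - z) (Ioi 0) :=
  (continuousOn_potential α).sub continuousOn_const

/-- There are no square integrable solutions for positive energies. -/
theorem IsC2.eq_zero_of_pos {α : ℂ} (hα : α.im = 0) {z : ℝ} (hz : 0 < z) {F F₁ : ℝ → ℂ}
    (hF : IsC2 F F₁ (fun x => (potential α x - z) * F x))
    (hF2 : MemLp F 2 (volume.restrict (Ioi 1))) {x : ℝ} (hx : 0 < x) : F x = 0 := by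
  set c : ℝ := -(1 / 4) + α.re with hc
  have hpot : ∀ t : ℝ, potential α t = ((c / t ^ 2 : ℝ) : ℂ) := by
    intro t
    have : α = (α.re : ℂ) := Complex.ext rfl (by simpa using hα)
    rw [potential, this, hc]
    push_cast
    simp
  have hF12 := hF.memLp_deriv (fun t ht => norm_potential_sub_le α z ht) hF2
  -- Energy of an oscillator with slowly varying frequency: only the derivative of the potential
  -- enters `E'`, which leaves an integrable coefficient of order `t⁻³`.
  set E : ℝ → ℝ := fun t => ‖F₁ t‖ ^ 2 + (z - c / t ^ 2) * ‖F t‖ ^ 2 with hE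
  have hEd : ∀ t, 0 < t → HasDerivAt E (2 * c / t ^ 3 * ‖F t‖ ^ 2) t := by
    intro t ht
    have h1 := (hF.hasDerivAt' t ht).norm_sq
    have h2 := (hF.hasDerivAt t ht).norm_sq
    have h3 : HasDerivAt (fun t : ℝ => z - c / t ^ 2) (2 * c / t ^ 3) t := by
      have := ((hasDerivAt_pow 2 t).inv (by positivity)).const_mul c |>.const_sub z
      refine this.congr_deriv ?_
      field_simp
      simp
      ring
    refine (h1.add (h3.mul h2)).congr_deriv ?_
    have h4 : inner ℝ (F₁ t) ((potential α t - z) * F t) =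
        (c / t ^ 2 - z) * inner ℝ (F t) (F₁ t) := by
      rw [hpot, ← Complex.ofReal_sub, ← Complex.real_smul, real_inner_smul_right,
        real_inner_comm]
    rw [h4]
    ring
  -- Beyond `x₀` the potential is at most `z/2`, so `E` controls both `|F|²` and `|F'|²`.
  set x₀ : ℝ := max 1 (2 * |c| / z + 1) with hx₀
  have hx₀1 : 1 ≤ x₀ := le_max_left _ _
  have hlow : ∀ t, x₀ ≤ t → z / 2 ≤ z - c / t ^ 2 := by
    intro t ht
    have ht1 : 1 ≤ t := hx₀1.trans ht
    have h1 : 2 * |c| / z ≤ t := by linarith [le_max_right 1 (2 * |c| / z + 1)]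
    have h2 : c / t ^ 2 ≤ z / 2 := by
      rw [div_le_iff₀ (by positivity)]
      rw [div_le_iff₀ hz] at h1
      nlinarith [le_abs_self c, mul_le_mul_of_nonneg_left ht1 (show 0 ≤ t * z by positivity)]
    linarith
  have hE0 : ∀ t, x₀ ≤ t → z / 2 * ‖F t‖ ^ 2 ≤ E t := by
    intro t ht
    have := mul_le_mul_of_nonneg_right (hlow t ht) (sq_nonneg ‖F t‖)
    simp only [hE]
    nlinarith [sq_nonneg ‖F₁ t‖]
  -- With this `A`, `E ≥ (z/2)|F|²` yields `E' ≥ -(A/t³) E`. The weight in `Φ` is the corresponding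
  -- integrating factor, at most `1`, so `Φ` is nondecreasing and bounded by the integrable `E`.
  -- This forces `E x₀ ≤ 0`, and the initial data vanish.
  set A : ℝ := 4 * |c| / z with hA
  have hA0 : 0 ≤ A := by positivity
  set Φ : ℝ → ℝ := fun t => E t * Real.exp (-A / (2 * t ^ 2)) with hΦ
  have hΦd : ∀ t, 0 < t → HasDerivAt Φ
      (2 * c / t ^ 3 * ‖F t‖ ^ 2 * Real.exp (-A / (2 * t ^ 2)) +
        E t * (Real.exp (-A / (2 * t ^ 2)) * (A / t ^ 3))) t := by
    intro t ht
    refine (hEd t ht).mul (HasDerivAt.exp ?_)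
    have := (((hasDerivAt_pow 2 t).const_mul 2).inv (by positivity)).const_mul (-A)
    refine this.congr_deriv ?_
    field_simp
    simp
  have hmono : MonotoneOn Φ (Ici x₀) := by
    have hpos : ∀ t ∈ Ici x₀, 0 < t := fun t ht => by linarith [mem_Ici.1 ht]
    refine monotoneOn_of_deriv_nonneg (convex_Ici _)
      (fun t ht => (hΦd t (hpos t ht)).continuousAt.continuousWithinAt)
      (fun t ht =>
        (hΦd t (hpos t (interior_subset ht))).differentiableAt.differentiableWithinAt) ?_
    intro t ht
    have ht' := interior_subset ht
    have ht0 := hpos t ht'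
    rw [(hΦd t ht0).deriv]
    have h1 : 0 ≤ (2 * c * ‖F t‖ ^ 2 + A * E t) := by
      have h2 : 2 * |c| * ‖F t‖ ^ 2 ≤ A * E t := by
        have := mul_le_mul_of_nonneg_left (hE0 t ht') hA0
        calc 2 * |c| * ‖F t‖ ^ 2 = A * (z / 2 * ‖F t‖ ^ 2) := by
              rw [hA]; field_simp; ring
          _ ≤ _ := this
      nlinarith [mul_le_mul_of_nonneg_right (neg_abs_le c) (sq_nonneg ‖F t‖)]
    have h3 : 0 ≤ Real.exp (-A / (2 * t ^ 2)) / t ^ 3 * (2 * c * ‖F t‖ ^ 2 + A * E t) := by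
      positivity
    refine h3.trans_eq ?_
    ring
  have hEi : IntegrableOn E (Ioi x₀) := by
    have i1 := (memLp_two_iff_integrable_sq_norm hF12.1).1 hF12
    have i2 := (memLp_two_iff_integrable_sq_norm hF2.1).1 hF2
    have i3 : IntegrableOn (fun t => (z + |c|) * ‖F t‖ ^ 2 + ‖F₁ t‖ ^ 2) (Ioi x₀) :=
      ((i2.const_mul _).add i1).mono_measure (Measure.restrict_mono (Ioi_subset_Ioi hx₀1) le_rfl)
    refine i3.mono' ?_ ?_
    · exact ContinuousOn.aestronglyMeasurable (fun t ht =>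
        (hEd t (by linarith [mem_Ioi.1 ht])).continuousAt.continuousWithinAt) measurableSet_Ioi
    · refine (ae_restrict_iff' measurableSet_Ioi).2 (.of_forall fun t ht => ?_)
      have ht' : x₀ ≤ t := (mem_Ioi.1 ht).le
      have hc1 : -|c| ≤ c / t ^ 2 := by
        rw [le_div_iff₀ (by nlinarith)]
        have : 1 ≤ t ^ 2 := one_le_pow₀ (hx₀1.trans ht')
        nlinarith [neg_abs_le c, abs_nonneg c]
      rw [Real.norm_of_nonneg ((by positivity : (0 : ℝ) ≤ z / 2 * ‖F t‖ ^ 2).trans (hE0 t ht'))]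
      simp only [hE]
      nlinarith [sq_nonneg ‖F t‖]
  have hΦle : ∀ t, x₀ ≤ t → Φ t ≤ E t := by
    intro t ht
    refine mul_le_of_le_one_right ((by positivity : (0 : ℝ) ≤ z / 2 * ‖F t‖ ^ 2).trans
      (hE0 t ht)) (Real.exp_le_one_iff.2 ?_)
    exact div_nonpos_of_nonpos_of_nonneg (by linarith) (by positivity)
  have hΦ0 : Φ x₀ ≤ 0 := nonpos_of_integrableOn_Ioi hEi fun t ht =>
    (hmono self_mem_Ici (mem_Ici.2 ht.le) ht.le).trans (hΦle t ht.le)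
  have hEx : E x₀ ≤ 0 := by
    by_contra! h
    exact absurd hΦ0 (not_le.2 (mul_pos h (Real.exp_pos _)))
  have hFx : F x₀ = 0 := by
    have := hE0 x₀ le_rfl
    have h2 : ‖F x₀‖ ^ 2 ≤ 0 := by
      by_contra! h
      nlinarith
    simpa using h2
  have hF1x : F₁ x₀ = 0 := by
    simp only [hE, hFx] at hEx
    have h2 : ‖F₁ x₀‖ ^ 2 ≤ 0 := by simpa using hEx
    simpa using h2
  exact hF.eq_zero_of_initial (continuousOn_potential_sub α z) (by linarith) hFx hF1x hx

theorem IsC2.conj {F F₁ F₂ : ℝ → ℂ} (hF : IsC2 F F₁ F₂) :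
    IsC2 (fun x => conj (F x)) (fun x => conj (F₁ x)) (fun x => conj (F₂ x)) :=
  ⟨fun x hx => (hF.hasDerivAt x hx).star, fun x hx => (hF.hasDerivAt' x hx).star,
    Complex.continuous_conj.comp_continuousOn hF.continuousOn⟩

theorem conj_potential {α : ℂ} (hα : α.im = 0) (x : ℝ) : conj (potential α x) = potential α x := by
  refine Complex.conj_eq_iff_im.2 ?_
  rw [potential, ← Complex.ofReal_pow, Complex.div_ofReal_im]
  simp [hα]

/-- There are no square integrable solutions for nonreal energies whose Wronskian with their
complex conjugate vanishes at `0`. -/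
theorem IsC2.eq_zero_of_im_ne_zero {α : ℂ} (hα : α.im = 0) {z : ℂ} (hz : z.im ≠ 0)
    {F F₁ : ℝ → ℂ} (hF : IsC2 F F₁ (fun x => (potential α x - z) * F x))
    (hF2 : MemLp F 2 (volume.restrict (Ioi 1)))
    (h0 : Tendsto (wronskian F F₁ (fun x => conj (F x)) (fun x => conj (F₁ x))) (𝓝[>] 0) (𝓝 0))
    {x : ℝ} (hx : 0 < x) : F x = 0 := by
  have hF12 := hF.memLp_deriv (fun t ht => norm_potential_sub_le α z ht) hF2
  have hW := integrableOn_wronskian hF2 hF12 hF2.star hF12.star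
  set W := wronskian F F₁ (fun x => conj (F x)) (fun x => conj (F₁ x)) with hWdef
  -- As `W' = 2i Im z |F|²`, the factor `Im z` makes `V` nondecreasing whatever the sign of `Im z`.
  -- Its limit `0` at the origin gives `V ≥ 0`, its integrability at infinity gives `V ≤ 0`; hence
  -- `V' = 0` and `F = 0`.
  set V : ℝ → ℝ := fun t => z.im * (W t).im with hV
  have hVd : ∀ t, 0 < t → HasDerivAt V (2 * z.im ^ 2 * ‖F t‖ ^ 2) t := by
    intro t ht
    have h1 : HasDerivAt W _ t := hF.hasDerivAt_wronskian hF.conj ht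
    have h2 := (Complex.imCLM.hasFDerivAt.comp_hasDerivAt t h1).const_mul z.im
    refine h2.congr_deriv ?_
    have : F t * conj ((potential α t - z) * F t) - (potential α t - z) * F t * conj (F t) =
        ((2 * z.im * ‖F t‖ ^ 2 : ℝ) : ℂ) * Complex.I := by
      rw [map_mul, map_sub, conj_potential hα]
      have e1 := Complex.mul_conj' (F t)
      have e2 := Complex.sub_conj z
      push_cast
      push_cast at e2
      linear_combination (z - conj z) * e1 + (‖F t‖ : ℂ) ^ 2 * e2
    rw [this, Complex.imCLM_apply, Complex.im_ofReal_mul, Complex.I_im]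
    ring
  have hmono : MonotoneOn V (Ioi 0) := by
    refine monotoneOn_of_deriv_nonneg (convex_Ioi _)
      (fun t ht => (hVd t ht).continuousAt.continuousWithinAt)
      (fun t ht => (hVd t (interior_subset ht)).differentiableAt.differentiableWithinAt) ?_
    intro t ht
    rw [(hVd t (interior_subset ht)).deriv]
    positivity
  have hV0 : Tendsto V (𝓝[>] 0) (𝓝 0) := by
    have := ((Complex.continuous_im.tendsto 0).comp h0).const_mul z.im
    simpa using this
  have hnonneg : ∀ t, 0 < t → 0 ≤ V t := by
    intro t ht
    refine le_of_tendsto hV0 ?_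
    filter_upwards [Ioo_mem_nhdsGT ht] with s hs
    exact hmono hs.1 ht hs.2.le
  have hVi : IntegrableOn V (Ioi 1) := (hW.im).const_mul z.im
  have hnonpos : ∀ t, 0 < t → V t ≤ 0 := by
    intro t ht
    refine nonpos_of_integrableOn_Ioi
      (hVi.mono_set (Ioi_subset_Ioi (le_max_left 1 t))) fun s hs => ?_
    have : t < s := (le_max_right 1 t).trans_lt hs
    exact hmono ht (ht.trans this) this.le
  have hVz : V =ᶠ[𝓝 x] fun _ => 0 := by
    filter_upwards [Ioi_mem_nhds hx] with t ht
    exact le_antisymm (hnonpos t ht) (hnonneg t ht)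
  have hd := (hVd x hx).deriv
  rw [hVz.deriv_eq, deriv_const] at hd
  have : ‖F x‖ ^ 2 = 0 := by
    have h2 : 2 * z.im ^ 2 ≠ 0 := by positivity
    exact (mul_eq_zero.1 hd.symm).resolve_left h2
  simpa using this

end AlmostHomogeneous
end

/-! ### The decaying solution, through the Macdonald integral -/

noncomputable section

namespace AlmostHomogeneous

theorem ofReal_cpow_eq_exp {x : ℝ} (hx : 0 < x) (w : ℂ) :
    (x : ℂ) ^ w = Complex.exp (Real.log x * w) := by
  rw [Complex.cpow_def_of_ne_zero (by exact_mod_cast hx.ne'), Complex.ofReal_log hx.le]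

theorem ofReal_cpow_ne_zero {x : ℝ} (hx : 0 < x) (w : ℂ) : (x : ℂ) ^ w ≠ 0 := by
  rw [ofReal_cpow_eq_exp hx]
  exact Complex.exp_ne_zero _

theorem hasDerivAt_ofReal_cpow {x : ℝ} (hx : 0 < x) (w : ℂ) :
    HasDerivAt (fun y : ℝ => (y : ℂ) ^ w) (w * (x : ℂ) ^ w / x) x := by
  have hx' : (x : ℂ) ≠ 0 := by exact_mod_cast hx.ne'
  rcases eq_or_ne w 0 with rfl | hw
  · simpa using hasDerivAt_const x (1 : ℂ)
  · have := hasDerivAt_ofReal_cpow_const hx.ne' hw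
    rwa [Complex.cpow_sub _ _ hx', Complex.cpow_one, ← mul_div_assoc] at this

theorem continuousOn_ofReal_cpow (w : ℂ) : ContinuousOn (fun x : ℝ => (x : ℂ) ^ w) (Ioi 0) :=
  fun _ hx => (hasDerivAt_ofReal_cpow hx w).continuousAt.continuousWithinAt

/-- The integrand of `∫₀^∞ exp(-t - y/t) t^{-s-1} dt`. -/
def macdonaldIntegrand (s : ℂ) (y t : ℝ) : ℂ :=
  (Real.exp (-t - y / t) : ℂ) * (t : ℂ) ^ (-s - 1)

/-- The integral `∫₀^∞ exp(-t - y/t) t^{-s-1} dt`, which is `2 y^{-s/2} K_s(2√y)`. -/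
def macdonald (s : ℂ) (y : ℝ) : ℂ := ∫ t in Ioi 0, macdonaldIntegrand s y t

theorem continuousOn_macdonaldIntegrand (s : ℂ) (y : ℝ) :
    ContinuousOn (macdonaldIntegrand s y) (Ioi 0) := by
  refine ContinuousOn.mul ?_ (continuousOn_ofReal_cpow _)
  refine Complex.continuous_ofReal.comp_continuousOn (Real.continuous_exp.comp_continuousOn ?_)
  exact continuousOn_id.neg.sub (continuousOn_const.div continuousOn_id fun t ht => ne_of_gt ht)

theorem norm_macdonaldIntegrand (s : ℂ) (y : ℝ) {t : ℝ} (ht : 0 < t) :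
    ‖macdonaldIntegrand s y t‖ = Real.exp (-t - y / t) * t ^ (-s.re - 1) := by
  rw [macdonaldIntegrand, norm_mul, Complex.norm_real, Real.norm_of_nonneg (Real.exp_pos _).le,
    Complex.norm_cpow_eq_rpow_re_of_pos ht]
  simp

/-- Raise `u ≤ exp u` with `u = a/(p+1)` to the power `p`. Dividing by `p + 1` rather than by `p`
keeps `p = 0` allowed. -/
theorem rpow_le_mul_exp {a p : ℝ} (ha : 0 ≤ a) (hp : 0 ≤ p) :
    a ^ p ≤ (p + 1) ^ p * Real.exp a := by
  have hq : 0 < p + 1 := by linarith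
  have h1 : a / (p + 1) ≤ Real.exp (a / (p + 1)) := by
    linarith [Real.add_one_le_exp (a / (p + 1))]
  have h2 : (a / (p + 1)) ^ p ≤ Real.exp a := by
    refine (Real.rpow_le_rpow (by positivity) h1 hp).trans ?_
    rw [← Real.exp_mul]
    refine Real.exp_le_exp.2 ?_
    rw [div_mul_eq_mul_div, div_le_iff₀ hq]
    nlinarith
  rw [Real.div_rpow ha hq.le, div_le_iff₀ (by positivity)] at h2
  linarith

/-- Trades the factor `exp(-y/t)` for a power `(t/y)^p`, leaving a Gamma integrand that converges
once `p > Re s`. -/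
theorem norm_macdonaldIntegrand_le (s : ℂ) {y t p : ℝ} (hy : 0 < y) (ht : 0 < t) (hp : 0 ≤ p) :
    ‖macdonaldIntegrand s y t‖ ≤
      (p + 1) ^ p * y ^ (-p) * (Real.exp (-t) * t ^ ((p - s.re) - 1)) := by
  rw [norm_macdonaldIntegrand s y ht]
  have h := rpow_le_mul_exp (a := y / t) (by positivity) hp
  rw [Real.div_rpow hy.le ht.le, div_le_iff₀ (by positivity)] at h
  have e1 : Real.exp (-t - y / t) = Real.exp (-t) * (Real.exp (y / t))⁻¹ := by
    rw [sub_eq_add_neg, Real.exp_add, Real.exp_neg (y / t)]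
  have e2 : t ^ ((p - s.re) - 1) = t ^ p * t ^ (-s.re - 1) := by
    rw [← Real.rpow_add ht]; ring_nf
  have h3 : (Real.exp (y / t))⁻¹ ≤ (p + 1) ^ p * y ^ (-p) * t ^ p := by
    rw [Real.rpow_neg hy.le, inv_le_iff_one_le_mul₀ (Real.exp_pos _)]
    have hyp : 0 < y ^ p := Real.rpow_pos_of_pos hy p
    calc 1 = y ^ p * (y ^ p)⁻¹ := (mul_inv_cancel₀ hyp.ne').symm
      _ ≤ ((p + 1) ^ p * Real.exp (y / t) * t ^ p) * (y ^ p)⁻¹ := by gcongr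
      _ = _ := by ring
  rw [e1, e2]
  calc Real.exp (-t) * (Real.exp (y / t))⁻¹ * t ^ (-s.re - 1)
      ≤ Real.exp (-t) * ((p + 1) ^ p * y ^ (-p) * t ^ p) * t ^ (-s.re - 1) := by gcongr
    _ = _ := by ring

theorem integrableOn_macdonaldIntegrand (s : ℂ) {y : ℝ} (hy : 0 < y) :
    IntegrableOn (macdonaldIntegrand s y) (Ioi 0) := by
  have hp : 0 ≤ |s.re| + 1 := by positivity
  have hi := (Real.GammaIntegral_convergent (s := (|s.re| + 1) - s.re)
    (by linarith [le_abs_self s.re])).const_mul ((|s.re| + 1 + 1) ^ (|s.re| + 1) * y ^ (-(|s.re| + 1)))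
  refine hi.mono' ((continuousOn_macdonaldIntegrand s y).aestronglyMeasurable measurableSet_Ioi) ?_
  exact (ae_restrict_iff' measurableSet_Ioi).2
    (.of_forall fun t ht => norm_macdonaldIntegrand_le s hy ht hp)

/-- The exponent `p` is left free: a small one controls `y → 0`, a large one gives sufficient decay
as `y → ∞`. -/
theorem exists_norm_macdonald_le (s : ℂ) {p : ℝ} (hp : 0 ≤ p) (hps : s.re < p) :
    ∃ C, 0 ≤ C ∧ ∀ y, 0 < y → ‖macdonald s y‖ ≤ C * y ^ (-p) := by
  have hi := Real.GammaIntegral_convergent (s := p - s.re) (by linarith)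
  have hI0 : 0 ≤ ∫ t in Ioi 0, Real.exp (-t) * t ^ ((p - s.re) - 1) :=
    setIntegral_nonneg measurableSet_Ioi fun t ht => by
      have : 0 < t := ht
      positivity
  refine ⟨(p + 1) ^ p * ∫ t in Ioi 0, Real.exp (-t) * t ^ ((p - s.re) - 1), by positivity,
    fun y hy => ?_⟩
  have h := norm_integral_le_of_norm_le (μ := volume.restrict (Ioi 0))
    (hi.const_mul ((p + 1) ^ p * y ^ (-p)))
    ((ae_restrict_iff' measurableSet_Ioi).2
      (.of_forall fun t ht => norm_macdonaldIntegrand_le s hy ht hp))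
  rw [integral_const_mul] at h
  refine h.trans_eq ?_
  ring

theorem hasDerivAt_macdonald (s : ℂ) {y : ℝ} (hy : 0 < y) :
    HasDerivAt (macdonald s) (-macdonald (s + 1) y) y := by
  have hmeas : ∀ s y, AEStronglyMeasurable (macdonaldIntegrand s y) (volume.restrict (Ioi 0)) :=
    fun s y => (continuousOn_macdonaldIntegrand s y).aestronglyMeasurable measurableSet_Ioi
  have h := hasDerivAt_integral_of_dominated_loc_of_deriv_le (μ := volume.restrict (Ioi 0))
    (F := macdonaldIntegrand s) (F' := fun y t => -macdonaldIntegrand (s + 1) y t)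
    -- For `x > y/2` the factor `exp(-x/t)` is largest at `x = y/2`, so the integrand there
    -- dominates all derivatives near `y`.
    (bound := fun t => ‖macdonaldIntegrand (s + 1) (y / 2) t‖)
    (s := Ioi (y / 2)) (Ioi_mem_nhds (by linarith)) (.of_forall fun y => hmeas s y)
    (integrableOn_macdonaldIntegrand s hy) (hmeas (s + 1) y).neg ?_
    (integrableOn_macdonaldIntegrand (s + 1) (by positivity : 0 < y / 2)).norm ?_
  · have h2 := h.2
    rw [integral_neg] at h2
    exact h2
  · refine (ae_restrict_iff' measurableSet_Ioi).2 (.of_forall fun t ht x hx => ?_)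
    have ht : 0 < t := ht
    rw [norm_neg, norm_macdonaldIntegrand _ _ ht, norm_macdonaldIntegrand _ _ ht]
    have : y / 2 / t ≤ x / t := div_le_div_of_nonneg_right (le_of_lt hx) ht.le
    gcongr
  · refine (ae_restrict_iff' measurableSet_Ioi).2 (.of_forall fun t ht x _ => ?_)
    have ht : 0 < t := ht
    have ht' : (t : ℂ) ≠ 0 := by exact_mod_cast ht.ne'
    have h1 : HasDerivAt (fun x : ℝ => Real.exp (-t - x / t)) (Real.exp (-t - x / t) * (-(1 / t))) x :=
      (((hasDerivAt_id x).div_const t).const_sub (-t)).exp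
    refine (h1.ofReal_comp.mul_const ((t : ℂ) ^ (-s - 1))).congr_deriv ?_
    have e : (t : ℂ) ^ (-(s + 1) - 1) = (t : ℂ) ^ (-s - 1) / t := by
      rw [show -(s + 1) - 1 = (-s - 1) - 1 by ring, Complex.cpow_sub (-s - 1) 1 ht',
        Complex.cpow_one]
    rw [macdonaldIntegrand, e]
    generalize (t : ℂ) ^ (-s - 1) = P
    push_cast
    field_simp

/-- Substitute `t ↦ y/t`, carried out as the scaling `t = y x` followed by `x ↦ 1/x`. This is the
symmetry `K_s = K_{-s}`. -/
theorem macdonald_neg (s : ℂ) {y : ℝ} (hy : 0 < y) :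
    macdonald s y = (y : ℂ) ^ (-s) * macdonald (-s) y := by
  have e1 := integral_comp_mul_left_Ioi (macdonaldIntegrand s y) 0 hy
  rw [mul_zero] at e1
  have e2 := integral_comp_rpow_Ioi (fun x => macdonaldIntegrand s y (y * x))
    (show (-1 : ℝ) ≠ 0 by norm_num)
  have hy' : (y : ℂ) ≠ 0 := by exact_mod_cast hy.ne'
  have e3 : macdonald s y = (y : ℂ) * ∫ x in Ioi 0, macdonaldIntegrand s y (y * x) := by
    rw [e1, Complex.real_smul, Complex.ofReal_inv, mul_inv_cancel_left₀ hy']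
    rfl
  rw [e3, ← e2, macdonald, ← integral_const_mul, ← integral_const_mul]
  refine setIntegral_congr_fun measurableSet_Ioi fun x hx => ?_
  have hx : 0 < x := hx
  have hxy : 0 < y * x⁻¹ := by positivity
  have hx' : (x : ℂ) ≠ 0 := by exact_mod_cast hx.ne'
  simp only [macdonaldIntegrand, Real.rpow_neg_one]
  rw [show -(y * x⁻¹) - y / (y * x⁻¹) = -x - y / x by field_simp; ring,
    show (-1 : ℝ) - 1 = -2 by norm_num]
  rw [ofReal_cpow_eq_exp hxy, ofReal_cpow_eq_exp hy, ofReal_cpow_eq_exp hx,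
    Real.log_mul hy.ne' (inv_ne_zero hx.ne'), Real.log_inv, Complex.real_smul, abs_neg, abs_one,
    one_mul, Real.rpow_def_of_pos hx]
  have ey : (y : ℂ) = Complex.exp (Real.log y) := by
    rw [← Complex.ofReal_exp, Real.exp_log hy]
  rw [Complex.ofReal_exp (Real.log x * -2)]
  conv_lhs => rw [ey]
  have : ∀ a b c d e : ℂ, a + (b + d) = e → Complex.exp a * (Complex.exp b * (c * Complex.exp d)) =
      c * Complex.exp e := by
    intro a b c d e h
    rw [← h, Complex.exp_add, Complex.exp_add]
    ring
  rw [this _ _ _ _ (Real.log y * -s + Real.log x * (- -s - 1)), Complex.exp_add]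
  · ring
  · push_cast
    ring

/-- Differentiate the reflection formula `macdonald_neg` and compare with the derivative of the left
side; no integration by parts is needed. -/
theorem macdonald_recurrence (s : ℂ) {y : ℝ} (hy : 0 < y) :
    (y : ℂ) * macdonald (s + 1) y = s * macdonald s y + macdonald (s - 1) y := by
  have hy' : (y : ℂ) ≠ 0 := by exact_mod_cast hy.ne'
  have h1 := hasDerivAt_macdonald s hy
  have h2 := (hasDerivAt_ofReal_cpow hy (-s)).mul (hasDerivAt_macdonald (-s) hy)
  have h3 : macdonald s =ᶠ[𝓝 y] fun y => (y : ℂ) ^ (-s) * macdonald (-s) y := by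
    filter_upwards [Ioi_mem_nhds hy] with x hx using macdonald_neg s hx
  have e := (h1.congr_of_eventuallyEq h3.symm).unique h2
  have e4 := macdonald_neg s hy
  have e5 := macdonald_neg (s - 1) hy
  rw [show -(s - 1) = -s + 1 by ring, Complex.cpow_add _ _ hy', Complex.cpow_one] at e5
  field_simp at e
  rw [e5, e4]
  linear_combination -e

/-- For negative index, as `y → 0` the integrand increases to the Gamma integrand, which dominates
it. The Wronskian formulas are arranged so that only such indices occur. -/
theorem tendsto_macdonald {s : ℂ} (hs : 0 < s.re) :
    Tendsto (macdonald (-s)) (𝓝[>] 0) (𝓝 (Complex.Gamma s)) := by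
  rw [Complex.Gamma_eq_integral hs]
  have h := tendsto_integral_filter_of_dominated_convergence (μ := volume.restrict (Ioi 0))
    (l := 𝓝[>] (0 : ℝ)) (F := macdonaldIntegrand (-s))
    (f := fun t => (Real.exp (-t) : ℂ) * (t : ℂ) ^ (s - 1))
    (fun t => Real.exp (-t) * t ^ (s.re - 1)) ?_ ?_ (Real.GammaIntegral_convergent hs) ?_
  · exact h
  · exact .of_forall fun y =>
      (continuousOn_macdonaldIntegrand (-s) y).aestronglyMeasurable measurableSet_Ioi
  · filter_upwards [self_mem_nhdsWithin] with y hy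
    have hy : 0 < y := hy
    refine (ae_restrict_iff' measurableSet_Ioi).2 (.of_forall fun t ht => ?_)
    have ht : 0 < t := ht
    rw [norm_macdonaldIntegrand _ _ ht, Complex.neg_re, neg_neg]
    gcongr
    have : 0 < y / t := by positivity
    linarith
  · refine (ae_restrict_iff' measurableSet_Ioi).2 (.of_forall fun t ht => ?_)
    simp only [macdonaldIntegrand, neg_neg]
    refine Tendsto.mul_const _ ?_
    have : Continuous fun y : ℝ => ((Real.exp (-t - y / t) : ℝ) : ℂ) := by fun_prop
    simpa using (this.tendsto 0).mono_left nhdsWithin_le_nhds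

/-- Powers solving the homogeneous equation. -/
theorem isC2_ofReal_cpow {m w : ℂ} (hw : w * (w - 1) = -(1 / 4) + m ^ 2) :
    IsC2 (fun x : ℝ => (x : ℂ) ^ w) (fun x => w * (x : ℂ) ^ w / x)
      (fun x => potential (m ^ 2) x * (x : ℂ) ^ w) := by
  refine ⟨fun x hx => hasDerivAt_ofReal_cpow hx w, fun x hx => ?_,
    (continuousOn_potential _).mul (continuousOn_ofReal_cpow w)⟩
  have hx' : (x : ℂ) ≠ 0 := by exact_mod_cast hx.ne'
  refine (((hasDerivAt_ofReal_cpow hx w).const_mul w).div (hasDerivAt_id x).ofReal_comp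
    hx').congr_deriv ?_
  rw [potential, ← hw]
  simp only [id, Complex.ofReal_one]
  field_simp

/-- The solution of `L_{m²} f = -4 β f` which decays at infinity. -/
def decaying (m : ℂ) (β x : ℝ) : ℂ := (x : ℂ) ^ (1 / 2 + m) * macdonald m (β * x ^ 2)

/-- The derivative of `decaying`. -/
def decayingDeriv (m : ℂ) (β x : ℝ) : ℂ :=
  (1 / 2 + m) * (x : ℂ) ^ (1 / 2 + m) / x * macdonald m (β * x ^ 2) -
    2 * β * x * (x : ℂ) ^ (1 / 2 + m) * macdonald (m + 1) (β * x ^ 2)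

variable {m : ℂ} {β : ℝ}

theorem hasDerivAt_macdonald_comp (s : ℂ) (hβ : 0 < β) {x : ℝ} (hx : 0 < x) :
    HasDerivAt (fun x : ℝ => macdonald s (β * x ^ 2))
      (-(2 * β * x) * macdonald (s + 1) (β * x ^ 2)) x := by
  have h1 : HasDerivAt (fun x : ℝ => β * x ^ 2) (β * (2 * x)) x := by
    simpa using (hasDerivAt_pow 2 x).const_mul β
  refine ((hasDerivAt_macdonald s (by positivity : 0 < β * x ^ 2)).scomp x h1).congr_deriv ?_
  rw [Complex.real_smul]
  push_cast
  ring

theorem isC2_decaying (m : ℂ) (hβ : 0 < β) :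
    IsC2 (decaying m β) (decayingDeriv m β)
      (fun x => (potential (m ^ 2) x - (-4 * β : ℂ)) * decaying m β x) := by
  have h0 : ∀ x, 0 < x → HasDerivAt (decaying m β) (decayingDeriv m β x) x := by
    intro x hx
    refine ((hasDerivAt_ofReal_cpow hx _).mul
      (hasDerivAt_macdonald_comp m hβ hx)).congr_deriv ?_
    rw [decayingDeriv]
    ring
  refine ⟨h0, fun x hx => ?_, (continuousOn_potential_sub _ _).mul fun x hx =>
    (h0 x hx).continuousAt.continuousWithinAt⟩
  have hx' : (x : ℂ) ≠ 0 := by exact_mod_cast hx.ne'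
  have p1 := hasDerivAt_ofReal_cpow hx (1 / 2 + m)
  have hi := (hasDerivAt_id x).ofReal_comp
  have d1 := (((p1.const_mul (1 / 2 + m)).div hi hx').mul (hasDerivAt_macdonald_comp m hβ hx)).sub
    (((hi.const_mul (2 * (β : ℂ))).mul p1).mul (hasDerivAt_macdonald_comp (m + 1) hβ hx))
  refine d1.congr_deriv ?_
  -- The recurrence at index `m + 1` relates `macdonald` and its first two derivatives: it is the
  -- differential equation in disguise.
  have hr := macdonald_recurrence (m + 1) (by positivity : 0 < β * x ^ 2)
  rw [add_sub_cancel_right] at hr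
  simp only [id, Complex.ofReal_one, Pi.div_apply, Pi.mul_apply, decaying, potential]
  push_cast at hr
  generalize (x : ℂ) ^ (1 / 2 + m) = P
  field_simp
  linear_combination (64 * (β : ℂ) * (x : ℂ) ^ 2 * P) * hr

/-- Only the derivative of the Macdonald factor contributes. Reflecting the index `m + 1` cancels
all powers of `x` and leaves a function with a Gamma limit. -/
theorem wronskian_decaying_plus (m : ℂ) (hβ : 0 < β) {x : ℝ} (hx : 0 < x) :
    wronskian (decaying m β) (decayingDeriv m β) (fun x : ℝ => (x : ℂ) ^ (1 / 2 + m))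
      (fun x => (1 / 2 + m) * (x : ℂ) ^ (1 / 2 + m) / x) x =
      2 * (β : ℂ) ^ (-m) * macdonald (-(m + 1)) (β * x ^ 2) := by
  have hx' : (x : ℂ) ≠ 0 := by exact_mod_cast hx.ne'
  have h1 : wronskian (decaying m β) (decayingDeriv m β) (fun x : ℝ => (x : ℂ) ^ (1 / 2 + m))
      (fun x => (1 / 2 + m) * (x : ℂ) ^ (1 / 2 + m) / x) x =
      2 * β * x * ((x : ℂ) ^ (1 / 2 + m)) ^ 2 * macdonald (m + 1) (β * x ^ 2) := by
    simp only [wronskian, decaying, decayingDeriv]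
    ring
  have hy : 0 < β * x ^ 2 := by positivity
  rw [h1, macdonald_neg (m + 1) hy, ofReal_cpow_eq_exp hy, ofReal_cpow_eq_exp hx,
    ofReal_cpow_eq_exp hβ, Real.log_mul hβ.ne' (by positivity), Real.log_pow, ← Complex.exp_nat_mul]
  have ex : (x : ℂ) = Complex.exp (Real.log x) := by rw [← Complex.ofReal_exp, Real.exp_log hx]
  have eb : (β : ℂ) = Complex.exp (Real.log β) := by rw [← Complex.ofReal_exp, Real.exp_log hβ]
  have : ∀ a b c d e g : ℂ, a + b + c + d = e →
      2 * Complex.exp a * Complex.exp b * Complex.exp c * (Complex.exp d * g) =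
      2 * Complex.exp e * g := by
    intro a b c d e g h
    rw [← h, Complex.exp_add, Complex.exp_add, Complex.exp_add]
    ring
  nth_rewrite 1 [ex]
  nth_rewrite 1 [eb]
  refine this _ _ _ _ _ _ ?_
  push_cast
  ring

/-- The product of the two powers is `x`, and the recurrence collapses what remains into the single
index `m - 1`, whose real part is negative when `Re m < 1`. -/
theorem wronskian_decaying_minus (m : ℂ) (hβ : 0 < β) {x : ℝ} (hx : 0 < x) :
    wronskian (decaying m β) (decayingDeriv m β) (fun x : ℝ => (x : ℂ) ^ (1 / 2 - m))
      (fun x => (1 / 2 - m) * (x : ℂ) ^ (1 / 2 - m) / x) x =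
      2 * macdonald (-(1 - m)) (β * x ^ 2) := by
  have hx' : (x : ℂ) ≠ 0 := by exact_mod_cast hx.ne'
  have hprod : (x : ℂ) ^ (1 / 2 + m) * (x : ℂ) ^ (1 / 2 - m) = x := by
    rw [← Complex.cpow_add _ _ hx', show (1 / 2 + m) + (1 / 2 - m) = 1 by ring, Complex.cpow_one]
  have hr := macdonald_recurrence m (by positivity : 0 < β * x ^ 2)
  rw [show -(1 - m) = m - 1 by ring]
  push_cast at hr
  have h1 : wronskian (decaying m β) (decayingDeriv m β) (fun x : ℝ => (x : ℂ) ^ (1 / 2 - m))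
      (fun x => (1 / 2 - m) * (x : ℂ) ^ (1 / 2 - m) / x) x =
      ((x : ℂ) ^ (1 / 2 + m) * (x : ℂ) ^ (1 / 2 - m)) / x * (-2 * m * macdonald m (β * x ^ 2)) +
      2 * β * x * ((x : ℂ) ^ (1 / 2 + m) * (x : ℂ) ^ (1 / 2 - m)) *
        macdonald (m + 1) (β * x ^ 2) := by
    simp only [wronskian, decaying, decayingDeriv]
    ring
  rw [h1, hprod, div_self hx']
  linear_combination 2 * hr

theorem tendsto_mul_sq (hβ : 0 < β) : Tendsto (fun x : ℝ => β * x ^ 2) (𝓝[>] 0) (𝓝[>] 0) := by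
  refine tendsto_nhdsWithin_iff.2 ⟨?_, ?_⟩
  · have : Continuous fun x : ℝ => β * x ^ 2 := by fun_prop
    simpa using (this.tendsto 0).mono_left nhdsWithin_le_nhds
  · filter_upwards [self_mem_nhdsWithin] with x hx
    have : 0 < x := hx
    exact mem_Ioi.2 (by positivity)

theorem tendsto_wronskian_decaying_plus (hm : -1 < m.re) (hβ : 0 < β) :
    Tendsto (wronskian (decaying m β) (decayingDeriv m β) (fun x : ℝ => (x : ℂ) ^ (1 / 2 + m))
      (fun x => (1 / 2 + m) * (x : ℂ) ^ (1 / 2 + m) / x)) (𝓝[>] 0)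
      (𝓝 (2 * (β : ℂ) ^ (-m) * Complex.Gamma (m + 1))) := by
  have h := ((tendsto_macdonald (s := m + 1) (by simp; linarith)).comp
    (tendsto_mul_sq hβ)).const_mul (2 * (β : ℂ) ^ (-m))
  refine h.congr' ?_
  filter_upwards [self_mem_nhdsWithin] with x hx
  exact (wronskian_decaying_plus m hβ hx).symm

theorem tendsto_wronskian_decaying_minus (hm : m.re < 1) (hβ : 0 < β) :
    Tendsto (wronskian (decaying m β) (decayingDeriv m β) (fun x : ℝ => (x : ℂ) ^ (1 / 2 - m))
      (fun x => (1 / 2 - m) * (x : ℂ) ^ (1 / 2 - m) / x)) (𝓝[>] 0)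
      (𝓝 (2 * Complex.Gamma (1 - m))) := by
  have h := ((tendsto_macdonald (s := 1 - m) (by simp; linarith)).comp
    (tendsto_mul_sq hβ)).const_mul 2
  refine h.congr' ?_
  filter_upwards [self_mem_nhdsWithin] with x hx
  exact (wronskian_decaying_minus m hβ hx).symm

theorem exists_norm_decaying_le (m : ℂ) (hβ : 0 < β) {p : ℝ} (hp : 0 ≤ p) (hpm : m.re < p) :
    ∃ C, 0 ≤ C ∧ ∀ x, 0 < x → ‖decaying m β x‖ ≤ C * x ^ (1 / 2 + m.re - 2 * p) := by
  obtain ⟨C, hC0, hC⟩ := exists_norm_macdonald_le m hp hpm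
  refine ⟨C * β ^ (-p), by positivity, fun x hx => ?_⟩
  rw [decaying, norm_mul, Complex.norm_cpow_eq_rpow_re_of_pos hx]
  have h := hC (β * x ^ 2) (by positivity)
  have e : (β * x ^ 2) ^ (-p) = β ^ (-p) * x ^ (-2 * p) := by
    rw [Real.mul_rpow hβ.le (by positivity), ← Real.rpow_natCast, ← Real.rpow_mul hx.le]
    norm_num
  have e2 : x ^ (1 / 2 + m.re - 2 * p) = x ^ (1 / 2 + m.re) * x ^ (-2 * p) := by
    rw [← Real.rpow_add hx]; ring_nf
  have e3 : ((1 / 2 + m : ℂ)).re = 1 / 2 + m.re := by simp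
  rw [e3, e2]
  rw [e] at h
  calc x ^ (1 / 2 + m.re) * ‖macdonald m (β * x ^ 2)‖
      ≤ x ^ (1 / 2 + m.re) * (C * (β ^ (-p) * x ^ (-2 * p))) := by gcongr
    _ = _ := by ring

end AlmostHomogeneous
end

/-! ### Approximation by test functions and square integrability criteria -/

noncomputable section

namespace AlmostHomogeneous

/-- Dominated convergence in `L²`. -/
theorem tendsto_toLp_of_dominated {μ : Measure ℝ} {f : ℕ → ℝ → ℂ} {F : ℝ → ℂ} {B : ℝ → ℝ}
    (hf : ∀ n, MemLp (f n) 2 μ) (hF : MemLp F 2 μ) (hB : MemLp B 2 μ)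
    (hb : ∀ n, ∀ᵐ x ∂μ, ‖f n x - F x‖ ≤ B x)
    (hlim : ∀ᵐ x ∂μ, Tendsto (fun n => f n x) atTop (𝓝 (F x))) :
    Tendsto (fun n => (hf n).toLp (f n)) atTop (𝓝 (hF.toLp F)) := by
  rw [Lp.tendsto_Lp_iff_tendsto_eLpNorm'' f hf F hF]
  have hsq : Tendsto (fun n => ∫ x, ‖f n x - F x‖ ^ 2 ∂μ) atTop (𝓝 0) := by
    have h := tendsto_integral_of_dominated_convergence (μ := μ)
      (F := fun n x => ‖f n x - F x‖ ^ 2) (f := fun _ => (0 : ℝ)) (fun x => ‖B x‖ ^ 2)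
      (fun n => (((hf n).sub hF).1.norm.pow 2)) ((memLp_two_iff_integrable_sq_norm hB.1).1 hB) ?_ ?_
    · simpa using h
    · intro n
      filter_upwards [hb n] with x hx
      rw [norm_pow, norm_norm]
      exact pow_le_pow_left₀ (norm_nonneg _) (hx.trans (Real.le_norm_self _)) 2
    · filter_upwards [hlim] with x hx
      have := ((hx.sub_const (F x)).norm).pow 2
      simpa using this
  have h2 : ∀ n, eLpNorm (f n - F) 2 μ =
      ENNReal.ofReal ((∫ x, ‖f n x - F x‖ ^ 2 ∂μ) ^ (2⁻¹ : ℝ)) := by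
    intro n
    rw [((hf n).sub hF).eLpNorm_eq_integral_rpow_norm two_ne_zero ENNReal.ofNat_ne_top]
    simp
  simp only [h2]
  have h3 : Tendsto (fun n => (∫ x, ‖f n x - F x‖ ^ 2 ∂μ) ^ (2⁻¹ : ℝ)) atTop (𝓝 0) := by
    have := hsq.rpow_const (p := 2⁻¹) (Or.inr (by norm_num))
    rwa [Real.zero_rpow (by norm_num)] at this
  simpa using ENNReal.tendsto_ofReal h3

theorem IsC2.deriv_eqOn {F F₁ F₂ : ℝ → ℂ} (hF : IsC2 F F₁ F₂) {x : ℝ} (hx : 0 < x) :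
    deriv F x = F₁ x := (hF.hasDerivAt x hx).deriv

theorem IsC2.deriv_deriv_eqOn {F F₁ F₂ : ℝ → ℂ} (hF : IsC2 F F₁ F₂) {x : ℝ} (hx : 0 < x) :
    deriv (deriv F) x = F₂ x := by
  have : deriv F =ᶠ[𝓝 x] F₁ := by
    filter_upwards [Ioi_mem_nhds hx] with y hy using hF.deriv_eqOn hy
  rw [this.deriv_eq, (hF.hasDerivAt' x hx).deriv]

/-- The weight `|x|^k` makes bounds on `k`-th derivatives of a cutoff invariant under dilation,
hence uniform along rescaled cutoffs. -/
theorem exists_bound_mul_pow_of_eq_zero {g : ℝ → ℂ} (hg : Continuous g) {a b : ℝ}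
    (h0 : ∀ x, x < a ∨ b < x → g x = 0) (k : ℕ) : ∃ M, 0 ≤ M ∧ ∀ x, ‖g x‖ * |x| ^ k ≤ M := by
  obtain ⟨M, hM⟩ := (isCompact_Icc (a := a) (b := b)).exists_bound_of_continuousOn
    (f := fun x => g x * (x : ℂ) ^ k) (by fun_prop)
  refine ⟨max M 0, le_max_right _ _, fun x => ?_⟩
  by_cases hx : x ∈ Icc a b
  · have := hM x hx
    rw [norm_mul, norm_pow, Complex.norm_real, Real.norm_eq_abs] at this
    exact this.trans (le_max_left _ _)
  · rw [h0 x (by by_contra! h; exact hx ⟨h.1, h.2⟩), norm_zero, zero_mul]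
    exact le_max_right _ _

/-- A criterion for membership in the domain of the minimal operator. -/
theorem mem_minOp_graph_of_memLp {α : ℂ} {h h₁ h₂ : ℝ → ℂ} (hh : IsC2 h h₁ h₂)
    (hs : ContDiffOn ℝ ((⊤ : ℕ∞) : WithTop ℕ∞) h (Ioi 0)) {b : ℝ}
    (hb : ∀ x, b ≤ x → h x = 0) (hh2 : MemLp h 2 halfLine)
    (hg2 : MemLp (fun x => -h₂ x + potential α x * h x) 2 halfLine)
    (hd : MemLp (fun x => h₁ x / x) 2 halfLine) (hd2 : MemLp (fun x => h x / (x : ℂ) ^ 2) 2 halfLine) :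
    (hh2.toLp h, hg2.toLp _) ∈ (minOp α).graph := by
  set g : ℝ → ℂ := fun x => -h₂ x + potential α x * h x with hgdef
  obtain ⟨χ, hχ⟩ := exists_isCutoff one_lt_two
  obtain ⟨M₁, hM₁0, hM₁⟩ := exists_bound_mul_pow_of_eq_zero hχ.contDiff_deriv.continuous
    (fun x hx => hχ.deriv_eq_zero hx) 1
  obtain ⟨M₂, hM₂0, hM₂⟩ := exists_bound_mul_pow_of_eq_zero hχ.contDiff_deriv_deriv.continuous
    (fun x hx => hχ.deriv_deriv_eq_zero hx) 2
  -- `ρ n` removes the interval `]0, 1/(n+1)]` and equals `1` from `2/(n+1)` on; the scaled bounds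
  -- read `|ρ'| ≤ M₁/x` and `|ρ''| ≤ M₂/x²`, uniformly in `n`.
  set ρ : ℕ → ℝ → ℂ := fun n x => 1 - χ ((n + 1) * x) with hρ
  have hρs : ∀ n, ContDiff ℝ ((⊤ : ℕ∞) : WithTop ℕ∞) (ρ n) := fun n =>
    contDiff_const.sub (hχ.smooth.comp (by fun_prop))
  have hlin : ∀ (n : ℕ) (x : ℝ), HasDerivAt (fun x : ℝ => ((n : ℝ) + 1) * x) ((n : ℝ) + 1) x :=
    fun n x => by simpa using (hasDerivAt_id x).const_mul ((n : ℝ) + 1)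
  have hρ1 : ∀ n, deriv (ρ n) = fun x => -(((n + 1 : ℝ) : ℂ) * deriv χ ((n + 1) * x)) := by
    intro n
    ext x
    have h1 := ((hχ.hasDerivAt ((n + 1) * x)).scomp x (hlin n x)).const_sub 1
    rw [Complex.real_smul] at h1
    exact h1.deriv
  have hρ2 : ∀ n, deriv (deriv (ρ n)) =
      fun x => -(((n + 1 : ℝ) : ℂ) ^ 2 * deriv (deriv χ) ((n + 1) * x)) := by
    intro n
    ext x
    rw [hρ1]
    have h1 := (((hχ.hasDerivAt' ((n + 1) * x)).scomp x (hlin n x)).const_mul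
      ((n + 1 : ℝ) : ℂ)).neg
    rw [Complex.real_smul] at h1
    refine h1.deriv.trans ?_
    ring
  have hC2 : ∀ n, IsC2 (fun x => ρ n x * h x) _ _ := fun n => hh.smooth_mul (hρs n)
  have hzero : ∀ (n : ℕ) (x : ℝ), x ≤ 1 / ((n : ℝ) + 1) → ρ n x = 0 := by
    intro n x hx
    have : ((n : ℝ) + 1) * x ≤ 1 := by
      rw [le_div_iff₀ (by positivity)] at hx
      linarith
    simp [hρ, hχ.eq_one _ this]
  have htest : ∀ n, IsTestFunction (fun x => ρ n x * h x) := by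
    intro n
    have hpos : (0 : ℝ) < 1 / ((n : ℝ) + 1) := by positivity
    have hsup : tsupport (fun x => ρ n x * h x) ⊆ Icc (1 / ((n : ℝ) + 1)) b := by
      refine closure_minimal (fun x hx => ⟨?_, ?_⟩) isClosed_Icc
      · by_contra! hlt
        exact hx (by simp [hzero n x hlt.le])
      · by_contra! hlt
        exact hx (by simp [hb x hlt.le])
    refine ⟨?_, isCompact_Icc.of_isClosed_subset (isClosed_tsupport _) hsup,
      hsup.trans (Icc_subset_Ioi_zero hpos)⟩
    rw [contDiff_iff_contDiffAt]
    intro x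
    rcases lt_or_ge x (1 / ((n : ℝ) + 1)) with hx | hx
    · refine (contDiffAt_const (c := (0 : ℂ))).congr_of_eventuallyEq ?_
      filter_upwards [Iio_mem_nhds hx] with y hy
      rw [hzero n y (le_of_lt hy), zero_mul]
    · exact (hρs n).contDiffAt.mul (hs.contDiffAt (Ioi_mem_nhds (hpos.trans_le hx)))
  have hdiff : ∀ n x, 0 < x → diffExpr α (fun x => ρ n x * h x) x =
      ρ n x * g x - deriv (deriv (ρ n)) x * h x - 2 * deriv (ρ n) x * h₁ x := by
    intro n x hx
    rw [diffExpr, (hC2 n).deriv_deriv_eqOn hx]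
    simp only [hgdef, potential]
    ring
  have hmem0 : ∀ n, MemLp (fun x => ρ n x * h x) 2 halfLine := fun n =>
    (htest n).smooth.continuous.memLp_of_hasCompactSupport (htest n).compact
  have hmem1 : ∀ n, MemLp (diffExpr α fun x => ρ n x * h x) 2 halfLine := fun n =>
    ((htest n).continuous_diffExpr α).memLp_of_hasCompactSupport ((htest n).compact_diffExpr α)
  have hnorm : ∀ n x, ‖ρ n x - 1‖ ≤ 1 := by
    intro n x
    simp only [hρ, sub_sub_cancel_left, norm_neg]
    exact hχ.norm_le _
  have hevent : ∀ x : ℝ, 0 < x → ∀ᶠ n : ℕ in atTop, 2 < ((n : ℝ) + 1) * x := by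
    intro x hx
    obtain ⟨N, hN⟩ := exists_nat_gt (2 / x)
    filter_upwards [eventually_ge_atTop N] with n hn
    rw [div_lt_iff₀ hx] at hN
    have : (N : ℝ) ≤ n := by exact_mod_cast hn
    nlinarith
  have habs : ∀ (n : ℕ) (x : ℝ), 0 < x → |((n : ℝ) + 1) * x| = (n + 1) * x := fun n x hx =>
    abs_of_pos (by positivity)
  have t0 := tendsto_toLp_of_dominated hmem0 hh2 hh2.norm (by
    intro n
    refine .of_forall fun x => ?_
    rw [show ρ n x * h x - h x = (ρ n x - 1) * h x by ring, norm_mul]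
    exact mul_le_of_le_one_left (norm_nonneg _) (hnorm n x)) (by
    refine (ae_restrict_iff' measurableSet_Ioi).2 (.of_forall fun x hx => ?_)
    refine tendsto_const_nhds.congr' ?_
    filter_upwards [hevent x hx] with n hn
    simp [hρ, hχ.eq_zero _ hn.le])
  -- The commutator terms `ρ'' h` and `2 ρ' h'` vanish at each fixed point for large `n` and are
  -- dominated by `h/x²` and `h'/x`; this is where the last two integrability hypotheses are used.
  have t1 := tendsto_toLp_of_dominated hmem1 hg2
    ((hg2.norm.add (hd2.norm.const_mul M₂)).add (hd.norm.const_mul (2 * M₁))) (by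
    intro n
    refine (ae_restrict_iff' measurableSet_Ioi).2 (.of_forall fun x hx => ?_)
    have hx : 0 < x := hx
    rw [hdiff n x hx, show ρ n x * g x - deriv (deriv (ρ n)) x * h x - 2 * deriv (ρ n) x * h₁ x -
      g x = (ρ n x - 1) * g x - deriv (deriv (ρ n)) x * h x - 2 * deriv (ρ n) x * h₁ x by ring]
    refine (norm_sub_le _ _).trans (add_le_add ((norm_sub_le _ _).trans (add_le_add ?_ ?_)) ?_)
    · rw [norm_mul]
      exact mul_le_of_le_one_left (norm_nonneg _) (hnorm n x)
    · have := hM₂ (((n : ℝ) + 1) * x)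
      rw [habs n x hx] at this
      rw [hρ2, norm_mul, norm_neg, norm_mul, norm_pow, Complex.norm_real,
        Real.norm_of_nonneg (by positivity : (0 : ℝ) ≤ n + 1)]
      have e : ‖h x / (x : ℂ) ^ 2‖ = ‖h x‖ / x ^ 2 := by
        rw [norm_div, norm_pow, Complex.norm_real, Real.norm_of_nonneg hx.le]
      simp only [e]
      calc ((n : ℝ) + 1) ^ 2 * ‖deriv (deriv χ) ((n + 1) * x)‖ * ‖h x‖
          = (‖deriv (deriv χ) ((n + 1) * x)‖ * ((n + 1) * x) ^ 2) * (‖h x‖ / x ^ 2) := by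
            field_simp
        _ ≤ _ := by gcongr
    · have := hM₁ (((n : ℝ) + 1) * x)
      rw [habs n x hx, pow_one] at this
      rw [hρ1, norm_mul, norm_mul, norm_neg, norm_mul, Complex.norm_real,
        Real.norm_of_nonneg (by positivity : (0 : ℝ) ≤ n + 1), Complex.norm_ofNat]
      have e : ‖h₁ x / (x : ℂ)‖ = ‖h₁ x‖ / x := by
        rw [norm_div, Complex.norm_real, Real.norm_of_nonneg hx.le]
      simp only [e]
      calc 2 * (((n : ℝ) + 1) * ‖deriv χ ((n + 1) * x)‖) * ‖h₁ x‖
          = 2 * (‖deriv χ ((n + 1) * x)‖ * ((n + 1) * x)) * (‖h₁ x‖ / x) := by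
            field_simp
        _ ≤ _ := by gcongr) (by
    refine (ae_restrict_iff' measurableSet_Ioi).2 (.of_forall fun x hx => ?_)
    refine tendsto_const_nhds.congr' ?_
    filter_upwards [hevent x hx] with n hn
    rw [hdiff n x hx, hρ2, hρ1]
    simp [hρ, hχ.eq_zero _ hn.le, hχ.deriv_eq_zero (Or.inr hn),
      hχ.deriv_deriv_eq_zero (Or.inr hn)])
  rw [minOp_graph]
  refine mem_closure_of_tendsto (t0.prodMk_nhds t1) (.of_forall fun n => ?_)
  exact ⟨_, htest n, (hmem0 n).coeFn_toLp, (hmem1 n).coeFn_toLp⟩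

/-- Solutions of second order equations with smooth coefficients are smooth. -/
theorem IsC2.contDiffOn {F F₁ p : ℝ → ℂ} (hF : IsC2 F F₁ (fun x => p x * F x))
    (hp : ContDiffOn ℝ ((⊤ : ℕ∞) : WithTop ℕ∞) p (Ioi 0)) :
    ContDiffOn ℝ ((⊤ : ℕ∞) : WithTop ℕ∞) F (Ioi 0) := by
  have key : ∀ n : ℕ, ContDiffOn ℝ n F (Ioi 0) ∧ ContDiffOn ℝ n F₁ (Ioi 0) := by
    intro n
    induction n with
    | zero =>
      exact ⟨contDiffOn_zero.2 hF.continuousOn_zero, contDiffOn_zero.2 hF.continuousOn_one⟩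
    | succ n ih =>
      push_cast
      rw [contDiffOn_succ_iff_deriv_of_isOpen isOpen_Ioi,
        contDiffOn_succ_iff_deriv_of_isOpen isOpen_Ioi]
      refine ⟨⟨fun x hx => (hF.hasDerivAt x hx).differentiableAt.differentiableWithinAt,
        by simp, ih.2.congr fun x hx => (hF.hasDerivAt x hx).deriv⟩,
        fun x hx => (hF.hasDerivAt' x hx).differentiableAt.differentiableWithinAt,
        by simp, ContDiffOn.congr (f := fun x => p x * F x) ?_
          fun x hx => (hF.hasDerivAt' x hx).deriv⟩
      exact (hp.of_le (by exact_mod_cast le_top)).mul ih.1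
  exact contDiffOn_infty.2 fun n => (key n).1

theorem contDiffOn_potential_sub (α z : ℂ) :
    ContDiffOn ℝ ((⊤ : ℕ∞) : WithTop ℕ∞) (fun x => potential α x - z) (Ioi 0) := by
  have h1 : ContDiffOn ℝ ((⊤ : ℕ∞) : WithTop ℕ∞) (fun x : ℝ => (x : ℂ) ^ 2) (Ioi 0) :=
    (Complex.ofRealCLM.contDiff.pow 2).contDiffOn
  have h2 : ContDiffOn ℝ ((⊤ : ℕ∞) : WithTop ℕ∞)
      (fun x : ℝ => (-(1 / 4) + α) * ((x : ℂ) ^ 2)⁻¹ - z) (Ioi 0) := by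
    refine (contDiffOn_const.mul (h1.inv fun x hx => ?_)).sub contDiffOn_const
    have : (0 : ℝ) < x := hx
    simpa using this.ne'
  exact h2.congr fun x _ => by rw [potential, div_eq_mul_inv]

/-- Integrates the derivative bound from `s` to `x` and lets `s → 0`; `q > 0` makes the comparison
function finite at the origin. -/
theorem norm_le_of_norm_deriv_le_rpow {W W' : ℝ → ℂ} {C q : ℝ} (hq : 0 < q) (hC : 0 ≤ C)
    (hd : ∀ x, 0 < x → HasDerivAt W (W' x) x) (hb : ∀ x, 0 < x → ‖W' x‖ ≤ C * x ^ (q - 1))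
    (h0 : Tendsto W (𝓝[>] 0) (𝓝 0)) {x : ℝ} (hx : 0 < x) : ‖W x‖ ≤ C / q * x ^ q := by
  have hlim : Tendsto (fun s => ‖W x - W s‖) (𝓝[>] 0) (𝓝 ‖W x - 0‖) :=
    (tendsto_const_nhds.sub h0).norm
  rw [sub_zero] at hlim
  refine le_of_tendsto hlim ?_
  filter_upwards [Ioo_mem_nhdsGT hx] with s hs
  have hB : ∀ t, 0 < t → HasDerivAt (fun t => C / q * t ^ q) (C * t ^ (q - 1)) t := by
    intro t ht
    refine ((Real.hasDerivAt_rpow_const (Or.inl ht.ne')).const_mul (C / q)).congr_deriv ?_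
    field_simp
  have hpos : ∀ t ∈ Icc s x, 0 < t := fun t ht => hs.1.trans_le ht.1
  refine image_norm_le_of_norm_deriv_right_le_deriv_boundary' (f := fun t => W t - W s)
    (f' := W') (a := s) (b := x)
    (fun t ht => ((hd t (hpos t ht)).continuousAt.sub continuousAt_const).continuousWithinAt)
    (fun t ht => ((hd t (hpos t (Ico_subset_Icc_self ht))).sub_const _).hasDerivWithinAt)
    (B := fun t => C / q * t ^ q) (B' := fun t => C * t ^ (q - 1)) ?_
    (fun t ht => (hB t (hpos t ht)).continuousAt.continuousWithinAt)
    (fun t ht => (hB t (hpos t (Ico_subset_Icc_self ht))).hasDerivWithinAt)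
    (fun t ht => hb t (hpos t (Ico_subset_Icc_self ht))) ⟨hs.2.le, le_rfl⟩
  have := hs.1
  simp only [sub_self, norm_zero]
  positivity

theorem memLp_of_norm_le_rpow {w : ℝ → ℂ} {b C e : ℝ} (hb : 0 < b) (he : -(1 / 2) < e)
    (hw : ContinuousOn w (Ioi 0)) (h0 : ∀ x, b < x → w x = 0)
    (hC : ∀ x, 0 < x → x ≤ b → ‖w x‖ ≤ C * x ^ e) : MemLp w 2 halfLine := by
  rw [memLp_two_iff_integrable_sq_norm (hw.aestronglyMeasurable measurableSet_Ioi)]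
  have hi : IntegrableOn (fun x : ℝ => C ^ 2 * x ^ (2 * e)) (Ioc 0 b) := by
    have := (intervalIntegral.intervalIntegrable_rpow' (a := 0) (b := b)
      (show -1 < 2 * e by linarith)).const_mul (C ^ 2)
    rwa [intervalIntegrable_iff_integrableOn_Ioc_of_le hb.le] at this
  have h1 : IntegrableOn (fun x => ‖w x‖ ^ 2) (Ioc 0 b) := by
    refine hi.mono' (((hw.mono Ioc_subset_Ioi_self).norm.pow 2).aestronglyMeasurable
      measurableSet_Ioc) ?_
    refine (ae_restrict_iff' measurableSet_Ioc).2 (.of_forall fun x hx => ?_)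
    rw [norm_pow, norm_norm]
    refine (pow_le_pow_left₀ (norm_nonneg _) (hC x hx.1 hx.2) 2).trans_eq ?_
    rw [mul_pow, ← Real.rpow_natCast (x ^ e), ← Real.rpow_mul hx.1.le]
    norm_num [mul_comm]
  have h2 : IntegrableOn (fun x => ‖w x‖ ^ 2) (Ioi b) := by
    refine IntegrableOn.congr_fun (integrableOn_zero) (fun x hx => ?_) measurableSet_Ioi
    simp [h0 x hx]
  have := h1.union h2
  rwa [Ioc_union_Ioi_eq_Ioi hb.le] at this

theorem memLp_of_norm_le_rpow_two {w : ℝ → ℂ} {C D e d : ℝ} (he : -(1 / 2) < e)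
    (hd : d < -(1 / 2)) (hw : ContinuousOn w (Ioi 0))
    (hC : ∀ x, 0 < x → ‖w x‖ ≤ C * x ^ e) (hD : ∀ x, 0 < x → ‖w x‖ ≤ D * x ^ d) :
    MemLp w 2 halfLine := by
  rw [memLp_two_iff_integrable_sq_norm (hw.aestronglyMeasurable measurableSet_Ioi)]
  have hsq : ∀ {A k x : ℝ}, 0 < x → ‖w x‖ ≤ A * x ^ k → ‖‖w x‖ ^ 2‖ ≤ A ^ 2 * x ^ (2 * k) := by
    intro A k x hx h
    rw [norm_pow, norm_norm]
    refine (pow_le_pow_left₀ (norm_nonneg _) h 2).trans_eq ?_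
    rw [mul_pow, ← Real.rpow_natCast (x ^ k), ← Real.rpow_mul hx.le]
    norm_num [mul_comm]
  have h1 : IntegrableOn (fun x => ‖w x‖ ^ 2) (Ioc 0 1) := by
    have hi := (intervalIntegral.intervalIntegrable_rpow' (a := 0) (b := 1)
      (show -1 < 2 * e by linarith)).const_mul (C ^ 2)
    rw [intervalIntegrable_iff_integrableOn_Ioc_of_le zero_le_one] at hi
    refine hi.mono' (((hw.mono Ioc_subset_Ioi_self).norm.pow 2).aestronglyMeasurable
      measurableSet_Ioc) ?_
    exact (ae_restrict_iff' measurableSet_Ioc).2 (.of_forall fun x hx => hsq hx.1 (hC x hx.1))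
  have h2 : IntegrableOn (fun x => ‖w x‖ ^ 2) (Ioi 1) := by
    have hi : IntegrableOn (fun x : ℝ => D ^ 2 * x ^ (2 * d)) (Ioi 1) :=
      ((integrableOn_Ioi_rpow_iff one_pos).2 (by linarith : 2 * d < -1)).const_mul (D ^ 2)
    refine hi.mono' (((hw.mono (Ioi_subset_Ioi zero_le_one)).norm.pow 2).aestronglyMeasurable
      measurableSet_Ioi) ?_
    exact (ae_restrict_iff' measurableSet_Ioi).2 (.of_forall fun x hx =>
      hsq (one_pos.trans hx) (hD x (one_pos.trans hx)))
  have := h1.union h2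
  rwa [Ioc_union_Ioi_eq_Ioi zero_le_one] at this

theorem mem_eigenvalues_iff {m : ℂ} {κ : OnePoint ℂ} {z : ℂ} :
    z ∈ eigenvalues (almostHomOp m κ) ↔
      ∃ f : L2HalfLine, f ≠ 0 ∧ (f, z • f) ∈ maxGraph (m ^ 2) ∧ f ∈ boundarySpace m κ := by
  have hg : (maxOp (m ^ 2)).graph = maxGraph (m ^ 2) := maxOp_graph _
  constructor
  · rintro ⟨f, hf0, hf⟩
    have hdom : (f : L2HalfLine) ∈ boundarySpace m κ ⊓ (maxOp (m ^ 2)).domain := f.2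
    refine ⟨f, hf0, ?_, hdom.1⟩
    rw [← hg, ← hf]
    exact LinearPMap.le_graph_of_le (LinearPMap.domRestrict_le) (LinearPMap.mem_graph _ f)
  · rintro ⟨f, hf0, hf, hb⟩
    rw [← hg, LinearPMap.mem_graph_iff] at hf
    obtain ⟨y, hy1, hy2⟩ := hf
    refine ⟨⟨f, hb, (show (y : L2HalfLine) = f from hy1) ▸ y.2⟩, hf0, ?_⟩
    refine Eq.trans ?_ hy2
    exact LinearPMap.domRestrict_apply hy1.symm

/-- Two choices of the free exponent: `p` just above `max 0 (Re m)` keeps the power above `-1/2`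
near `0`, possible because `|Re m| < 1`, while `p = 2` pushes it below `-1/2` at infinity. -/
theorem memLp_decaying {m : ℂ} (hm : |m.re| < 1) {β : ℝ} (hβ : 0 < β) :
    MemLp (decaying m β) 2 halfLine := by
  obtain ⟨h1, h2⟩ := abs_lt.1 hm
  have hp : max 0 m.re < (1 + m.re) / 2 := max_lt (by linarith) (by linarith)
  obtain ⟨p, hp1, hp2⟩ := exists_between hp
  obtain ⟨C, -, hC⟩ := exists_norm_decaying_le m hβ ((le_max_left _ _).trans hp1.le)
    ((le_max_right _ _).trans_lt hp1)
  obtain ⟨D, -, hD⟩ := exists_norm_decaying_le m hβ zero_le_two (by linarith : m.re < 2)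
  exact memLp_of_norm_le_rpow_two (by linarith) (by linarith)
    (isC2_decaying m hβ).continuousOn_zero hC hD

end AlmostHomogeneous
end

/-! ### Boundary functions, and sufficiency of the eigenvalue equation -/

noncomputable section

namespace AlmostHomogeneous

theorem IsC2.const_mul {F F₁ F₂ : ℝ → ℂ} (hF : IsC2 F F₁ F₂) (c : ℂ) :
    IsC2 (fun x => c * F x) (fun x => c * F₁ x) (fun x => c * F₂ x) :=
  ⟨fun x hx => (hF.hasDerivAt x hx).const_mul c, fun x hx => (hF.hasDerivAt' x hx).const_mul c,
    continuousOn_const.mul hF.continuousOn⟩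

theorem IsC2.add {F F₁ F₂ G G₁ G₂ : ℝ → ℂ} (hF : IsC2 F F₁ F₂) (hG : IsC2 G G₁ G₂) :
    IsC2 (fun x => F x + G x) (fun x => F₁ x + G₁ x) (fun x => F₂ x + G₂ x) :=
  ⟨fun x hx => (hF.hasDerivAt x hx).add (hG.hasDerivAt x hx),
    fun x hx => (hF.hasDerivAt' x hx).add (hG.hasDerivAt' x hx),
    hF.continuousOn.add hG.continuousOn⟩

theorem IsC2.sub {F F₁ F₂ G G₁ G₂ : ℝ → ℂ} (hF : IsC2 F F₁ F₂) (hG : IsC2 G G₁ G₂) :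
    IsC2 (fun x => F x - G x) (fun x => F₁ x - G₁ x) (fun x => F₂ x - G₂ x) :=
  ⟨fun x hx => (hF.hasDerivAt x hx).sub (hG.hasDerivAt x hx),
    fun x hx => (hF.hasDerivAt' x hx).sub (hG.hasDerivAt' x hx),
    hF.continuousOn.sub hG.continuousOn⟩

theorem IsC2.congr_second {F F₁ F₂ G₂ : ℝ → ℂ} (hF : IsC2 F F₁ F₂) (h : ∀ x, F₂ x = G₂ x) :
    IsC2 F F₁ G₂ := by
  rwa [show G₂ = F₂ from funext fun x => (h x).symm]

theorem wronskian_sub_const_mul (F F₁ B B₁ u u₁ : ℝ → ℂ) (c : ℂ) (x : ℝ) :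
    wronskian (fun x => F x - c * B x) (fun x => F₁ x - c * B₁ x) u u₁ x =
      wronskian F F₁ u u₁ x - c * wronskian B B₁ u u₁ x := by
  simp only [wronskian]
  ring

/-- The function `x ^ w` on `]0,∞[`. -/
abbrev powFun (w : ℂ) : ℝ → ℂ := fun x => (x : ℂ) ^ w

/-- The derivative of `powFun w`. -/
abbrev powDeriv (w : ℂ) : ℝ → ℂ := fun x => w * (x : ℂ) ^ w / x

theorem isC2_powFun_plus (m : ℂ) : IsC2 (powFun (1 / 2 + m)) (powDeriv (1 / 2 + m))
    (fun x => potential (m ^ 2) x * powFun (1 / 2 + m) x) := isC2_ofReal_cpow (by ring)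

theorem isC2_powFun_minus (m : ℂ) : IsC2 (powFun (1 / 2 - m)) (powDeriv (1 / 2 - m))
    (fun x => potential (m ^ 2) x * powFun (1 / 2 - m) x) := isC2_ofReal_cpow (by ring)

theorem wronskian_powFun (m : ℂ) {x : ℝ} (hx : 0 < x) :
    wronskian (powFun (1 / 2 - m)) (powDeriv (1 / 2 - m)) (powFun (1 / 2 + m))
      (powDeriv (1 / 2 + m)) x = 2 * m := by
  have hx' : (x : ℂ) ≠ 0 := by exact_mod_cast hx.ne'
  have hprod : (x : ℂ) ^ (1 / 2 - m) * (x : ℂ) ^ (1 / 2 + m) = x := by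
    rw [← Complex.cpow_add _ _ hx', show (1 / 2 - m) + (1 / 2 + m) = 1 by ring, Complex.cpow_one]
  have : wronskian (powFun (1 / 2 - m)) (powDeriv (1 / 2 - m)) (powFun (1 / 2 + m))
      (powDeriv (1 / 2 + m)) x =
      ((x : ℂ) ^ (1 / 2 - m) * (x : ℂ) ^ (1 / 2 + m)) / x * (2 * m) := by
    simp only [wronskian]
    ring
  rw [this, hprod, div_self hx', one_mul]

/-- The derivative of `boundaryFun m κ` for finite `κ`. -/
abbrev boundaryDeriv (m κ : ℂ) : ℝ → ℂ := fun x =>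
  powDeriv (1 / 2 - m) x + κ * powDeriv (1 / 2 + m) x

theorem isC2_boundaryFun (m κ : ℂ) : IsC2 (boundaryFun m (OnePoint.some κ)) (boundaryDeriv m κ)
    (fun x => potential (m ^ 2) x * boundaryFun m (OnePoint.some κ) x) :=
  ((isC2_powFun_minus m).add ((isC2_powFun_plus m).const_mul κ)).congr_second fun x => by
    simp only [boundaryFun]
    ring

theorem wronskian_boundaryFun_plus (m κ : ℂ) {x : ℝ} (hx : 0 < x) :
    wronskian (boundaryFun m (OnePoint.some κ)) (boundaryDeriv m κ) (powFun (1 / 2 + m))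
      (powDeriv (1 / 2 + m)) x = 2 * m := by
  rw [← wronskian_powFun m hx]
  simp only [wronskian, boundaryFun]
  ring

theorem wronskian_boundaryFun_minus (m κ : ℂ) {x : ℝ} (hx : 0 < x) :
    wronskian (boundaryFun m (OnePoint.some κ)) (boundaryDeriv m κ) (powFun (1 / 2 - m))
      (powDeriv (1 / 2 - m)) x = -2 * m * κ := by
  have h : wronskian (boundaryFun m (OnePoint.some κ)) (boundaryDeriv m κ) (powFun (1 / 2 - m))
      (powDeriv (1 / 2 - m)) x = -κ * wronskian (powFun (1 / 2 - m)) (powDeriv (1 / 2 - m))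
        (powFun (1 / 2 + m)) (powDeriv (1 / 2 + m)) x := by
    simp only [wronskian, boundaryFun]
    ring
  rw [h, wronskian_powFun m hx]
  ring

theorem norm_powFun {w : ℂ} {x : ℝ} (hx : 0 < x) : ‖powFun w x‖ = x ^ w.re :=
  Complex.norm_cpow_eq_rpow_re_of_pos hx w

theorem norm_powDeriv {w : ℂ} {x : ℝ} (hx : 0 < x) : ‖powDeriv w x‖ = ‖w‖ * x ^ (w.re - 1) := by
  rw [powDeriv, norm_div, norm_mul, Complex.norm_cpow_eq_rpow_re_of_pos hx, Complex.norm_real,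
    Real.norm_of_nonneg hx.le, Real.rpow_sub_one hx.ne', mul_div_assoc]

/-- If the boundary Wronskians of `K - c b` vanish then `K - c b` is small near `0`. -/
theorem exists_norm_le_of_tendsto_wronskian {m : ℂ} (hm0 : m ≠ 0) {D D₁ K : ℝ → ℂ} {z : ℂ}
    (hD : IsC2 D D₁ (fun x => potential (m ^ 2) x * D x - z * K x)) {C e : ℝ} (hC : 0 ≤ C)
    (hK : ∀ x, 0 < x → ‖K x‖ ≤ C * x ^ e) (he : |m.re| < e + 3 / 2)
    (hp : Tendsto (wronskian D D₁ (powFun (1 / 2 + m)) (powDeriv (1 / 2 + m))) (𝓝[>] 0) (𝓝 0))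
    (hn : Tendsto (wronskian D D₁ (powFun (1 / 2 - m)) (powDeriv (1 / 2 - m))) (𝓝[>] 0) (𝓝 0)) :
    ∃ A, 0 ≤ A ∧ ∀ x, 0 < x → ‖D x‖ ≤ A * x ^ (e + 2) ∧ ‖D₁ x‖ ≤ A * x ^ (e + 1) := by
  -- For a homogeneous solution `u` one has `W(D, u)' = z K u`, so a zero limit at the origin
  -- improves to a power bound one order better than that of `K u`.
  have key : ∀ (w : ℂ) (q : ℝ), q = e + 1 + w.re → 0 < q →
      IsC2 (powFun w) (powDeriv w) (fun x => potential (m ^ 2) x * powFun w x) →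
      Tendsto (wronskian D D₁ (powFun w) (powDeriv w)) (𝓝[>] 0) (𝓝 0) →
      ∀ x, 0 < x → ‖wronskian D D₁ (powFun w) (powDeriv w) x‖ ≤ (‖z‖ * C) / q * x ^ q := by
    intro w q hq hq0 hw h0 x hx
    refine norm_le_of_norm_deriv_le_rpow hq0 (by positivity)
      (fun t ht => hD.hasDerivAt_wronskian hw ht) (fun t ht => ?_) h0 hx
    rw [show D t * (potential (m ^ 2) t * powFun w t) -
      (potential (m ^ 2) t * D t - z * K t) * powFun w t = z * K t * powFun w t by ring,
      norm_mul, norm_mul, norm_powFun ht, show q - 1 = e + w.re by linarith, Real.rpow_add ht]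
    calc ‖z‖ * ‖K t‖ * t ^ w.re ≤ ‖z‖ * (C * t ^ e) * t ^ w.re := by gcongr; exact hK t ht
      _ = _ := by ring
  obtain ⟨he1, he2⟩ := abs_lt.1 he
  have r1 : (1 / 2 + m : ℂ).re = 1 / 2 + m.re := by simp
  have r2 : (1 / 2 - m : ℂ).re = 1 / 2 - m.re := by simp
  have k1 := key (1 / 2 + m) (e + 3 / 2 + m.re) (by rw [r1]; ring) (by linarith)
    (isC2_powFun_plus m) hp
  have k2 := key (1 / 2 - m) (e + 3 / 2 - m.re) (by rw [r2]; ring) (by linarith)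
    (isC2_powFun_minus m) hn
  set A₁ := (‖z‖ * C) / (e + 3 / 2 + m.re) with hA₁
  set A₂ := (‖z‖ * C) / (e + 3 / 2 - m.re) with hA₂
  have hA₁0 : 0 ≤ A₁ := div_nonneg (by positivity) (by linarith)
  have hA₂0 : 0 ≤ A₂ := div_nonneg (by positivity) (by linarith)
  have h2m : 0 < ‖2 * m‖ := by simpa using hm0
  set B := 1 + ‖(1 / 2 - m : ℂ)‖ + ‖(1 / 2 + m : ℂ)‖ with hB
  have hB1 : 1 ≤ B := by
    have := norm_nonneg (1 / 2 - m : ℂ)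
    have := norm_nonneg (1 / 2 + m : ℂ)
    linarith
  refine ⟨B * (A₁ + A₂) / ‖2 * m‖, by positivity, fun x hx => ⟨?_, ?_⟩⟩
  -- Variation of constants: `D` is recovered by Cramer's rule from its Wronskians with the two
  -- powers, whose own Wronskian is `2m ≠ 0`. The exponents `±m` cancel. The same rule gives `D₁`
  -- below.
  · have e1 : 2 * m * D x = powFun (1 / 2 - m) x *
        wronskian D D₁ (powFun (1 / 2 + m)) (powDeriv (1 / 2 + m)) x -
        powFun (1 / 2 + m) x *
          wronskian D D₁ (powFun (1 / 2 - m)) (powDeriv (1 / 2 - m)) x := by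
      rw [← wronskian_powFun m hx]
      simp only [wronskian]
      ring
    have e2 : ‖2 * m‖ * ‖D x‖ ≤ (A₁ + A₂) * x ^ (e + 2) := by
      rw [← norm_mul, e1]
      refine (norm_sub_le _ _).trans ?_
      rw [norm_mul, norm_mul, norm_powFun hx, norm_powFun hx, r1, r2, add_mul]
      refine add_le_add ?_ ?_
      · refine (mul_le_mul_of_nonneg_left (k1 x hx) (by positivity)).trans_eq ?_
        rw [mul_left_comm, ← Real.rpow_add hx]
        congr 2
        ring
      · refine (mul_le_mul_of_nonneg_left (k2 x hx) (by positivity)).trans_eq ?_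
        rw [mul_left_comm, ← Real.rpow_add hx]
        congr 2
        ring
    rw [div_mul_eq_mul_div, le_div_iff₀ h2m, mul_comm]
    refine e2.trans ?_
    have : 0 ≤ (A₁ + A₂) * x ^ (e + 2) := by positivity
    nlinarith
  · have e1 : 2 * m * D₁ x = powDeriv (1 / 2 - m) x *
        wronskian D D₁ (powFun (1 / 2 + m)) (powDeriv (1 / 2 + m)) x -
        powDeriv (1 / 2 + m) x *
          wronskian D D₁ (powFun (1 / 2 - m)) (powDeriv (1 / 2 - m)) x := by
      rw [← wronskian_powFun m hx]
      simp only [wronskian]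
      ring
    rw [div_mul_eq_mul_div, le_div_iff₀ h2m, mul_comm, ← norm_mul, e1]
    refine (norm_sub_le _ _).trans ?_
    rw [norm_mul, norm_mul, norm_powDeriv hx, norm_powDeriv hx, r1, r2]
    have l1 : ‖(1 / 2 - m : ℂ)‖ * x ^ (1 / 2 - m.re - 1) *
        ‖wronskian D D₁ (powFun (1 / 2 + m)) (powDeriv (1 / 2 + m)) x‖ ≤
        B * A₁ * x ^ (e + 1) := by
      have hx1 : x ^ (e + 1) = x ^ (1 / 2 - m.re - 1) * x ^ (e + 3 / 2 + m.re) := by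
        rw [← Real.rpow_add hx]
        congr 1
        ring
      rw [hx1]
      have hb : ‖(1 / 2 - m : ℂ)‖ ≤ B := by linarith [norm_nonneg (1 / 2 + m : ℂ)]
      calc _ ≤ B * x ^ (1 / 2 - m.re - 1) * (A₁ * x ^ (e + 3 / 2 + m.re)) := by
            gcongr
            exact k1 x hx
        _ = _ := by ring
    have l2 : ‖(1 / 2 + m : ℂ)‖ * x ^ (1 / 2 + m.re - 1) *
        ‖wronskian D D₁ (powFun (1 / 2 - m)) (powDeriv (1 / 2 - m)) x‖ ≤
        B * A₂ * x ^ (e + 1) := by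
      have hx1 : x ^ (e + 1) = x ^ (1 / 2 + m.re - 1) * x ^ (e + 3 / 2 - m.re) := by
        rw [← Real.rpow_add hx]
        congr 1
        ring
      rw [hx1]
      have hb : ‖(1 / 2 + m : ℂ)‖ ≤ B := by linarith [norm_nonneg (1 / 2 - m : ℂ)]
      calc _ ≤ B * x ^ (1 / 2 + m.re - 1) * (A₂ * x ^ (e + 3 / 2 - m.re)) := by
            gcongr
            exact k2 x hx
        _ = _ := by ring
    linarith

/-- A small function with square integrable image under `L_α` belongs to the domain of the minimal
operator around `0`. -/
theorem exists_mem_minOp_domain {α z : ℂ} {D D₁ K : ℝ → ℂ}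
    (hD : IsC2 D D₁ (fun x => potential α x * D x - z * K x))
    (hs : ContDiffOn ℝ ((⊤ : ℕ∞) : WithTop ℕ∞) D (Ioi 0))
    {A C e : ℝ} (hA : 0 ≤ A) (he : -(1 / 2) < e)
    (hK : ∀ x, 0 < x → ‖K x‖ ≤ C * x ^ e)
    (hDle : ∀ x, 0 < x → ‖D x‖ ≤ A * x ^ (e + 2) ∧ ‖D₁ x‖ ≤ A * x ^ (e + 1)) :
    ∃ h ∈ (minOp α).domain, ∀ᵐ x ∂halfLine, x < 1 → D x = h x := by
  obtain ⟨χ, hχ⟩ := exists_isCutoff one_lt_two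
  obtain ⟨M₁, hM₁0, hM₁⟩ := exists_bound_mul_pow_of_eq_zero hχ.contDiff_deriv.continuous
    (fun x hx => hχ.deriv_eq_zero hx) 0
  obtain ⟨M₂, hM₂0, hM₂⟩ := exists_bound_mul_pow_of_eq_zero hχ.contDiff_deriv_deriv.continuous
    (fun x hx => hχ.deriv_deriv_eq_zero hx) 0
  simp only [pow_zero, mul_one] at hM₁ hM₂
  have hh := hD.smooth_mul hχ.smooth
  set h : ℝ → ℂ := fun x => χ x * D x with hh0
  set h₁ : ℝ → ℂ := fun x => deriv χ x * D x + χ x * D₁ x with hh1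
  set h₂ : ℝ → ℂ := fun x => deriv (deriv χ) x * D x + 2 * deriv χ x * D₁ x +
    χ x * (potential α x * D x - z * K x) with hh2
  have hz : ∀ x, 2 < x → h x = 0 ∧ h₁ x = 0 ∧ h₂ x = 0 := by
    intro x hx
    simp [hh0, hh1, hh2, hχ.eq_zero x hx.le, hχ.deriv_eq_zero (Or.inr hx),
      hχ.deriv_deriv_eq_zero (Or.inr hx)]
  have hne : ∀ {x : ℝ}, x ∈ Ioi (0 : ℝ) → (x : ℂ) ≠ 0 := fun {x} hx => by
    have : (0 : ℝ) < x := hx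
    exact_mod_cast this.ne'
  have p1 : ∀ x : ℝ, 0 < x → x ^ (e + 1) = x ^ e * x := fun x hx => Real.rpow_add_one hx.ne' e
  have p2 : ∀ x : ℝ, 0 < x → x ^ (e + 2) = x ^ e * x ^ 2 := fun x hx => by
    rw [show e + 2 = e + (2 : ℕ) by norm_num, Real.rpow_add_natCast hx.ne']
  have b0 : ∀ x, 0 < x → ‖h x‖ ≤ A * (x ^ e * x ^ 2) := by
    intro x hx
    rw [hh0, norm_mul, ← p2 x hx]
    exact (mul_le_of_le_one_left (norm_nonneg _) (hχ.norm_le x)).trans (hDle x hx).1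
  have b1 : ∀ x, 0 < x → ‖h₁ x‖ ≤ M₁ * (A * (x ^ e * x ^ 2)) + A * (x ^ e * x) := by
    intro x hx
    refine (norm_add_le _ _).trans (add_le_add ?_ ?_)
    · rw [norm_mul, ← p2 x hx]
      exact mul_le_mul (hM₁ x) (hDle x hx).1 (norm_nonneg _) hM₁0
    · rw [norm_mul, ← p1 x hx]
      exact (mul_le_of_le_one_left (norm_nonneg _) (hχ.norm_le x)).trans (hDle x hx).2
  have b2 : ∀ x, 0 < x → ‖-h₂ x + potential α x * h x‖ ≤
      M₂ * (A * (x ^ e * x ^ 2)) + 2 * M₁ * (A * (x ^ e * x)) + ‖z‖ * (C * x ^ e) := by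
    intro x hx
    have : -h₂ x + potential α x * h x =
        -(deriv (deriv χ) x * D x) - 2 * deriv χ x * D₁ x + χ x * (z * K x) := by
      simp only [hh0, hh2]
      ring
    rw [this]
    refine (norm_add_le _ _).trans (add_le_add ((norm_sub_le _ _).trans (add_le_add ?_ ?_)) ?_)
    · rw [norm_neg, norm_mul, ← p2 x hx]
      exact mul_le_mul (hM₂ x) (hDle x hx).1 (norm_nonneg _) hM₂0
    · rw [norm_mul, norm_mul, Complex.norm_ofNat, ← p1 x hx]
      exact mul_le_mul (mul_le_mul_of_nonneg_left (hM₁ x) zero_le_two) (hDle x hx).2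
        (norm_nonneg _) (by positivity)
    · rw [norm_mul, norm_mul]
      refine (mul_le_of_le_one_left (by positivity) (hχ.norm_le x)).trans ?_
      exact mul_le_mul_of_nonneg_left (hK x hx) (norm_nonneg _)
  -- The truncated `h`, together with `h₁/x`, `h/x²` and `L h`, is bounded by a multiple of `x^e` on
  -- `]0,2]`, and `e > -1/2` is square integrable there.
  have m0 : MemLp h 2 halfLine := by
    refine memLp_of_norm_le_rpow two_pos he hh.continuousOn_zero (fun x hx => (hz x hx).1)
      (C := A * 4) fun x hx hx2 => (b0 x hx).trans ?_
    have : x ^ 2 ≤ 4 := by nlinarith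
    calc A * (x ^ e * x ^ 2) ≤ A * (x ^ e * 4) := by gcongr
      _ = _ := by ring
  have m1 : MemLp (fun x => h₁ x / x) 2 halfLine := by
    refine memLp_of_norm_le_rpow two_pos he (hh.continuousOn_one.div
      Complex.continuous_ofReal.continuousOn fun x hx => hne hx)
      (fun x hx => by rw [(hz x hx).2.1, zero_div]) (C := M₁ * A * 2 + A) fun x hx hx2 => ?_
    rw [norm_div, Complex.norm_real, Real.norm_of_nonneg hx.le, div_le_iff₀ hx]
    refine (b1 x hx).trans ?_
    calc M₁ * (A * (x ^ e * x ^ 2)) + A * (x ^ e * x)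
        = M₁ * A * (x ^ e * x * x) + A * (x ^ e * x) := by ring
      _ ≤ M₁ * A * (x ^ e * x * 2) + A * (x ^ e * x) := by gcongr
      _ = _ := by ring
  have m2 : MemLp (fun x => h x / (x : ℂ) ^ 2) 2 halfLine := by
    refine memLp_of_norm_le_rpow two_pos he (hh.continuousOn_zero.div
      (Complex.continuous_ofReal.pow 2).continuousOn fun x hx => pow_ne_zero 2 (hne hx))
      (fun x hx => by rw [(hz x hx).1, zero_div]) (C := A) fun x hx hx2 => ?_
    rw [norm_div, norm_pow, Complex.norm_real, Real.norm_of_nonneg hx.le,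
      div_le_iff₀ (by positivity)]
    refine (b0 x hx).trans_eq ?_
    ring
  have m3 : MemLp (fun x => -h₂ x + potential α x * h x) 2 halfLine := by
    refine memLp_of_norm_le_rpow two_pos he (hh.continuousOn.neg.add
      ((continuousOn_potential α).mul hh.continuousOn_zero))
      (fun x hx => by rw [(hz x hx).1, (hz x hx).2.2]; ring)
      (C := M₂ * A * 4 + 2 * M₁ * A * 2 + ‖z‖ * C) fun x hx hx2 => (b2 x hx).trans ?_
    have : x ^ 2 ≤ 4 := by nlinarith
    calc M₂ * (A * (x ^ e * x ^ 2)) + 2 * M₁ * (A * (x ^ e * x)) + ‖z‖ * (C * x ^ e)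
        ≤ M₂ * (A * (x ^ e * 4)) + 2 * M₁ * (A * (x ^ e * 2)) + ‖z‖ * (C * x ^ e) := by gcongr
      _ = _ := by ring
  have hmem := mem_minOp_graph_of_memLp hh (hχ.smooth.contDiffOn.mul hs) (b := 2)
    (fun x hx => by simp [hh0, hχ.eq_zero x hx]) m0 m3 m1 m2
  refine ⟨m0.toLp h, LinearPMap.mem_domain_of_mem_graph hmem, ?_⟩
  filter_upwards [m0.coeFn_toLp] with x hx hx1
  rw [hx, hh0]
  simp [hχ.eq_one x hx1.le]

/-- A vanishing solution would have zero Wronskian with `x^{1/2-m}`, whereas the limit `2 Γ(1-m)` is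
nonzero. -/
theorem exists_decaying_ne_zero {m : ℂ} (hm : m.re < 1) {β : ℝ} (hβ : 0 < β) :
    ∃ x, 0 < x ∧ decaying m β x ≠ 0 := by
  by_contra! h
  have hlim := tendsto_wronskian_decaying_minus hm hβ
  have h0 : Tendsto (wronskian (decaying m β) (decayingDeriv m β)
      (fun x : ℝ => (x : ℂ) ^ (1 / 2 - m))
      (fun x => (1 / 2 - m) * (x : ℂ) ^ (1 / 2 - m) / x)) (𝓝[>] 0) (𝓝 0) := by
    refine tendsto_const_nhds.congr' ?_
    filter_upwards [self_mem_nhdsWithin] with x hx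
    have hx : 0 < x := hx
    have e : decaying m β =ᶠ[𝓝 x] fun _ => 0 := by
      filter_upwards [Ioi_mem_nhds hx] with y hy using h y hy
    have e1 : decayingDeriv m β x = 0 := by
      rw [← ((isC2_decaying m hβ).hasDerivAt x hx).deriv, e.deriv_eq, deriv_const]
    simp [wronskian, h x hx, e1]
  have := tendsto_nhds_unique hlim h0
  have hG : Complex.Gamma (1 - m) ≠ 0 := Complex.Gamma_ne_zero_of_re_pos (by simp; linarith)
  exact hG (by simpa using this)

theorem eqOn_zero_of_ae_eq_zero {F : ℝ → ℂ} (hF : ContinuousOn F (Ioi 0))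
    (h : F =ᵐ[halfLine] 0) {x : ℝ} (hx : 0 < x) : F x = 0 :=
  Measure.eqOn_of_ae_eq h hF continuousOn_const
    (by rw [isOpen_Ioi.interior_eq]; exact subset_closure) hx

/-- Existence of eigenvalues. -/
theorem mem_eigenvalues_of_eq_zero {m κ : ℂ} (hm0 : m ≠ 0) (hm : |m.re| < 1) {β : ℝ} (hβ : 0 < β)
    (h : κ * (β : ℂ) ^ (-m) * Complex.Gamma (m + 1) + Complex.Gamma (1 - m) = 0) :
    (-4 * β : ℂ) ∈ eigenvalues (almostHomOp m (OnePoint.some κ)) := by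
  obtain ⟨h1, h2⟩ := abs_lt.1 hm
  have hK := isC2_decaying m hβ
  have hK2 := memLp_decaying hm hβ
  set K := decaying m β with hKdef
  -- This `c` cancels the limiting Wronskian with `x^{1/2+m}`; the eigenvalue equation is exactly
  -- what makes the same `c` cancel the one with `x^{1/2-m}`.
  set c : ℂ := (β : ℂ) ^ (-m) * Complex.Gamma (m + 1) / m with hc
  have hb := isC2_boundaryFun m κ
  have hD := (hK.sub (hb.const_mul c)).congr_second
    (G₂ := fun x => potential (m ^ 2) x * (K x - c * boundaryFun m (OnePoint.some κ) x) -
      (-4 * β : ℂ) * K x) fun x => by ring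
  have hWp : Tendsto (wronskian (fun x => K x - c * boundaryFun m (OnePoint.some κ) x)
      (fun x => decayingDeriv m β x - c * boundaryDeriv m κ x) (powFun (1 / 2 + m))
      (powDeriv (1 / 2 + m))) (𝓝[>] 0) (𝓝 0) := by
    have hlim := (tendsto_wronskian_decaying_plus h1 hβ).sub_const (c * (2 * m))
    rw [show 2 * (β : ℂ) ^ (-m) * Complex.Gamma (m + 1) - c * (2 * m) = 0 by
      rw [hc]; field_simp; ring] at hlim
    refine hlim.congr' ?_
    filter_upwards [self_mem_nhdsWithin] with x hx
    rw [wronskian_sub_const_mul, wronskian_boundaryFun_plus m κ hx]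
  have hWn : Tendsto (wronskian (fun x => K x - c * boundaryFun m (OnePoint.some κ) x)
      (fun x => decayingDeriv m β x - c * boundaryDeriv m κ x) (powFun (1 / 2 - m))
      (powDeriv (1 / 2 - m))) (𝓝[>] 0) (𝓝 0) := by
    have hlim := (tendsto_wronskian_decaying_minus h2 hβ).sub_const (c * (-2 * m * κ))
    rw [show 2 * Complex.Gamma (1 - m) - c * (-2 * m * κ) = 0 by
      rw [hc]; field_simp; linear_combination 2 * h] at hlim
    refine hlim.congr' ?_
    filter_upwards [self_mem_nhdsWithin] with x hx
    rw [wronskian_sub_const_mul, wronskian_boundaryFun_minus m κ hx]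
  -- The growth exponent `e = 1/2 + Re m - 2p` of `K` must exceed `-1/2`, which is `p < (1 + Re
  -- m)/2`; then also `e + 3/2 > 1 > |Re m|`.
  obtain ⟨p, hp1, hp2⟩ := exists_between
    (show max 0 m.re < (1 + m.re) / 2 from max_lt (by linarith) (by linarith))
  obtain ⟨C, hC0, hC⟩ := exists_norm_decaying_le m hβ ((le_max_left _ _).trans hp1.le)
    ((le_max_right _ _).trans_lt hp1)
  obtain ⟨A, hA0, hA⟩ := exists_norm_le_of_tendsto_wronskian hm0 hD hC0 hC
    (by linarith) hWp hWn
  have hsm : ContDiffOn ℝ ((⊤ : ℕ∞) : WithTop ℕ∞)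
      (fun x => K x - c * boundaryFun m (OnePoint.some κ) x) (Ioi 0) := by
    refine (hK.contDiffOn (contDiffOn_potential_sub _ _)).sub (contDiffOn_const.mul ?_)
    exact hb.contDiffOn (by simpa using contDiffOn_potential_sub (m ^ 2) 0)
  obtain ⟨hmin, hdom, hae⟩ := exists_mem_minOp_domain hD hsm hA0
    (by linarith) hC hA
  refine mem_eigenvalues_iff.2 ⟨hK2.toLp K, ?_, ?_, ?_⟩
  · intro h0
    obtain ⟨x, hx, hne⟩ := exists_decaying_ne_zero h2 hβ
    refine hne (eqOn_zero_of_ae_eq_zero hK.continuousOn_zero ?_ hx)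
    have := hK2.coeFn_toLp
    rw [h0] at this
    exact this.symm.trans (Lp.coeFn_zero ℂ 2 halfLine)
  · rw [mem_maxGraph_iff]
    intro φ hφ
    have e := hK.integral_mul_diffExpr (m ^ 2) hφ
    have e1 : ∫ x, (hK2.toLp K) x * diffExpr (m ^ 2) φ x ∂halfLine =
        ∫ x, K x * diffExpr (m ^ 2) φ x ∂halfLine :=
      integral_congr_ae (by filter_upwards [hK2.coeFn_toLp] with x hx; rw [hx])
    rw [e1, e]
    refine integral_congr_ae ?_
    filter_upwards [hK2.coeFn_toLp, Lp.coeFn_smul (-4 * β : ℂ) (hK2.toLp K)] with x hx hx'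
    rw [hx', Pi.smul_apply, hx, smul_eq_mul]
    ring
  · refine ⟨c, hmin, hdom, 1, one_pos, ?_⟩
    filter_upwards [hae, hK2.coeFn_toLp] with x hx hx' hx1
    rw [hx', hx hx1]

end AlmostHomogeneous
end

/-! ### Self-adjoint boundary conditions, and necessity of the eigenvalue equation -/

noncomputable section

namespace AlmostHomogeneous

open scoped ComplexConjugate

/-- `u` solves `L_α u = 0` on `]0,∞[` and is square integrable near `0`. -/
structure IsHom (α : ℂ) (u u₁ : ℝ → ℂ) : Prop where
  isC2 : IsC2 u u₁ (fun x => potential α x * u x)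
  memLp : ∀ ε : ℝ, 0 < ε → MemLp u 2 (volume.restrict (Ioo 0 ε))

theorem IsHom.conj {α : ℂ} (hα : α.im = 0) {u u₁ : ℝ → ℂ} (hu : IsHom α u u₁) :
    IsHom α (fun x => conj (u x)) (fun x => conj (u₁ x)) :=
  ⟨hu.isC2.conj.congr_second fun x => by rw [map_mul, conj_potential hα],
    fun ε hε => (hu.memLp ε hε).star⟩

/-- Both exponents `1/2 ± m` satisfy this bound exactly when `|Re m| < 1`. -/
theorem memLp_powFun {w : ℂ} (hw : -(1 / 2) < w.re) (ε : ℝ) (hε : 0 < ε) :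
    MemLp (powFun w) 2 (volume.restrict (Ioo 0 ε)) := by
  rw [memLp_two_iff_integrable_sq_norm (((continuousOn_ofReal_cpow w).mono
    Ioo_subset_Ioi_self).aestronglyMeasurable measurableSet_Ioo)]
  have hi := intervalIntegral.intervalIntegrable_rpow' (a := 0) (b := ε)
    (show -1 < 2 * w.re by linarith)
  rw [intervalIntegrable_iff_integrableOn_Ioo_of_le hε.le] at hi
  refine IntegrableOn.congr_fun hi (fun x hx => ?_) measurableSet_Ioo
  rw [norm_powFun hx.1, ← Real.rpow_natCast (x ^ w.re), ← Real.rpow_mul hx.1.le]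
  norm_num [mul_comm]

theorem isHom_powFun_plus {m : ℂ} (hm : |m.re| < 1) :
    IsHom (m ^ 2) (powFun (1 / 2 + m)) (powDeriv (1 / 2 + m)) :=
  ⟨isC2_powFun_plus m, memLp_powFun (by simp; linarith [(abs_lt.1 hm).1])⟩

theorem isHom_powFun_minus {m : ℂ} (hm : |m.re| < 1) :
    IsHom (m ^ 2) (powFun (1 / 2 - m)) (powDeriv (1 / 2 - m)) :=
  ⟨isC2_powFun_minus m, memLp_powFun (by simp; linarith [(abs_lt.1 hm).2])⟩

theorem isHom_boundaryFun {m : ℂ} (hm : |m.re| < 1) (κ : ℂ) :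
    IsHom (m ^ 2) (boundaryFun m (OnePoint.some κ)) (boundaryDeriv m κ) :=
  ⟨isC2_boundaryFun m κ, fun ε hε => ((isHom_powFun_minus hm).memLp ε hε).add
    (((isHom_powFun_plus hm).memLp ε hε).const_mul κ)⟩

/-- At `m = 0` the powers `x^{1/2±m}` coincide; `√x log x` is then the second solution, bounded near
`0` because it equals `2 √x log √x`. -/
theorem isHom_log_mul : IsHom 0 (fun x => (Real.log x : ℂ) * powFun (1 / 2) x)
    (fun x => powFun (1 / 2) x / x + Real.log x * powDeriv (1 / 2) x) := by
  have h : ∀ x : ℝ, 0 < x → HasDerivAt (fun y : ℝ => (Real.log y : ℂ)) ((x : ℂ)⁻¹) x :=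
    fun x hx => by simpa using (Real.hasDerivAt_log hx.ne').ofReal_comp
  have hne : ∀ x : ℝ, 0 < x → (x : ℂ) ≠ 0 := fun x hx => by exact_mod_cast hx.ne'
  refine ⟨⟨fun x hx => ?_, fun x hx => ?_, ?_⟩, fun ε hε => ?_⟩
  · refine ((h x hx).mul (hasDerivAt_ofReal_cpow hx (1 / 2))).congr_deriv ?_
    simp only [powFun, powDeriv]
    ring
  · have hp := hasDerivAt_ofReal_cpow hx (1 / 2)
    have hid : HasDerivAt (fun y : ℝ => (y : ℂ)) 1 x := (hasDerivAt_id x).ofReal_comp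
    have := hne x hx
    refine ((hp.div hid this).add ((h x hx).mul
      ((hp.const_mul (1 / 2)).div hid this))).congr_deriv ?_
    simp only [powFun, potential, Pi.div_apply]
    field_simp
    ring
  · refine (continuousOn_potential 0).mul (ContinuousOn.mul (fun x hx => ?_)
      (continuousOn_ofReal_cpow _))
    exact (h x hx).continuousAt.continuousWithinAt
  · have hc : Continuous fun x : ℝ => 2 * (√x * Real.log √x) :=
      continuous_const.mul (Real.continuous_mul_log.comp Real.continuous_sqrt)
    obtain ⟨C, hC⟩ := (isCompact_Icc (a := 0) (b := ε)).exists_bound_of_continuousOn hc.continuousOn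
    have hcont : ContinuousOn (fun x : ℝ => (Real.log x : ℂ) * powFun (1 / 2) x) (Ioi 0) :=
      ContinuousOn.mul (fun x hx => (h x hx).continuousAt.continuousWithinAt)
        (continuousOn_ofReal_cpow _)
    refine MemLp.of_bound ((hcont.mono Ioo_subset_Ioi_self).aestronglyMeasurable
      measurableSet_Ioo) C ((ae_restrict_iff' measurableSet_Ioo).2 (.of_forall fun x hx => ?_))
    refine le_trans (le_of_eq ?_) (hC x ⟨hx.1.le, hx.2.le⟩)
    rw [norm_mul, norm_powFun hx.1, Complex.norm_real, Real.log_sqrt hx.1.le, Real.sqrt_eq_rpow,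
      ← Real.norm_of_nonneg (show 0 ≤ x ^ (1 / 2 : ℂ).re from Real.rpow_nonneg hx.1.le _),
      ← norm_mul]
    congr 1
    norm_num
    ring

/-- There are two independent solutions of `L_{m²} u = 0` that are square integrable near `0`. -/
theorem exists_isHom_basis {m : ℂ} (hm : |m.re| < 1) : ∃ (U U₁ V V₁ : ℝ → ℂ) (w : ℂ), w ≠ 0 ∧
    IsHom (m ^ 2) U U₁ ∧ IsHom (m ^ 2) V V₁ ∧ ∀ x, 0 < x → wronskian U U₁ V V₁ x = w := by
  rcases eq_or_ne m 0 with rfl | hm0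
  · refine ⟨powFun (1 / 2), powDeriv (1 / 2), fun x => (Real.log x : ℂ) * powFun (1 / 2) x,
      fun x => powFun (1 / 2) x / x + Real.log x * powDeriv (1 / 2) x, 1, one_ne_zero, ?_, ?_,
      fun x hx => ?_⟩
    · simpa using isHom_powFun_plus hm
    · simpa using isHom_log_mul
    · have hx' : (x : ℂ) ≠ 0 := by exact_mod_cast hx.ne'
      have hprod : (x : ℂ) ^ (1 / 2 : ℂ) * (x : ℂ) ^ (1 / 2 : ℂ) = x := by
        rw [← Complex.cpow_add _ _ hx', show (1 / 2 : ℂ) + 1 / 2 = 1 by ring, Complex.cpow_one]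
      have : wronskian (powFun (1 / 2)) (powDeriv (1 / 2))
          (fun x => (Real.log x : ℂ) * powFun (1 / 2) x)
          (fun x => powFun (1 / 2) x / x + Real.log x * powDeriv (1 / 2) x) x =
          ((x : ℂ) ^ (1 / 2 : ℂ) * (x : ℂ) ^ (1 / 2 : ℂ)) / x := by
        simp only [wronskian]
        ring
      rw [this, hprod, div_self hx']
  · exact ⟨_, _, _, _, 2 * m, mul_ne_zero two_ne_zero hm0, isHom_powFun_minus hm,
      isHom_powFun_plus hm, fun x hx => wronskian_powFun m hx⟩

theorem IsC2.deriv_eq_zero {F F₁ F₂ : ℝ → ℂ} (hF : IsC2 F F₁ F₂) (h : ∀ x, 0 < x → F x = 0)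
    {x : ℝ} (hx : 0 < x) : F₁ x = 0 := by
  have e : F =ᶠ[𝓝 x] fun _ => 0 := by
    filter_upwards [Ioi_mem_nhds hx] with y hy using h y hy
  rw [← (hF.hasDerivAt x hx).deriv, e.deriv_eq, deriv_const]

/-- Linear dependence of two solutions with vanishing Wronskian. -/
theorem IsC2.exists_eq_mul {F F₁ K K₁ p : ℝ → ℂ} (hF : IsC2 F F₁ (fun x => p x * F x))
    (hK : IsC2 K K₁ (fun x => p x * K x)) (hp : ContinuousOn p (Ioi 0))
    (hW : wronskian F F₁ K K₁ 1 = 0) (hK0 : ∃ x, 0 < x ∧ K x ≠ 0) :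
    ∃ a, ∀ x, 0 < x → F x = a * K x ∧ F₁ x = a * K₁ x := by
  have hex : ∃ a, F 1 = a * K 1 ∧ F₁ 1 = a * K₁ 1 := by
    simp only [wronskian] at hW
    by_cases h1 : K 1 = 0
    · by_cases h2 : K₁ 1 = 0
      · obtain ⟨x, hx, hne⟩ := hK0
        exact absurd (hK.eq_zero_of_initial hp one_pos h1 h2 hx) hne
      · refine ⟨F₁ 1 / K₁ 1, ?_, (div_mul_cancel₀ _ h2).symm⟩
        rw [h1, mul_zero, sub_zero] at hW
        rw [h1, mul_zero]
        exact (mul_eq_zero.1 hW).resolve_right h2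
    · refine ⟨F 1 / K 1, (div_mul_cancel₀ _ h1).symm, ?_⟩
      field_simp
      linear_combination -hW
  obtain ⟨a, h1, h2⟩ := hex
  have hD := (hF.sub (hK.const_mul a)).congr_second
    (G₂ := fun x => p x * (F x - a * K x)) fun x => by ring
  have h0 : ∀ x, 0 < x → F x - a * K x = 0 := fun x hx =>
    hD.eq_zero_of_initial hp one_pos (sub_eq_zero.2 h1) (sub_eq_zero.2 h2) hx
  exact ⟨a, fun x hx => ⟨sub_eq_zero.1 (h0 x hx), sub_eq_zero.1 (hD.deriv_eq_zero h0 hx)⟩⟩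

theorem tendsto_conj_zero {ι : Type*} {l : Filter ι} {g : ι → ℂ} (h : Tendsto g l (𝓝 0)) :
    Tendsto (fun x => conj (g x)) l (𝓝 0) := by
  simpa [Function.comp_def] using (Complex.continuous_conj.tendsto 0).comp h

/-- The boundary form vanishes on the functions satisfying a self-adjoint boundary condition. -/
theorem tendsto_wronskian_conj {α : ℂ} (hα : α.im = 0) {F F₁ b b₁ : ℝ → ℂ} {c : ℂ}
    {U U₁ V V₁ : ℝ → ℂ} {w : ℂ} (hw0 : w ≠ 0) (hU : IsHom α U U₁) (hV : IsHom α V V₁)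
    (hw : ∀ x, 0 < x → wronskian U U₁ V V₁ x = w) (hb : IsHom α b b₁)
    (hbb : ∀ x, 0 < x → wronskian b b₁ (fun x => conj (b x)) (fun x => conj (b₁ x)) x = 0)
    (hlim : ∀ u u₁, IsHom α u u₁ → Tendsto (wronskian (fun x => F x - c * b x)
      (fun x => F₁ x - c * b₁ x) u u₁) (𝓝[>] 0) (𝓝 0)) :
    Tendsto (wronskian F F₁ (fun x => conj (F x)) (fun x => conj (F₁ x))) (𝓝[>] 0) (𝓝 0) := by
  set D : ℝ → ℂ := fun x => F x - c * b x with hD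
  set D₁ : ℝ → ℂ := fun x => F₁ x - c * b₁ x with hD₁
  -- `W(u, D̄)` is minus the conjugate of `W(D, ū)`, and `ū` is again homogeneous since `α` is real.
  have hr : ∀ u u₁, IsHom α u u₁ → Tendsto (wronskian u u₁ (fun x => conj (D x))
      (fun x => conj (D₁ x))) (𝓝[>] 0) (𝓝 0) := by
    intro u u₁ hu
    have := (tendsto_conj_zero (hlim _ _ (hu.conj hα))).neg
    rw [neg_zero] at this
    refine this.congr fun x => ?_
    simp only [wronskian, map_sub, map_mul, Complex.conj_conj]
    ring
  -- Plücker's identity: `W(U, V) W(D, D̄) = W(U, D̄) W(D, V) - W(V, D̄) W(D, U)`, where every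
  -- factor on the right tends to `0`.
  have hDD : Tendsto (wronskian D D₁ (fun x => conj (D x)) (fun x => conj (D₁ x)))
      (𝓝[>] 0) (𝓝 0) := by
    have := (((hr U U₁ hU).mul (hlim V V₁ hV)).sub ((hr V V₁ hV).mul (hlim U U₁ hU))).const_mul w⁻¹
    rw [mul_zero, sub_zero, mul_zero] at this
    refine this.congr' ?_
    filter_upwards [self_mem_nhdsWithin] with x hx
    rw [inv_mul_eq_iff_eq_mul₀ hw0, ← hw x hx]
    simp only [wronskian]
    ring
  -- Expand `W(F, F̄)` with `F = D + c b`; the remaining term `|c|² W(b, b̄)` is zero by `hbb`.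
  have := (hDD.add ((hlim _ _ (hb.conj hα)).const_mul (conj c))).add ((hr b b₁ hb).const_mul c)
  rw [mul_zero, add_zero, mul_zero, add_zero] at this
  refine this.congr' ?_
  filter_upwards [self_mem_nhdsWithin] with x hx
  have h0 := hbb x hx
  simp only [wronskian] at h0
  simp only [wronskian, hD, hD₁, map_sub, map_mul]
  linear_combination (-c * conj c) * h0

/-- The eigenvalues under a self-adjoint boundary condition are negative, and the decaying solution
satisfies the boundary condition. -/
theorem exists_of_mem_eigenvalues {m : ℂ} (hα : (m ^ 2).im = 0) (hm : |m.re| < 1) {κ : OnePoint ℂ}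
    {b₁ : ℝ → ℂ} (hb : IsHom (m ^ 2) (boundaryFun m κ) b₁)
    (hbb : ∀ x, 0 < x → wronskian (boundaryFun m κ) b₁ (fun x => conj (boundaryFun m κ x))
      (fun x => conj (b₁ x)) x = 0)
    (hinf : ∀ c : ℂ, MemLp (fun x => c * boundaryFun m κ x) 2 (volume.restrict (Ioi 1)) → c = 0)
    {z : ℂ} (hz : z ∈ eigenvalues (almostHomOp m κ)) :
    ∃ β : ℝ, 0 < β ∧ z = -4 * β ∧ ∃ c : ℂ, ∀ u u₁, IsHom (m ^ 2) u u₁ →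
      Tendsto (fun x => wronskian (decaying m β) (decayingDeriv m β) u u₁ x -
        c * wronskian (boundaryFun m κ) b₁ u u₁ x) (𝓝[>] 0) (𝓝 0) := by
  obtain ⟨f, hf0, hfg, c, h, hh, ε, hε, hfh⟩ := mem_eigenvalues_iff.1 hz
  obtain ⟨F, F₁, hF, hfF⟩ := exists_isC2_of_mem_maxGraph hfg
  obtain ⟨U, U₁, V, V₁, w, hw0, hU, hV, hw⟩ := exists_isHom_basis hm
  have hF2 : MemLp F 2 (volume.restrict (Ioi 1)) :=
    ((memLp_congr_ae hfF).1 (Lp.memLp f)).mono_measure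
      (Measure.restrict_mono (Ioi_subset_Ioi zero_le_one) le_rfl)
  have hFne : ¬∀ x, 0 < x → F x = 0 := by
    intro h0
    refine hf0 (Lp.ext (hfF.trans ?_))
    refine EventuallyEq.trans ?_ (Lp.coeFn_zero ℂ 2 halfLine).symm
    exact (ae_restrict_iff' measurableSet_Ioi).2 (.of_forall fun x hx => h0 x hx)
  set b := boundaryFun m κ with hbdef
  have hD := hF.sub (hb.isC2.const_mul c)
  obtain ⟨g, hg⟩ := LinearPMap.mem_domain_iff.1 hh
  have hlim : ∀ u u₁, IsHom (m ^ 2) u u₁ → Tendsto (wronskian (fun x => F x - c * b x)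
      (fun x => F₁ x - c * b₁ x) u u₁) (𝓝[>] 0) (𝓝 0) := by
    intro u u₁ hu
    refine tendsto_wronskian_of_mem_minOp_graph hg hD hε ?_ hu.isC2 (hu.memLp ε hε)
    filter_upwards [hfh, hfF] with x h1 h2 hx
    rw [← h2, h1 hx]
  by_cases hzi : z.im = 0
  swap
  · exact absurd (fun x hx => hF.eq_zero_of_im_ne_zero hα hzi hF2
      (tendsto_wronskian_conj hα hw0 hU hV hw hb hbb hlim) hx) hFne
  have hzr : z = (z.re : ℂ) := Complex.ext rfl (by simpa using hzi)
  rcases lt_trichotomy z.re 0 with hneg | h0 | hpos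
  · have hβ : 0 < -z.re / 4 := by linarith
    have hzβ : z = -4 * ((-z.re / 4 : ℝ) : ℂ) := by
      rw [hzr]
      push_cast
      simp only [Complex.ofReal_re]
      ring
    refine ⟨-z.re / 4, hβ, hzβ, ?_⟩
    set β := -z.re / 4 with hβdef
    have hK := isC2_decaying m hβ
    rw [← hzβ] at hK
    have hK2 := (memLp_decaying hm hβ).mono_measure
      (Measure.restrict_mono (Ioi_subset_Ioi zero_le_one) le_rfl :
        volume.restrict (Ioi 1) ≤ volume.restrict (Ioi (0 : ℝ)))
    -- Two solutions square integrable at infinity are proportional, so the eigenvector is a nonzero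
    -- multiple of `decaying`, which inherits the boundary condition with constant `c / a`.
    have hW := hF.wronskian_eq_zero hK (fun t ht => norm_potential_sub_le _ z ht) hF2 hK2 one_pos
    obtain ⟨a, ha⟩ := hF.exists_eq_mul hK (continuousOn_potential_sub _ z) hW
      (exists_decaying_ne_zero (abs_lt.1 hm).2 hβ)
    have ha0 : a ≠ 0 := by
      rintro rfl
      exact hFne fun x hx => by rw [(ha x hx).1, zero_mul]
    refine ⟨c / a, fun u u₁ hu => ?_⟩
    have := (hlim u u₁ hu).const_mul a⁻¹
    rw [mul_zero] at this
    refine this.congr' ?_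
    filter_upwards [self_mem_nhdsWithin] with x hx
    rw [inv_mul_eq_iff_eq_mul₀ ha0]
    simp only [wronskian, ha x hx]
    field_simp
    ring
  · have hz0 : z = 0 := Complex.ext h0 hzi
    subst hz0
    -- At energy `0`, `F - c b` solves the homogeneous equation. Its Wronskians with `U` and `V` are
    -- constant and tend to `0`, so they vanish and `F = c b`.
    have hD' := hD.congr_second
      (G₂ := fun x => potential (m ^ 2) x * (F x - c * b x)) fun x => by ring
    have hW : ∀ u u₁, IsHom (m ^ 2) u u₁ → ∀ x, 0 < x → wronskian (fun x => F x - c * b x)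
        (fun x => F₁ x - c * b₁ x) u u₁ x = 0 := by
      intro u u₁ hu x hx
      refine tendsto_nhds_unique (tendsto_const_nhds.congr' ?_) (hlim u u₁ hu)
      filter_upwards [self_mem_nhdsWithin] with y hy
      exact hD'.wronskian_eq hu.isC2 hx hy
    have hFb : ∀ x, 0 < x → F x = c * b x := by
      intro x hx
      have h1 := hW U U₁ hU x hx
      have h2 := hW V V₁ hV x hx
      have h3 := hw x hx
      simp only [wronskian] at h1 h2 h3
      have : w * (F x - c * b x) = 0 := by
        rw [← h3]
        linear_combination U x * h2 - V x * h1
      exact sub_eq_zero.1 ((mul_eq_zero.1 this).resolve_left hw0)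
    have hc : c = 0 := by
      refine hinf c ((memLp_congr_ae ?_).1 hF2)
      refine (ae_restrict_iff' measurableSet_Ioi).2 (.of_forall fun x hx => ?_)
      exact hFb x (one_pos.trans hx)
    exact absurd (fun x hx => by rw [hFb x hx, hc, zero_mul]) hFne
  · rw [hzr] at hF
    exact absurd (fun x hx => hF.eq_zero_of_pos hα hpos hF2 hx) hFne

/-- Multiples of `x ^ w` with `Re w ≥ -1/2` are not square integrable at infinity. -/
theorem eq_zero_of_memLp_powFun {w c : ℂ} (hw : -(1 / 2) ≤ w.re)
    (h : MemLp (fun x => c * powFun w x) 2 (volume.restrict (Ioi 1))) : c = 0 := by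
  by_contra hc
  have h1 := h.const_mul c⁻¹
  simp only [inv_mul_cancel_left₀ hc] at h1
  rw [memLp_two_iff_integrable_sq_norm h1.1] at h1
  have h2 : IntegrableOn (fun x : ℝ => x ^ (2 * w.re)) (Ioi 1) := by
    refine IntegrableOn.congr_fun h1 (fun x hx => ?_) measurableSet_Ioi
    have hx0 : 0 < x := one_pos.trans hx
    rw [norm_powFun hx0, ← Real.rpow_natCast (x ^ w.re), ← Real.rpow_mul hx0.le]
    norm_num [mul_comm]
  have := (integrableOn_Ioi_rpow_iff one_pos).1 h2
  linarith

/-- A solution of `L_{m²} F = 0` that is square integrable at infinity is a pure power. -/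
theorem mul_eq_zero_of_memLp {m a₁ a₂ : ℂ} (hm0 : m ≠ 0)
    (h : MemLp (fun x => a₁ * powFun (1 / 2 - m) x + a₂ * powFun (1 / 2 + m) x) 2
      (volume.restrict (Ioi 1))) : a₁ * a₂ = 0 := by
  have hF := (((isC2_powFun_minus m).const_mul a₁).add
    ((isC2_powFun_plus m).const_mul a₂)).congr_second
    (G₂ := fun x => (potential (m ^ 2) x - 0) *
      (a₁ * powFun (1 / 2 - m) x + a₂ * powFun (1 / 2 + m) x)) fun x => by ring
  have h' := hF.memLp_deriv (fun t ht => norm_potential_sub_le _ 0 ht) h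
  set F : ℝ → ℂ := fun x => a₁ * powFun (1 / 2 - m) x + a₂ * powFun (1 / 2 + m) x with hFdef
  set F₁ : ℝ → ℂ := fun x => a₁ * powDeriv (1 / 2 - m) x + a₂ * powDeriv (1 / 2 + m) x with hF₁
  by_contra hne
  have hb : ∀ᵐ x : ℝ ∂volume.restrict (Ioi 1), ‖(x : ℂ)⁻¹‖ ≤ 1 := by
    refine (ae_restrict_iff' measurableSet_Ioi).2 (.of_forall fun x hx => ?_)
    have hx : 1 < x := hx
    rw [norm_inv, Complex.norm_real, Real.norm_of_nonneg (by linarith)]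
    exact inv_le_one_of_one_le₀ hx.le
  have hmeas : AEStronglyMeasurable (fun x : ℝ => (x : ℂ)⁻¹) (volume.restrict (Ioi 1)) :=
    (Complex.measurable_ofReal.inv).aestronglyMeasurable
  -- Each factor `xF' - (1/2 ± m)F` isolates one power. Minus their product over `x²` is a quadratic
  -- form in `F/x` and `F'`, integrable on `]1,∞[`, and it equals `4 m² a₁ a₂ / x`. As `1/x` is not
  -- integrable there, `a₁ a₂ = 0`. This also covers imaginary `m`, where both powers have the same
  -- modulus.
  have i1 := (h.integrable_mul h).bdd_mul hmeas hb
  have i2 := ((i1.bdd_mul hmeas hb).const_mul (-(1 / 4) + m ^ 2))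
  have i3 := (h.integrable_mul h').bdd_mul hmeas hb
  have i4 := h'.integrable_mul h'
  have i5 := ((i2.add i3).sub i4).const_mul (4 * m ^ 2 * (a₁ * a₂))⁻¹
  have hk : 4 * m ^ 2 * (a₁ * a₂) ≠ 0 :=
    mul_ne_zero (mul_ne_zero (by norm_num) (pow_ne_zero 2 hm0)) hne
  have : IntegrableOn (fun x : ℝ => x ^ (-1 : ℝ)) (Ioi 1) := by
    refine IntegrableOn.congr_fun i5.norm (fun x hx => ?_) measurableSet_Ioi
    have hx0 : 0 < x := one_pos.trans hx
    have hx' : (x : ℂ) ≠ 0 := by exact_mod_cast hx0.ne'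
    have hprod : (x : ℂ) ^ (1 / 2 - m) * (x : ℂ) ^ (1 / 2 + m) = x := by
      rw [← Complex.cpow_add _ _ hx', show (1 / 2 - m) + (1 / 2 + m) = 1 by ring,
        Complex.cpow_one]
    have e : (-(1 / 4) + m ^ 2) * ((x : ℂ)⁻¹ * ((x : ℂ)⁻¹ * (F x * F x))) +
        (x : ℂ)⁻¹ * (F x * F₁ x) - F₁ x * F₁ x = 4 * m ^ 2 * (a₁ * a₂) * (x : ℂ)⁻¹ := by
      have e1 : (-(1 / 4) + m ^ 2) * ((x : ℂ)⁻¹ * ((x : ℂ)⁻¹ * (F x * F x))) +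
          (x : ℂ)⁻¹ * (F x * F₁ x) - F₁ x * F₁ x = 4 * m ^ 2 * (a₁ * a₂) *
          ((x : ℂ) ^ (1 / 2 - m) * (x : ℂ) ^ (1 / 2 + m)) * (x : ℂ)⁻¹ * (x : ℂ)⁻¹ := by
        simp only [hFdef, hF₁, powFun, powDeriv]
        ring
      rw [e1, hprod]
      field_simp
    simp only [Pi.add_apply, Pi.sub_apply, Pi.mul_apply]
    rw [e, inv_mul_cancel_left₀ hk, norm_inv, Complex.norm_real, Real.norm_of_nonneg hx0.le,
      Real.rpow_neg_one]
  have := (integrableOn_Ioi_rpow_iff one_pos).1 this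
  linarith

theorem eq_zero_of_memLp_boundaryFun {m κ c : ℂ} (hm0 : m ≠ 0) (hm : |m.re| < 1)
    (h : MemLp (fun x => c * boundaryFun m (OnePoint.some κ) x) 2 (volume.restrict (Ioi 1))) :
    c = 0 := by
  have e : (fun x => c * boundaryFun m (OnePoint.some κ) x) =
      fun x => c * powFun (1 / 2 - m) x + c * κ * powFun (1 / 2 + m) x := by
    ext x
    simp only [boundaryFun]
    ring
  rw [e] at h
  rcases mul_eq_zero.1 (mul_eq_zero_of_memLp hm0 h) with h0 | h0
  · exact h0
  · simp only [h0, zero_mul, add_zero] at h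
    exact eq_zero_of_memLp_powFun (by simp; linarith [(abs_lt.1 hm).2]) h

/-- The eigenvalue equation for finite `κ`. -/
theorem exists_of_mem_eigenvalues_some {m κ : ℂ} (hα : (m ^ 2).im = 0) (hm0 : m ≠ 0)
    (hm : |m.re| < 1)
    (hbb : ∀ x, 0 < x → wronskian (boundaryFun m (OnePoint.some κ)) (boundaryDeriv m κ)
      (fun x => conj (boundaryFun m (OnePoint.some κ) x))
      (fun x => conj (boundaryDeriv m κ x)) x = 0)
    {z : ℂ} (hz : z ∈ eigenvalues (almostHomOp m (OnePoint.some κ))) :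
    ∃ β : ℝ, 0 < β ∧ z = -4 * β ∧
      κ * (β : ℂ) ^ (-m) * Complex.Gamma (m + 1) + Complex.Gamma (1 - m) = 0 := by
  obtain ⟨β, hβ, hzβ, c, hc⟩ := exists_of_mem_eigenvalues hα hm (isHom_boundaryFun hm κ) hbb
    (fun c h => eq_zero_of_memLp_boundaryFun hm0 hm h) hz
  refine ⟨β, hβ, hzβ, ?_⟩
  have h1 := hc _ _ (isHom_powFun_plus hm)
  have h2 := hc _ _ (isHom_powFun_minus hm)
  have l1 := tendsto_nhds_unique h1 (((tendsto_wronskian_decaying_plus (abs_lt.1 hm).1 hβ).sub_const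
    (c * (2 * m))).congr' (by
      filter_upwards [self_mem_nhdsWithin] with x hx
      rw [wronskian_boundaryFun_plus m κ hx]))
  have l2 := tendsto_nhds_unique h2 (((tendsto_wronskian_decaying_minus (abs_lt.1 hm).2 hβ).sub_const
    (c * (-2 * m * κ))).congr' (by
      filter_upwards [self_mem_nhdsWithin] with x hx
      rw [wronskian_boundaryFun_minus m κ hx]))
  -- Eliminates the unknown constant `c` between the two matching conditions.
  linear_combination (-1 / 2) * l2 - κ / 2 * l1

theorem conj_powFun {x : ℝ} (hx : 0 < x) (w : ℂ) : conj (powFun w x) = powFun (conj w) x := by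
  rw [powFun, powFun, ofReal_cpow_eq_exp hx, ofReal_cpow_eq_exp hx, ← Complex.exp_conj, map_mul,
    Complex.conj_ofReal]

theorem conj_powDeriv {x : ℝ} (hx : 0 < x) (w : ℂ) : conj (powDeriv w x) = powDeriv (conj w) x := by
  have := conj_powFun hx w
  simp only [powFun] at this
  rw [powDeriv, map_div₀, map_mul, this, Complex.conj_ofReal]

theorem conj_half : conj (1 / 2 : ℂ) = 1 / 2 := by
  rw [map_div₀, map_one, map_ofNat]

/-- There are no eigenvalues if the boundary function is a multiple of `x^{1/2+m}`. -/
theorem eigenvalues_eq_empty {m : ℝ} (hm : |m| < 1) {κ : OnePoint ℂ} {a : ℝ} (ha : a ≠ 0)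
    (h : boundaryFun m κ = fun x => (a : ℂ) * powFun (1 / 2 + m) x) :
    eigenvalues (almostHomOp m κ) = ∅ := by
  have hm' : |(m : ℂ).re| < 1 := by simpa using hm
  have ha' : (a : ℂ) ≠ 0 := by exact_mod_cast ha
  have hp := isHom_powFun_plus hm'
  refine eq_empty_iff_forall_notMem.2 fun z hz => ?_
  have hb : IsHom ((m : ℂ) ^ 2) (boundaryFun m κ) (fun x => (a : ℂ) * powDeriv (1 / 2 + m) x) := by
    rw [h]
    exact ⟨(hp.isC2.const_mul (a : ℂ)).congr_second fun x => by ring,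
      fun ε hε => (hp.memLp ε hε).const_mul _⟩
  have hbb : ∀ x, 0 < x → wronskian (boundaryFun m κ) (fun x => (a : ℂ) * powDeriv (1 / 2 + m) x)
      (fun x => conj (boundaryFun m κ x))
      (fun x => conj ((a : ℂ) * powDeriv (1 / 2 + m) x)) x = 0 := by
    intro x hx
    simp only [h, wronskian, map_mul, conj_powFun hx, conj_powDeriv hx, map_add, conj_half,
      Complex.conj_ofReal]
    ring
  have hinf : ∀ c : ℂ, MemLp (fun x => c * boundaryFun m κ x) 2 (volume.restrict (Ioi 1)) →
      c = 0 := by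
    intro c hc
    have : c * a = 0 := by
      refine eq_zero_of_memLp_powFun (w := 1 / 2 + m) ?_ (by simpa [h, mul_assoc] using hc)
      simp
      linarith [(abs_lt.1 hm).1]
    exact (mul_eq_zero.1 this).resolve_right ha'
  obtain ⟨β, hβ, -, c, hc⟩ := exists_of_mem_eigenvalues
    (by rw [← Complex.ofReal_pow, Complex.ofReal_im]) hm' hb hbb hinf hz
  -- The boundary function has zero Wronskian with `x^{1/2+m}`, so the limit `2 β^{-m} Γ(1+m)` would
  -- have to be `0`.
  have h2 := tendsto_nhds_unique (hc _ _ hp)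
    ((tendsto_wronskian_decaying_plus (abs_lt.1 hm').1 hβ).congr' (by
      filter_upwards with x
      rw [h]
      simp only [wronskian]
      ring))
  refine mul_ne_zero (mul_ne_zero two_ne_zero (ofReal_cpow_ne_zero hβ _))
    (Complex.Gamma_ne_zero_of_re_pos ?_) h2.symm
  simp
  linarith [(abs_lt.1 hm).1]

end AlmostHomogeneous
end

/-! ### Solving the eigenvalue equation -/

noncomputable section

namespace AlmostHomogeneous

open scoped ComplexConjugate

/-- The eigenvalues for finite `κ` and a real boundary condition. -/
theorem mem_eigenvalues_iff_exists {m κ : ℂ} (hα : (m ^ 2).im = 0) (hm0 : m ≠ 0) (hm : |m.re| < 1)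
    (hbb : ∀ x, 0 < x → wronskian (boundaryFun m (OnePoint.some κ)) (boundaryDeriv m κ)
      (fun x => conj (boundaryFun m (OnePoint.some κ) x))
      (fun x => conj (boundaryDeriv m κ x)) x = 0) {z : ℂ} :
    z ∈ eigenvalues (almostHomOp m (OnePoint.some κ)) ↔ ∃ β : ℝ, 0 < β ∧ z = -4 * β ∧
      κ * (β : ℂ) ^ (-m) * Complex.Gamma (m + 1) + Complex.Gamma (1 - m) = 0 := by
  refine ⟨exists_of_mem_eigenvalues_some hα hm0 hm hbb, ?_⟩
  rintro ⟨β, hβ, rfl, h⟩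
  exact mem_eigenvalues_of_eq_zero hm0 hm hβ h

theorem mem_eigenvalues_real_iff {m κ : ℝ} (hm0 : m ≠ 0) (hm : |m| < 1) {z : ℂ} :
    z ∈ eigenvalues (almostHomOp (m : ℂ) (OnePoint.some (κ : ℂ))) ↔ ∃ β : ℝ, 0 < β ∧ z = -4 * β ∧
      κ * β ^ (-m) * Real.Gamma (m + 1) + Real.Gamma (1 - m) = 0 := by
  rw [mem_eigenvalues_iff_exists (by rw [← Complex.ofReal_pow, Complex.ofReal_im])
    (by exact_mod_cast hm0) (by simpa using hm) ?_]
  · refine exists_congr fun β => and_congr_right fun hβ => and_congr_right fun _ => ?_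
    have e1 : (β : ℂ) ^ (-(m : ℂ)) = ((β ^ (-m) : ℝ) : ℂ) := by
      rw [Complex.ofReal_cpow hβ.le, Complex.ofReal_neg]
    have e2 : Complex.Gamma (m + 1) = (Real.Gamma (m + 1) : ℂ) := by
      rw [← Complex.Gamma_ofReal, Complex.ofReal_add, Complex.ofReal_one]
    have e3 : Complex.Gamma (1 - m) = (Real.Gamma (1 - m) : ℂ) := by
      rw [← Complex.Gamma_ofReal, Complex.ofReal_sub, Complex.ofReal_one]
    rw [e1, e2, e3]
    exact_mod_cast Iff.rfl
  · intro x hx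
    simp only [boundaryFun, wronskian, map_add, map_sub, map_mul, conj_powDeriv hx, conj_half,
      Complex.conj_ofReal, show ∀ w : ℂ, conj ((x : ℂ) ^ w) = (x : ℂ) ^ (conj w) from
        conj_powFun hx]
    ring

/-- For `m ≠ 0` the eigenvalue equation would equate a nonnegative number plus a positive one to
`0`. For `m = 0` the boundary function degenerates to `(1 + κ) √x`, nonzero because `κ ≥ 0`. -/
theorem eigenvalues_some_eq_empty {m κ : ℝ} (hm : |m| < 1) (hκ : 0 ≤ κ) :
    eigenvalues (almostHomOp (m : ℂ) (OnePoint.some (κ : ℂ))) = ∅ := by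
  rcases eq_or_ne m 0 with rfl | hm0
  · refine eigenvalues_eq_empty hm (a := 1 + κ) (by positivity) ?_
    ext x
    simp only [boundaryFun, powFun]
    push_cast
    simp only [sub_zero, add_zero]
    ring
  · refine eq_empty_iff_forall_notMem.2 fun z hz => ?_
    obtain ⟨β, hβ, -, h⟩ := (mem_eigenvalues_real_iff hm0 hm).1 hz
    obtain ⟨h1, h2⟩ := abs_lt.1 hm
    have := Real.Gamma_pos_of_pos (show 0 < m + 1 by linarith)
    have := Real.Gamma_pos_of_pos (show 0 < 1 - m by linarith)
    have : 0 ≤ κ * β ^ (-m) * Real.Gamma (m + 1) := by positivity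
    linarith

theorem eigenvalues_infty_eq_empty {m : ℝ} (hm : |m| < 1) :
    eigenvalues (almostHomOp (m : ℂ) OnePoint.infty) = ∅ := by
  refine eigenvalues_eq_empty hm one_ne_zero ?_
  ext x
  simp only [boundaryFun, powFun, Complex.ofReal_one, one_mul]

theorem eigenvalues_of_neg {m κ : ℝ} (hm0 : m ≠ 0) (hm : |m| < 1) (hκ : κ < 0) :
    eigenvalues (almostHomOp (m : ℂ) (OnePoint.some (κ : ℂ))) =
      {((-4 * (κ * Real.Gamma m / Real.Gamma (-m)) ^ (1 / m) : ℝ) : ℂ)} := by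
  obtain ⟨h1, h2⟩ := abs_lt.1 hm
  have g1 := Real.Gamma_pos_of_pos (show 0 < m + 1 by linarith)
  have g2 := Real.Gamma_pos_of_pos (show 0 < 1 - m by linarith)
  have e1 := Real.Gamma_add_one hm0
  have e2 : Real.Gamma (1 - m) = -m * Real.Gamma (-m) := by
    rw [← Real.Gamma_add_one (neg_ne_zero.2 hm0), neg_add_eq_sub]
  -- Written with `Γ(1 ± m)`, which are positive, the quotient is visibly positive for `κ < 0`; the
  -- real power `q ^ (1/m)` is then the genuine root.
  have hq : κ * Real.Gamma m / Real.Gamma (-m) = -κ * Real.Gamma (m + 1) / Real.Gamma (1 - m) := by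
    rw [e1, e2]
    have : Real.Gamma (-m) ≠ 0 := fun h => by simp [e2, h] at g2
    field_simp
  have hq0 : 0 < κ * Real.Gamma m / Real.Gamma (-m) := by
    rw [hq]
    have : 0 < -κ := by linarith
    positivity
  set q := κ * Real.Gamma m / Real.Gamma (-m) with hqdef
  have key : ∀ β : ℝ, 0 < β →
      (κ * β ^ (-m) * Real.Gamma (m + 1) + Real.Gamma (1 - m) = 0 ↔ β = q ^ (1 / m)) := by
    intro β hβ
    have hβm : 0 < β ^ m := Real.rpow_pos_of_pos hβ m
    have s1 : κ * β ^ (-m) * Real.Gamma (m + 1) + Real.Gamma (1 - m) = 0 ↔ β ^ m = q := by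
      rw [Real.rpow_neg hβ.le, hq, eq_div_iff g2.ne']
      field_simp
      constructor <;> intro h <;> linarith
    rw [s1, one_div, ← Real.rpow_left_inj hβ.le (Real.rpow_nonneg hq0.le _) hm0,
      Real.rpow_inv_rpow hq0.le hm0]
  ext z
  rw [mem_eigenvalues_real_iff hm0 hm, mem_singleton_iff]
  constructor
  · rintro ⟨β, hβ, rfl, h⟩
    rw [(key β hβ).1 h]
    push_cast
    ring
  · rintro rfl
    have hβ := Real.rpow_pos_of_pos hq0 (1 / m)
    refine ⟨_, hβ, ?_, (key _ hβ).2 rfl⟩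
    push_cast
    ring

section Imaginary

variable {μ : ℝ}

/-- The functional equation moves a zero on the imaginary axis to the line `Re = 1`, where Gamma has
none. -/
theorem Gamma_I_mul_ne_zero (hμ : μ ≠ 0) : Complex.Gamma (Complex.I * μ) ≠ 0 := by
  intro h
  have h0 : Complex.I * μ ≠ 0 := by simpa using hμ
  have := Complex.Gamma_add_one _ h0
  rw [h, mul_zero] at this
  exact Complex.Gamma_ne_zero_of_re_pos (by simp) this

theorem eigenvalues_imaginary (hμ : μ ≠ 0) {κ : ℂ} (hκ : ‖κ‖ = 1) {α : ℝ}
    (hα : Complex.exp (Complex.I * α) =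
      Complex.Gamma (-(Complex.I * μ)) / (κ * Complex.Gamma (Complex.I * μ))) :
    eigenvalues (almostHomOp (Complex.I * μ) (OnePoint.some κ)) =
      Set.range fun n : ℤ => ((-4 * Real.exp (-((α + 2 * Real.pi * n) / μ)) : ℝ) : ℂ) := by
  set m : ℂ := Complex.I * μ with hm
  have hm0 : m ≠ 0 := by simpa [hm] using hμ
  have hκ0 : κ ≠ 0 := by
    rintro rfl
    simp at hκ
  have hcm : conj m = -m := by simp [hm]
  have hG : Complex.Gamma m ≠ 0 := Gamma_I_mul_ne_zero hμ
  have e1 := Complex.Gamma_add_one m hm0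
  have e2 : Complex.Gamma (1 - m) = -m * Complex.Gamma (-m) := by
    rw [← Complex.Gamma_add_one _ (neg_ne_zero.2 hm0), neg_add_eq_sub]
  have hμ' : (μ : ℂ) ≠ 0 := by exact_mod_cast hμ
  have key : ∀ β : ℝ, 0 < β →
      (κ * (β : ℂ) ^ (-m) * Complex.Gamma (m + 1) + Complex.Gamma (1 - m) = 0 ↔
        ∃ n : ℤ, β = Real.exp (-((α + 2 * Real.pi * n) / μ))) := by
    intro β hβ
    -- With `Γ(1 ± m) = ±m Γ(±m)` the common factor `m` cancels and the equation becomes `β^{-m} =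
    -- exp(iα)`. Its left side is `exp(-iμ log β)`, so `μ log β` is determined modulo `2π`.
    have s1 : κ * (β : ℂ) ^ (-m) * Complex.Gamma (m + 1) + Complex.Gamma (1 - m) = 0 ↔
        (β : ℂ) ^ (-m) = Complex.exp (Complex.I * α) := by
      rw [hα, eq_div_iff (mul_ne_zero hκ0 hG), e1, e2]
      constructor
      · intro h
        refine mul_left_cancel₀ hm0 ?_
        linear_combination h
      · intro h
        linear_combination m * h
    rw [s1, ofReal_cpow_eq_exp hβ, Complex.exp_eq_exp_iff_exists_int]
    constructor
    · rintro ⟨n, h⟩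
      refine ⟨n, ?_⟩
      rw [← Real.exp_log hβ]
      congr 1
      have : (Real.log β : ℂ) * μ = -(α + 2 * Real.pi * n) := by
        refine mul_left_cancel₀ Complex.I_ne_zero ?_
        rw [hm] at h
        linear_combination -h
      have : Real.log β * μ = -(α + 2 * Real.pi * n) := by exact_mod_cast this
      field_simp
      linarith
    · rintro ⟨n, rfl⟩
      refine ⟨n, ?_⟩
      rw [Real.log_exp, hm]
      push_cast
      field_simp
  have hbb : ∀ x, 0 < x → wronskian (boundaryFun m (OnePoint.some κ)) (boundaryDeriv m κ)
      (fun x => conj (boundaryFun m (OnePoint.some κ) x))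
      (fun x => conj (boundaryDeriv m κ x)) x = 0 := by
    intro x hx
    -- For imaginary `m`, conjugation exchanges the two powers, so `W(b, b̄)` is proportional to `1
    -- - |κ|²`: the condition `|κ| = 1` is self-adjointness.
    have h : wronskian (boundaryFun m (OnePoint.some κ)) (boundaryDeriv m κ)
        (fun x => conj (boundaryFun m (OnePoint.some κ) x))
        (fun x => conj (boundaryDeriv m κ x)) x = (1 - κ * conj κ) *
          wronskian (powFun (1 / 2 - m)) (powDeriv (1 / 2 - m)) (powFun (1 / 2 + m))
            (powDeriv (1 / 2 + m)) x := by
      simp only [boundaryFun, wronskian, map_add, map_sub, map_mul, conj_powDeriv hx, conj_half,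
        show ∀ w : ℂ, conj ((x : ℂ) ^ w) = (x : ℂ) ^ (conj w) from conj_powFun hx,
        hcm, sub_neg_eq_add, ← sub_eq_add_neg]
      ring
    rw [h, Complex.mul_conj', hκ]
    simp
  have hα' : (m ^ 2).im = 0 := by
    rw [hm, mul_pow, Complex.I_sq, ← Complex.ofReal_pow, neg_one_mul, ← Complex.ofReal_neg,
      Complex.ofReal_im]
  ext z
  rw [mem_eigenvalues_iff_exists hα' hm0 (by simp [hm]) hbb]
  constructor
  · rintro ⟨β, hβ, rfl, h⟩
    obtain ⟨n, rfl⟩ := (key β hβ).1 h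
    exact ⟨n, by push_cast; ring⟩
  · rintro ⟨n, rfl⟩
    exact ⟨_, Real.exp_pos _, by push_cast; ring, (key _ (Real.exp_pos _)).2 ⟨n, rfl⟩⟩

/-- The two Gamma values are complex conjugates, so the quotient has modulus `1` and its argument
serves as `α`. -/
theorem exists_exp_eq_Gamma_div (hμ : μ ≠ 0) {κ : ℂ} (hκ : ‖κ‖ = 1) :
    ∃ α : ℝ, Complex.exp (Complex.I * α) =
      Complex.Gamma (-(Complex.I * μ)) / (κ * Complex.Gamma (Complex.I * μ)) := by
  set u := Complex.Gamma (-(Complex.I * μ)) / (κ * Complex.Gamma (Complex.I * μ)) with hu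
  have hc : conj (Complex.I * μ) = -(Complex.I * μ) := by simp
  have h1 : ‖u‖ = 1 := by
    rw [hu, norm_div, norm_mul, hκ, one_mul, ← hc, Complex.Gamma_conj, Complex.norm_conj]
    exact div_self (norm_ne_zero_iff.2 (Gamma_I_mul_ne_zero hμ))
  refine ⟨Complex.arg u, ?_⟩
  have := Complex.norm_mul_exp_arg_mul_I u
  rwa [h1, Complex.ofReal_one, one_mul, mul_comm] at this

theorem infinite_setOf_lt_add_mul (a M : ℝ) {d : ℝ} (hd : d ≠ 0) :
    {n : ℤ | M < a + d * n}.Infinite := by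
  rcases hd.lt_or_gt with h | h
  · obtain ⟨N, hN⟩ := exists_int_lt ((M - a) / d)
    refine (Set.Iio_infinite N).mono fun n hn => ?_
    have hn : (n : ℝ) < N := by exact_mod_cast mem_Iio.1 hn
    have := (lt_div_iff_of_neg h).1 (hn.trans hN)
    simp only [mem_ofPred_eq]
    linarith
  · obtain ⟨N, hN⟩ := exists_int_gt ((M - a) / d)
    refine (Set.Ioi_infinite N).mono fun n hn => ?_
    have hn : (N : ℝ) < n := by exact_mod_cast mem_Ioi.1 hn
    have := (div_lt_iff₀ h).1 (hN.trans hn)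
    simp only [mem_ofPred_eq]
    linarith

theorem injective_eigenvalue (hμ : μ ≠ 0) (α : ℝ) :
    Function.Injective fun n : ℤ => -4 * Real.exp (-((α + 2 * Real.pi * n) / μ)) := by
  intro n k h
  have h1 := Real.exp_injective (mul_left_cancel₀ (by norm_num) h)
  have h2 := (div_left_inj' hμ).1 (neg_injective h1)
  have h3 := mul_left_cancel₀ (by positivity : 2 * Real.pi ≠ 0) (add_left_cancel h2)
  exact_mod_cast h3

theorem infinite_eigenvalues_lt (hμ : μ ≠ 0) {κ : ℂ} (hκ : ‖κ‖ = 1) (R : ℝ) :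
    {E : ℝ | E < R ∧ (E : ℂ) ∈ eigenvalues
      (almostHomOp (Complex.I * μ) (OnePoint.some κ))}.Infinite := by
  obtain ⟨α, hα⟩ := exists_exp_eq_Gamma_div hμ hκ
  -- An exponent larger than `|R|` suffices, since `exp t ≥ t + 1` gives `-4 exp t < -|R| ≤ R`.
  refine ((infinite_setOf_lt_add_mul (-α / μ) |R| (d := -2 * Real.pi / μ)
    (by simp [hμ, Real.pi_ne_zero])).image (injective_eigenvalue hμ α).injOn).mono ?_
  rintro _ ⟨n, hn, rfl⟩
  refine ⟨?_, ?_⟩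
  · have e : -α / μ + -2 * Real.pi / μ * n = -((α + 2 * Real.pi * n) / μ) := by ring
    rw [mem_ofPred_eq, e] at hn
    have := Real.add_one_le_exp (-((α + 2 * Real.pi * n) / μ))
    have := neg_abs_le R
    have := abs_nonneg R
    simp only
    linarith
  · rw [eigenvalues_imaginary hμ hκ hα]
    exact ⟨n, rfl⟩

theorem infinite_eigenvalues_Ioo (hμ : μ ≠ 0) {κ : ℂ} (hκ : ‖κ‖ = 1) {ε : ℝ} (hε : 0 < ε) :
    {E : ℝ | -ε < E ∧ E < 0 ∧ (E : ℂ) ∈ eigenvalues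
      (almostHomOp (Complex.I * μ) (OnePoint.some κ))}.Infinite := by
  obtain ⟨α, hα⟩ := exists_exp_eq_Gamma_div hμ hκ
  -- An `s` above `-log (ε/4)` gives `4 exp(-s) < ε`; injectivity of the parametrization turns
  -- infinitely many integers into infinitely many eigenvalues.
  refine ((infinite_setOf_lt_add_mul (α / μ) (-Real.log (ε / 4)) (d := 2 * Real.pi / μ)
    (by simp [hμ, Real.pi_ne_zero])).image (injective_eigenvalue hμ α).injOn).mono ?_
  rintro _ ⟨n, hn, rfl⟩
  have hpos := Real.exp_pos (-((α + 2 * Real.pi * n) / μ))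
  refine ⟨?_, ?_, ?_⟩
  · have e : α / μ + 2 * Real.pi / μ * n = (α + 2 * Real.pi * n) / μ := by ring
    rw [mem_ofPred_eq, e] at hn
    have := Real.exp_lt_exp.2 (neg_lt.1 hn)
    rw [Real.exp_log (by positivity)] at this
    simp only
    linarith
  · simp only
    linarith
  · rw [eigenvalues_imaginary hμ hκ hα]
    exact ⟨n, rfl⟩

end Imaginary

end AlmostHomogeneous

end

theorem mainTheorem10 :
    -- no eigenvalues for real `m` and `κ ∈ [0,∞]`
    (∀ m : ℝ, -1 < m → m < 1 →
      (∀ κ : ℝ, 0 ≤ κ →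
        AlmostHomogeneous.eigenvalues
          (AlmostHomogeneous.almostHomOp (m : ℂ) (OnePoint.some (κ : ℂ))) = ∅) ∧
      AlmostHomogeneous.eigenvalues
        (AlmostHomogeneous.almostHomOp (m : ℂ) OnePoint.infty) = ∅) ∧
    -- a single eigenvalue for real `m ≠ 0` and `κ < 0`
    (∀ m : ℝ, -1 < m → m < 1 → m ≠ 0 → ∀ κ : ℝ, κ < 0 →
      AlmostHomogeneous.eigenvalues
          (AlmostHomogeneous.almostHomOp (m : ℂ) (OnePoint.some (κ : ℂ))) =
        {((-4 * (κ * Real.Gamma m / Real.Gamma (-m)) ^ (1 / m) : ℝ) : ℂ)}) ∧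
    -- infinitely many eigenvalues, accumulating at `-∞` and `0`, for `m = i μ`, `|κ| = 1`
    (∀ μ : ℝ, μ ≠ 0 → ∀ κ : ℂ, ‖κ‖ = 1 →
      (∀ R : ℝ, {E : ℝ | E < R ∧ (E : ℂ) ∈ AlmostHomogeneous.eigenvalues
          (AlmostHomogeneous.almostHomOp (Complex.I * μ) (OnePoint.some κ))}.Infinite) ∧
      (∀ ε : ℝ, 0 < ε → {E : ℝ | -ε < E ∧ E < 0 ∧ (E : ℂ) ∈ AlmostHomogeneous.eigenvalues
          (AlmostHomogeneous.almostHomOp (Complex.I * μ) (OnePoint.some κ))}.Infinite) ∧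
      (∀ α : ℝ, Complex.exp (Complex.I * α) =
            Complex.Gamma (-(Complex.I * μ)) / (κ * Complex.Gamma (Complex.I * μ)) →
        AlmostHomogeneous.eigenvalues
            (AlmostHomogeneous.almostHomOp (Complex.I * μ) (OnePoint.some κ)) =
          Set.range fun n : ℤ =>
            ((-4 * Real.exp (-((α + 2 * Real.pi * n) / μ)) : ℝ) : ℂ))) := by
  refine ⟨fun m h1 h2 => ⟨fun κ hκ => ?_, ?_⟩, fun m h1 h2 hm0 κ hκ => ?_,
    fun μ hμ κ hκ => ⟨fun R => ?_, fun ε hε => ?_, fun α hα => ?_⟩⟩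
  · exact AlmostHomogeneous.eigenvalues_some_eq_empty (abs_lt.2 ⟨h1, h2⟩) hκ
  · exact AlmostHomogeneous.eigenvalues_infty_eq_empty (abs_lt.2 ⟨h1, h2⟩)
  · exact AlmostHomogeneous.eigenvalues_of_neg hm0 (abs_lt.2 ⟨h1, h2⟩) hκ
  · exact AlmostHomogeneous.infinite_eigenvalues_lt hμ hκ R
  · exact AlmostHomogeneous.infinite_eigenvalues_Ioo hμ hκ hε
  · exact AlmostHomogeneous.eigenvalues_imaginary hμ hκ hα
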